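/- **Setting.** For $c\ge 1$ let $T_c(x,y)=(cx+(c-1)y+1,\ (c+1)x+cy+1)$, $P_c^k=T_c^k(0,0)$ for $k\in\mathbb Z$, let $Q_c^+$ be the convex hull of $\{P_c^k\}_{k\in\mathbb Z}$ and $Q_c^-=-Q_c^+$. The translation surface $S_c$ is obtained from $Q_c^+\sqcup Q_c^-$ by gluing each edge $\overline{P_c^kP_c^{k+1}}$ of $Q_c^+$ to its image $\overline{(-P_c^k)(-P_c^{k+1})}$ under rotation by $\pi$ by a translation; it has the quotient topology, and its singular points are the images of the vertices. A saddle connection is a geodesic segment that joins singular points and has no singular point in its interior. Two paths with the same endpoints are homotopic if there is a homotopy between them that fixes the endpoints and does not pass through singular points at interior times; $[\gamma]$ is the class of $\gamma$. A homeomorphism $h_c:S_c\to S_1$ is canonical if it is induced by a homeomorphism $g:Q_c^+\to Q_1^+$ that maps each edge $\overline{P_c^kP_c^{k+1}}$ to $\overline{P_1^kP_1^{k+1}}$ (with $P_c^k\mapsto P_1^k$), preserving ratios of distances on each edge, and by the map $q\mapsto -g(-q)$ from $Q_c^-$ to $Q_1^-$. Let $\mathcal G^\pm=\langle A,B,C,-I\mid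 A^2=B^2=C^2=(-I)^2=I,\ -I \text{ central}\rangle\cong(\mathbb Z_2*\mathbb Z_2*\mathbb Z_2)\oplus\mathbb Z_2$, let $G\mapsto G_c\in \mathrm{GL}(2,\mathbb R)$ be the homomorphism with $$A_c=\begin{pmatrix}-1&0\\0&1\end{pmatrix},\quad B_c=\begin{pmatrix}-1&2\\0&1\end{pmatrix},\quad C_c=\begin{pmatrix}-c&c-1\\-c-1&c\end{pmatrix},\quad (-I)_c=-I,$$ and let $\mathcal G_c^\pm=\langle -I,A_c,D_c,E_c\rangle$ be its image, where $D=BA$ and $E=(-I)CB$, that is, $$D_c=\begin{pmatrix}1&2\\0&1\end{pmatrix},\quad E_c=\begin{pmatrix}-c&c+1\\-c-1&c+2\end{pmatrix}.$$ Directions are taken modulo rotation by $\pi$, as points of $\mathbb{RP}^1$. **Theorem (classification of saddle connections).** Let $c>1$. 1. There is exactly one continuous surjective map $\varphi_c:\mathbb{RP}^1\to\mathbb{RP}^1$ of degree one that satisfies $\varphi_c\circ G_c=G_1\circ\varphi_c$ for all $G\in\mathcal G^\pm$ and weakly preserves orientation (the image of a positively oriented triple is never a negatively oriented triple). There is a saddle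 connection of $S_c$ in the direction $\theta\in\mathbb{RP}^1$ if and only if there is a saddle connection of $S_1$ in the direction $\varphi_c(\theta)$. 2. Equivalently, there is a saddle connection of $S_c$ in the direction $\theta$ if and only if $\theta$ is the image of the horizontal direction or of the direction of slope one under an element of $\mathcal G_c^\pm$. 3. Canonical homeomorphisms exist, and for every canonical homeomorphism $h_c:S_c\to S_1$ the homotopy classes of saddle connections of $S_c$ and $S_1$ are identical: for every saddle connection $\sigma$ of $S_c$ there is a saddle connection $\sigma'\in h_c([\sigma])$ of $S_1$, and for every saddle connection $\sigma'$ of $S_1$ there is a saddle connection $\sigma\in h_c^{-1}([\sigma'])$ of $S_c$. -/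

import Mathlib

open scoped LinearAlgebra.Projectivization MatrixGroups

noncomputable section

namespace ParabolaSurface

/-! ### The polygons and the surfaces `S_c` -/

/-- The plane, as column vectors. -/
abbrev Plane : Type := Fin 2 → ℝ

/-- The affine map `T_c (x, y) = (c x + (c - 1) y + 1, (c + 1) x + c y + 1)`, with its inverse. -/
def T (c : ℝ) : Equiv.Perm Plane where
  toFun p := ![c * p 0 + (c - 1) * p 1 + 1, (c + 1) * p 0 + c * p 1 + 1]
  invFun p := ![c * (p 0 - 1) - (c - 1) * (p 1 - 1), -(c + 1) * (p 0 - 1) + c * (p 1 - 1)]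
  left_inv p := by
    funext i
    fin_cases i <;> simp <;> ring
  right_inv p := by
    funext i
    fin_cases i <;> simp <;> ring

/-- The vertices `P_c^k = T_c^k (0, 0)`, for `k ∈ ℤ`. -/
def vertex (c : ℝ) (k : ℤ) : Plane := (T c ^ k) 0

/-- The infinite polygon `Q_c^+`, the convex hull of the vertices. -/
def Qplus (c : ℝ) : Set Plane := convexHull ℝ (Set.range (vertex c))

/-- The infinite polygon `Q_c^-`, the image of `Q_c^+` under the rotation by `π`. -/
def Qminus (c : ℝ) : Set Plane := {q | -q ∈ Qplus c}

/-- The `k`-th edge of `Q_c^+`. -/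
def edge (c : ℝ) (k : ℤ) : Set Plane := segment ℝ (vertex c k) (vertex c (k + 1))

/-- The rotation by `π` from `Q_c^+` to `Q_c^-`. -/
def rot {c : ℝ} (p : Qplus c) : Qminus c := ⟨-p.1, by simp [Qminus]⟩

theorem vertex_mem (c : ℝ) (k : ℤ) : vertex c k ∈ Qplus c :=
  subset_convexHull ℝ _ ⟨k, rfl⟩

/-- The edge identifications: the `k`-th edge of `Q_c^+`, from `P_c^k` to `P_c^{k+1}`, is glued to
its image under the rotation by `π` through the translation by `-(P_c^k + P_c^{k+1})`. -/
inductive Glue (c : ℝ) : Qplus c ⊕ Qminus c → Qplus c ⊕ Qminus c → Prop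
  | edge (k : ℤ) (p : Qplus c) (q : Qminus c) (hp : p.1 ∈ edge c k)
      (hq : q.1 = p.1 - (vertex c k + vertex c (k + 1))) : Glue c (Sum.inl p) (Sum.inr q)

/-- The surface `S_c`, as the quotient of the disjoint union of `Q_c^+` and `Q_c^-` by the edge
identifications. -/
def S (c : ℝ) : Type := Quot (Glue c)

/-- `S_c` carries the quotient topology. -/
instance (c : ℝ) : TopologicalSpace (S c) :=
  inferInstanceAs (TopologicalSpace (Quot (Glue c)))

/-- The inclusion of `Q_c^+` into `S_c`. -/
def inPlus {c : ℝ} (p : Qplus c) : S c := Quot.mk (Glue c) (Sum.inl p)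

/-- The inclusion of `Q_c^-` into `S_c`. -/
def inMinus {c : ℝ} (q : Qminus c) : S c := Quot.mk (Glue c) (Sum.inr q)

/-- The set `Σ` of singular points of `S_c`: the points that come from vertices of the polygons.
(The vertices of `Q_c^-` are glued to vertices of `Q_c^+`.) -/
def singular (c : ℝ) : Set (S c) := Set.range fun k : ℤ => inPlus ⟨vertex c k, vertex_mem c k⟩

/-! ### Saddle connections -/

/-- `σ` is straight with constant velocity `v` during the times `a ≤ t ≤ b`, and stays
in one of the two polygons. -/
def StraightOn {c : ℝ} {x y : S c} (σ : Path x y) (v : Plane) (a b : ℝ) : Prop :=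
  ∃ p : Plane,
    (∀ t : unitInterval, a ≤ t → t ≤ b → ∃ h : p + (t : ℝ) • v ∈ Qplus c, σ t = inPlus ⟨_, h⟩) ∨
    (∀ t : unitInterval, a ≤ t → t ≤ b → ∃ h : p + (t : ℝ) • v ∈ Qminus c, σ t = inMinus ⟨_, h⟩)

/-- `σ`, parametrized by `[0, 1]` with constant velocity, is a saddle connection of `S_c` with
holonomy `v`: it joins singular points, it is not singular at interior times, and
`[0, 1]` can be cut into finitely many intervals, on each of which `σ` is a straight segment of
velocity `v` in one of the polygons. As the polygons are glued by translations,
and `σ` avoids the vertices at interior times, this says that `σ` is a geodesic. -/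
structure IsSaddleConnectionWith {c : ℝ} {x y : S c} (σ : Path x y) (v : Plane) : Prop where
  ne_zero : v ≠ 0
  source_mem : x ∈ singular c
  target_mem : y ∈ singular c
  interior_notMem : ∀ t : unitInterval, t ≠ 0 → t ≠ 1 → σ t ∉ singular c
  straight : ∃ (n : ℕ) (τ : Fin (n + 1) → ℝ), StrictMono τ ∧ τ 0 = 0 ∧ τ (Fin.last n) = 1 ∧
    ∀ i : Fin n, StraightOn σ v (τ i.castSucc) (τ i.succ)

/-- `σ` is a saddle connection. -/
def IsSaddleConnection {c : ℝ} {x y : S c} (σ : Path x y) : Prop :=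
  ∃ v : Plane, IsSaddleConnectionWith σ v

/-- The homotopy class `[γ]`: the paths homotopic to `γ` relative to the endpoints, by a homotopy
that does not meet the singular points at interior times. -/
def homotopyClass {c : ℝ} {x y : S c} (γ : Path x y) : Set (Path x y) :=
  {γ' | ∃ F : Path.Homotopy γ γ', ∀ s t : unitInterval, t ≠ 0 → t ≠ 1 → F (s, t) ∉ singular c}

/-! ### The canonical homeomorphisms -/

/-- `h : S_c → S_1` is a canonical homeomorphism: it is induced by a homeomorphism
`g : Q_c^+ → Q_1^+` that sends each edge to the corresponding edge (so the origin to the origin),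
preserving ratios of distances on each edge, and by the conjugate of `g` by the rotation
by `π` on `Q_c^-`. -/
def IsCanonicalHomeo {c : ℝ} (h : S c ≃ₜ S 1) : Prop :=
  ∃ g : Qplus c ≃ₜ Qplus 1,
    (∀ (k : ℤ) (t : unitInterval) (p : Qplus c),
      (p : Plane) = AffineMap.lineMap (vertex c k) (vertex c (k + 1)) (t : ℝ) →
      (g p : Plane) = AffineMap.lineMap (vertex 1 k) (vertex 1 (k + 1)) (t : ℝ)) ∧
    (∀ p : Qplus c, h (inPlus p) = inPlus (g p)) ∧
    (∀ p : Qplus c, h (inMinus (rot p)) = inMinus (rot (g p)))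

/-! ### Directions -/

/-- The real projective line: the directions in the plane modulo rotation by `π`. -/
abbrev RP1 : Type := ℙ ℝ Plane

/-- `RP1` carries the quotient topology. -/
instance : TopologicalSpace RP1 :=
  inferInstanceAs (TopologicalSpace (Quotient (projectivizationSetoid ℝ Plane)))

/-- There is a saddle connection of `S_c` in the direction `θ`. -/
def HasSaddleConnection (c : ℝ) (θ : RP1) : Prop :=
  ∃ (x y : S c) (σ : Path x y) (v : Plane) (hv : v ≠ 0),
    IsSaddleConnectionWith σ v ∧ Projectivization.mk ℝ v hv = θ

/-- The horizontal direction. -/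
def horizontal : RP1 := Projectivization.mk ℝ ![1, 0] (by simp)

/-- The direction of slope one. -/
def slopeOne : RP1 := Projectivization.mk ℝ ![1, 1] (by simp)

/-- The direction at angle `t` from the horizontal. -/
def dir (t : ℝ) : RP1 := Projectivization.mk ℝ ![Real.cos t, Real.sin t] (by
  intro h
  have h0 := congrFun h 0
  have h1 := congrFun h 1
  simp at h0 h1
  nlinarith [Real.sin_sq_add_cos_sq t])

/-- `(a, b, d)` is a positively oriented triple of `RP1`: going around `RP1` once
counterclockwise from `a`, one meets `b` and then `d` before one is back at `a`. -/
def PosOriented (a b d : RP1) : Prop :=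
  ∃ α β δ : ℝ, α < β ∧ β < δ ∧ δ < α + Real.pi ∧ dir α = a ∧ dir β = b ∧ dir δ = d

/-! ### The groups -/

/-- The matrix `A_c` (it does not depend on `c`). -/
def matA : GL (Fin 2) ℝ :=
  Matrix.GeneralLinearGroup.mkOfDetNeZero !![-1, 0; 0, 1] (by simp [Matrix.det_fin_two])

/-- The matrix `B_c` (it does not depend on `c`). -/
def matB : GL (Fin 2) ℝ :=
  Matrix.GeneralLinearGroup.mkOfDetNeZero !![-1, 2; 0, 1] (by simp [Matrix.det_fin_two])

/-- The matrix `C_c`. -/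
def matC (c : ℝ) : GL (Fin 2) ℝ :=
  Matrix.GeneralLinearGroup.mkOfDetNeZero !![-c, c - 1; -c - 1, c] (by
    rw [Matrix.det_fin_two_of]; ring_nf; norm_num)

/-- The matrix `D_c` (it does not depend on `c`). -/
def matD : GL (Fin 2) ℝ :=
  Matrix.GeneralLinearGroup.mkOfDetNeZero !![1, 2; 0, 1] (by simp [Matrix.det_fin_two])

/-- The matrix `E_c`. -/
def matE (c : ℝ) : GL (Fin 2) ℝ :=
  Matrix.GeneralLinearGroup.mkOfDetNeZero !![-c, c + 1; -c - 1, c + 2] (by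
    rw [Matrix.det_fin_two_of]; ring_nf; norm_num)

/-- The group `𝒢_c^± = ⟨-I, A_c, D_c, E_c⟩` of matrices. -/
def matGroup (c : ℝ) : Subgroup (GL (Fin 2) ℝ) :=
  Subgroup.closure {-1, matA, matD, matE c}

/-- Names of the generators `A`, `B`, `C`, `-I` of the abstract group `𝒢^±`. -/
inductive Gen : Type
  | A | B | C | negI

/-- The relations `A² = B² = C² = (-I)² = I`, and `-I` commutes with `A`, `B`, `C`. -/
inductive Rel : FreeGroup Gen → Prop
  | sq (x : Gen) : Rel (FreeGroup.of x * FreeGroup.of x)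
  | comm (x : Gen) : Rel (FreeGroup.of Gen.negI * FreeGroup.of x * (FreeGroup.of Gen.negI)⁻¹ * (FreeGroup.of x)⁻¹)

/-- The abstract group `𝒢^± = (ℤ₂ * ℤ₂ * ℤ₂) ⊕ ℤ₂`. -/
abbrev AbsGroup : Type := PresentedGroup {r | Rel r}

/-- The matrix of a generator. -/
def genMat (c : ℝ) : Gen → GL (Fin 2) ℝ
  | Gen.A => matA
  | Gen.B => matB
  | Gen.C => matC c
  | Gen.negI => -1

theorem genMat_rel (c : ℝ) (r : FreeGroup Gen) (hr : r ∈ {r | Rel r}) :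
    FreeGroup.lift (genMat c) r = 1 := by
  cases hr with
  | sq x =>
    ext i j
    cases x <;> fin_cases i <;> fin_cases j <;>
      simp [genMat, matA, matB, matC, Matrix.GeneralLinearGroup.mkOfDetNeZero,
        Matrix.mul_apply, Fin.sum_univ_two] <;> ring
  | comm x => simp [genMat]

/-- The representation `G ↦ G_c` of `𝒢^±`. -/
def rep (c : ℝ) : AbsGroup →* GL (Fin 2) ℝ := PresentedGroup.toGroup (genMat_rel c)

/-- `φ` has the properties of the semiconjugacy `φ_c : RP1 → RP1`: it is continuous and surjective,
of degree one (it lifts to a continuous map `F` of the universal cover `ℝ` that commutes with the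
deck translation by `π`), it satisfies `φ ∘ G_c = G_1 ∘ φ` for all `G ∈ 𝒢^±`, and it weakly
preserves orientation. -/
structure IsSemiconjugacy (c : ℝ) (φ : RP1 → RP1) : Prop where
  continuous : Continuous φ
  surjective : Function.Surjective φ
  degree_one : ∃ F : ℝ → ℝ, Continuous F ∧ (∀ t, F (t + Real.pi) = F t + Real.pi) ∧
    ∀ t, φ (dir t) = dir (F t)
  semiconj : ∀ (G : AbsGroup) (θ : RP1), φ (rep c G • θ) = rep 1 G • φ θ
  weakly_monotone : ∀ a b d : RP1, PosOriented a b d → ¬ PosOriented (φ d) (φ b) (φ a)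

end ParabolaSurface

end

open ParabolaSurface

namespace ParabolaSurface

/-! For `b < a` the direction of the diagonal from $P_c^b$ to $P_c^a$ depends only on `a + b`, and
it turns counterclockwise as `a + b` grows, for every $c\ge1$ (`cross_diag_pos`,
`cross_diag_eq_zero`). This order structure, in which `c` does not occur, is what the surfaces have
in common.

After $Q_c^-$ is rotated onto $Q_c^+$, a saddle connection is encoded by its initial vertex, its
direction, the list of edges that it crosses and its final vertex (`Realizes`). The polygons are
convex, so paths that cross the same edges are homotopic (`Follows.mem_homotopyClass`). The third
claim thus reduces to the statement that the realized lists do not depend on `c`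
(`Realizes.transfer`), and the second one to a description of their directions
(`InOrbit.of_realizes`, `InOrbit.exists_realizes`).

Both rest on a hidden symmetry. The segments between consecutive vertices of 0, 1, -1, 2, -2, … are
alternately of slope one and horizontal. They cut the polygons into triangles, and the two triangles
at an edge form a parallelogram of which the edge is a diagonal. The matrix $B_c$ negates horizontal
vectors and fixes vectors of slope one; it therefore flips each parallelogram and exchanges its
diagonals, and is the derivative of an automorphism of $S_c$ that the polygons do not show. Its
effect on lists of edges is purely combinatorial (`FlipRel`), and for directions between the
horizontal and slope one it shortens the list (`FlipRel.length_lt`). Powers of $T_c$ and the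
reflection $A_c$ bring every list with a crossing into this sector, so everything reduces to
diagonals by induction on the length (`Realizes.induction`).

For the first claim, use the chart $(x,1)$ of the projective line. The horizontal direction is
$\infty$, and $A,B,C$ act by $x\mapsto-x$, by $x\mapsto2-x$ and by an inversion with fixed points
$\kappa=(c-1)/(c+1)$ and $1$. A semiconjugacy becomes a function $f$ that commutes with the first
two maps and intertwines the inversions for $c$ and for $1$; orientation forces it to preserve
$[0,1]$ and to collapse $[0,\kappa]$ to $0$. On $[\kappa,1]$ the equation expresses $f$ by its
values outside of $(\kappa,1)$, so $f$ is a fixed point of an operator `step`. This operator sends a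
uniform distance $e$ to at most $e/(1+2e)$ (`abs_step_sub_le`), whence existence and uniqueness with
rate $1/(2n+1)$. The horizontal direction and slope one have only themselves as preimages
(`IsSemiconjugacy.eq_horizontal`, `IsProfile.map_eq_one`), so equivariance carries the directions of
saddle connections both ways. -/

/-- The determinant of two vectors of the plane. -/
def cross (u v : Plane) : ℝ := u 0 * v 1 - u 1 * v 0

theorem cross_sub_right (u v w : Plane) : cross u (v - w) = cross u v - cross u w := by
  simp [cross]; ring

theorem cross_smul_right (r : ℝ) (u v : Plane) : cross u (r • v) = r * cross u v := by
  simp [cross]; ring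

theorem cross_smul_left (r : ℝ) (u v : Plane) : cross (r • u) v = r * cross u v := by
  simp [cross]; ring

theorem cross_neg_left (u v : Plane) : cross (-u) v = -cross u v := by
  simp [cross]; ring

theorem cross_neg_right (u v : Plane) : cross u (-v) = -cross u v := by
  simp [cross]; ring

theorem cross_self (u : Plane) : cross u u = 0 := by
  simp [cross]; ring

theorem cross_swap (u v : Plane) : cross u v = -cross v u := by
  simp [cross]; ring

theorem plane_ext {u v : Plane} (h0 : u 0 = v 0) (h1 : u 1 = v 1) : u = v := by
  funext i; fin_cases i <;> assumption

theorem eq_smul_of_cross_eq_zero {u v : Plane} (hu : u ≠ 0) (h : cross u v = 0) :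
    ∃ t : ℝ, v = t • u := by
  have hn : u 0 * u 0 + u 1 * u 1 ≠ 0 := by
    intro h0
    apply hu
    apply plane_ext <;> simp <;> nlinarith [mul_self_nonneg (u 0), mul_self_nonneg (u 1)]
  unfold cross at h
  refine ⟨(u 0 * v 0 + u 1 * v 1) / (u 0 * u 0 + u 1 * u 1), plane_ext ?_ ?_⟩ <;>
    simp only [Pi.smul_apply, smul_eq_mul] <;> rw [div_mul_eq_mul_div, eq_div_iff hn]
  · linear_combination (-u 1) * h
  · linear_combination u 0 * h

/-! ### The vertices -/

theorem vertex_zero (c : ℝ) : vertex c 0 = 0 := by simp [vertex]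

theorem vertex_succ (c : ℝ) (k : ℤ) : vertex c (k + 1) = T c (vertex c k) := by
  rw [vertex, add_comm, zpow_one_add]; rfl

theorem vertex_succ_zero (c : ℝ) (k : ℤ) :
    vertex c (k + 1) 0 = c * vertex c k 0 + (c - 1) * vertex c k 1 + 1 := by
  rw [vertex_succ]; simp [T]

theorem vertex_succ_one (c : ℝ) (k : ℤ) :
    vertex c (k + 1) 1 = (c + 1) * vertex c k 0 + c * vertex c k 1 + 1 := by
  rw [vertex_succ]; simp [T]

/-- The reflection in the vertical axis conjugates $T_c$ to its inverse. The relation is symmetric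
in `k` and `-k`, so one inductive step serves both directions. -/
theorem vertex_neg (c : ℝ) (k : ℤ) :
    vertex c (-k) 0 = -vertex c k 0 ∧ vertex c (-k) 1 = vertex c k 1 := by
  have key : ∀ k : ℤ, (vertex c (-k) 0 = -vertex c k 0 ∧ vertex c (-k) 1 = vertex c k 1) →
      vertex c (-(k + 1)) 0 = -vertex c (k + 1) 0 ∧
        vertex c (-(k + 1)) 1 = vertex c (k + 1) 1 := by
    rintro k ⟨h0, h1⟩
    have e0 := vertex_succ_zero c (-(k + 1))
    have e1 := vertex_succ_one c (-(k + 1))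
    rw [show -(k + 1) + 1 = -k by ring] at e0 e1
    rw [vertex_succ_zero, vertex_succ_one]
    constructor
    · linear_combination (-c) * e0 + (c - 1) * e1 + c * h0 - (c - 1) * h1
    · linear_combination (c + 1) * e0 - c * e1 - (c + 1) * h0 + c * h1
  induction k using Int.induction_on with
  | zero => simp [vertex_zero]
  | succ n ih => exact key n ih
  | pred n ih =>
    rw [neg_neg] at ih
    have h := key n ⟨by rw [ih.1, neg_neg], ih.2.symm⟩
    constructor
    · have := h.1
      rw [show -((n : ℤ) + 1) = -n - 1 by ring] at this
      rw [this, show -(-(n : ℤ) - 1) = n + 1 by ring]; ring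
    · have := h.2
      rw [show -((n : ℤ) + 1) = -n - 1 by ring] at this
      rw [this, show -(-(n : ℤ) - 1) = n + 1 by ring]

/-- Together with `vertex_neg`, this is why the diagonal from `-k` to `k + 1` has slope one. -/
theorem vertex_step_one (c : ℝ) (k : ℤ) :
    vertex c (k + 1) 1 - vertex c k 1 = vertex c (k + 1) 0 + vertex c k 0 := by
  rw [vertex_succ_zero, vertex_succ_one]; ring

theorem vertex_nonneg {c : ℝ} (hc : 1 ≤ c) (n : ℕ) :
    (0 ≤ vertex c n 0 ∧ 0 ≤ vertex c n 1) := by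
  induction n with
  | zero => simp [vertex_zero]
  | succ n ih =>
    obtain ⟨h0, h1⟩ := ih
    push_cast
    rw [vertex_succ_zero, vertex_succ_one]
    have : 0 ≤ c - 1 := by linarith
    have : 0 ≤ c := by linarith
    constructor <;> positivity

theorem vertex_zero_step {c : ℝ} (hc : 1 ≤ c) (k : ℤ) :
    vertex c k 0 + 1 ≤ vertex c (k + 1) 0 := by
  have key : ∀ n : ℕ, vertex c n 0 + 1 ≤ vertex c ((n : ℤ) + 1) 0 := by
    intro n
    obtain ⟨h0, h1⟩ := vertex_nonneg hc n
    rw [vertex_succ_zero]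
    nlinarith [mul_nonneg (sub_nonneg.2 hc) h0, mul_nonneg (sub_nonneg.2 hc) h1]
  rcases le_or_gt 0 k with hk | hk
  · lift k to ℕ using hk
    exact key k
  · obtain ⟨n, hn⟩ : ∃ n : ℕ, (n : ℤ) = -(k + 1) := ⟨(-(k + 1)).toNat, by omega⟩
    have h := key n
    rw [hn, show -(k + 1) + 1 = -k by ring, (vertex_neg c (k + 1)).1, (vertex_neg c k).1] at h
    linarith

theorem vertex_zero_strictMono {c : ℝ} (hc : 1 ≤ c) : StrictMono fun k : ℤ => vertex c k 0 :=
  strictMono_int_of_lt_succ fun k => by have := vertex_zero_step hc k; linarith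

theorem vertex_zero_pos {c : ℝ} (hc : 1 ≤ c) {k : ℤ} (hk : 0 < k) : 0 < vertex c k 0 := by
  have := vertex_zero_strictMono hc hk
  simpa [vertex_zero] using this

theorem vertex_zero_nonneg {c : ℝ} (hc : 1 ≤ c) {k : ℤ} (hk : 0 ≤ k) : 0 ≤ vertex c k 0 := by
  rcases hk.eq_or_lt with rfl | h
  · simp [vertex_zero]
  · exact (vertex_zero_pos hc h).le

theorem vertex_injective {c : ℝ} (hc : 1 ≤ c) : Function.Injective (vertex c) := fun _ _ h =>
  (vertex_zero_strictMono hc).injective (congrFun h 0)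

theorem lt_of_step_pos {f : ℤ → ℝ} {a : ℤ} (h : ∀ k, a ≤ k → f k < f (k + 1)) :
    ∀ i j : ℤ, a ≤ i → i < j → f i < f j := by
  intro i j hi hij
  obtain ⟨n, rfl⟩ : ∃ n : ℕ, j = i + n + 1 := ⟨(j - i - 1).toNat, by omega⟩
  induction n with
  | zero => simpa using h i hi
  | succ n ih =>
    have := h (i + n + 1) (by omega)
    push_cast
    rw [show i + ((n : ℤ) + 1) + 1 = i + n + 1 + 1 by ring]
    exact (ih (by omega)).trans this

/-- Heights increase over nonnegative indices by `vertex_step_one`, and a negative `i` is replaced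
by its mirror image `-i < j`. -/
theorem vertex_one_lt {c : ℝ} (hc : 1 ≤ c) {i j : ℤ} (h1 : i < j) (h2 : 0 < i + j) :
    vertex c i 1 < vertex c j 1 := by
  have key : ∀ i j : ℤ, 0 ≤ i → i < j → vertex c i 1 < vertex c j 1 :=
    lt_of_step_pos (f := fun k => vertex c k 1) fun k hk => by
      have := vertex_step_one c k
      have := vertex_zero_nonneg hc hk
      have := vertex_zero_step hc k
      linarith
  rcases le_or_gt 0 i with hi | hi
  · exact key _ _ hi h1
  · rw [← (vertex_neg c i).2]
    exact key _ _ (by omega) (by omega)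

/-- The same argument with heights measured across the slope one direction; the mirror image of the
index `i` is now `1 - i`. -/
theorem vertex_diff_lt {c : ℝ} (hc : 1 ≤ c) {i j : ℤ} (h1 : i < j) (h2 : 1 < i + j) :
    vertex c i 1 - vertex c i 0 < vertex c j 1 - vertex c j 0 := by
  have step : ∀ k : ℤ, vertex c (k + 1) 1 - vertex c (k + 1) 0 =
      vertex c k 1 - vertex c k 0 + 2 * vertex c k 0 := fun k => by
    have := vertex_step_one c k
    linarith
  have key : ∀ i j : ℤ, 1 ≤ i → i < j →
      vertex c i 1 - vertex c i 0 < vertex c j 1 - vertex c j 0 :=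
    lt_of_step_pos (f := fun k => vertex c k 1 - vertex c k 0) fun k hk => by
      have := step k
      have := vertex_zero_pos hc (show 0 < k by omega)
      linarith
  rcases le_or_gt 1 i with hi | hi
  · exact key _ _ hi h1
  · have h := step (-i)
    have e : vertex c i 1 - vertex c i 0 = vertex c (-i + 1) 1 - vertex c (-i + 1) 0 := by
      rw [h, (vertex_neg c i).1, (vertex_neg c i).2]; ring
    rw [e]
    exact key _ _ (by omega) (by omega)

/-! ### The linear part of $T_c$ and the directions of the diagonals. -/

/-- The linear part of `T_c`. -/
def lin (c : ℝ) (u : Plane) : Plane := ![c * u 0 + (c - 1) * u 1, (c + 1) * u 0 + c * u 1]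

/-- The inverse of the linear part of `T_c`. -/
def linInv (c : ℝ) (u : Plane) : Plane := ![c * u 0 - (c - 1) * u 1, -(c + 1) * u 0 + c * u 1]

theorem lin_linInv (c : ℝ) (u : Plane) : lin c (linInv c u) = u := by
  apply plane_ext <;> simp [lin, linInv] <;> ring

theorem linInv_lin (c : ℝ) (u : Plane) : linInv c (lin c u) = u := by
  apply plane_ext <;> simp [lin, linInv] <;> ring

theorem cross_lin (c : ℝ) (u v : Plane) : cross (lin c u) (lin c v) = cross u v := by
  simp [lin, cross]; ring

theorem vertex_succ_sub (c : ℝ) (i j : ℤ) :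
    vertex c (i + 1) - vertex c (j + 1) = lin c (vertex c i - vertex c j) := by
  apply plane_ext
  · simp only [Pi.sub_apply, vertex_succ_zero]; simp [lin]; ring
  · simp only [Pi.sub_apply, vertex_succ_one]; simp [lin]; ring

/-- The reflection in the vertical axis. -/
def refl (u : Plane) : Plane := ![-u 0, u 1]

theorem vertex_neg' (c : ℝ) (k : ℤ) : vertex c (-k) = refl (vertex c k) :=
  plane_ext (by simp [refl, (vertex_neg c k).1]) (by simp [refl, (vertex_neg c k).2])

theorem cross_refl (u v : Plane) : cross (refl u) (refl v) = -cross u v := by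
  simp [refl, cross]; ring

theorem refl_sub (u v : Plane) : refl (u - v) = refl u - refl v := by
  apply plane_ext <;> simp [refl]; ring

theorem cross_diag_shift (c : ℝ) (a b i j e : ℤ) :
    cross (vertex c (a + e) - vertex c (b + e)) (vertex c (i + e) - vertex c (j + e)) =
      cross (vertex c a - vertex c b) (vertex c i - vertex c j) := by
  induction e using Int.induction_on with
  | zero => simp
  | succ n ih =>
    rw [← ih]; simp only [← add_assoc, vertex_succ_sub, cross_lin]
  | pred n ih =>
    rw [← ih]
    conv_rhs => rw [show a + -(n : ℤ) = a + (-n - 1) + 1 by ring,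
      show b + -(n : ℤ) = b + (-n - 1) + 1 by ring, show i + -(n : ℤ) = i + (-n - 1) + 1 by ring,
      show j + -(n : ℤ) = j + (-n - 1) + 1 by ring]
    simp only [vertex_succ_sub, cross_lin]

theorem vertex_sub_neg (c : ℝ) (k : ℤ) :
    vertex c k - vertex c (-k) = (2 * vertex c k 0) • ![1, 0] := by
  apply plane_ext
  · simp [(vertex_neg c k).1]; ring
  · simp [(vertex_neg c k).2]

theorem vertex_succ_sub_neg (c : ℝ) (k : ℤ) :
    vertex c (k + 1) - vertex c (-k) = (vertex c k 0 + vertex c (k + 1) 0) • ![1, 1] := by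
  apply plane_ext
  · simp [(vertex_neg c k).1]; ring
  · have := vertex_step_one c k
    simp [(vertex_neg c k).2]; linarith

theorem vertex_add_pos {c : ℝ} (hc : 1 ≤ c) {k : ℤ} (hk : 0 ≤ k) :
    0 < vertex c k 0 + vertex c (k + 1) 0 :=
  add_pos_of_nonneg_of_pos (vertex_zero_nonneg hc hk) (vertex_zero_pos hc (by omega))

/-- The linear part of $T_c$ has determinant one and shifts the indices, so `a + b` may be taken to
be 0 or 1. The first diagonal is then horizontal or of slope one, and the claim compares the heights
of two vertices above it. -/
theorem cross_diag_aux {c : ℝ} (hc : 1 ≤ c) {a b i j : ℤ} (hab : b < a) :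
    (j < i → a + b < i + j → 0 < cross (vertex c a - vertex c b) (vertex c i - vertex c j)) ∧
    (a + b = i + j → cross (vertex c a - vertex c b) (vertex c i - vertex c j) = 0) := by
  obtain ⟨e, he⟩ | ⟨e, he⟩ := Int.even_or_odd (a + b)
  · obtain ⟨k, rfl⟩ : ∃ k, a = k + e := ⟨a - e, by ring⟩
    obtain rfl : b = -k + e := by omega
    obtain ⟨i, rfl⟩ : ∃ k, i = k + e := ⟨i - e, by ring⟩
    obtain ⟨j, rfl⟩ : ∃ k, j = k + e := ⟨j - e, by ring⟩
    rw [cross_diag_shift, vertex_sub_neg, cross_smul_left]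
    have hk := vertex_zero_pos hc (show 0 < k by omega)
    constructor
    · intro h1 h2
      have := vertex_one_lt hc (show j < i by omega) (by omega)
      apply mul_pos (by linarith)
      simp [cross]; linarith
    · intro h
      obtain rfl : j = -i := by omega
      simp [cross, (vertex_neg c i).2]
  · obtain ⟨k, rfl⟩ : ∃ k, a = k + 1 + e := ⟨a - e - 1, by ring⟩
    obtain rfl : b = -k + e := by omega
    obtain ⟨i, rfl⟩ : ∃ k, i = k + 1 + e := ⟨i - e - 1, by ring⟩
    obtain ⟨j, rfl⟩ : ∃ k, j = k + e := ⟨j - e, by ring⟩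
    rw [cross_diag_shift, vertex_succ_sub_neg, cross_smul_left]
    have hk := vertex_add_pos hc (show 0 ≤ k by omega)
    constructor
    · intro h1 h2
      have := vertex_diff_lt hc (show j < i + 1 by omega) (by omega)
      apply mul_pos (by linarith)
      simp [cross]; linarith
    · intro h
      obtain rfl : j = -i := by omega
      rw [vertex_succ_sub_neg, cross_smul_right, cross_self]; simp

theorem cross_diag_pos {c : ℝ} (hc : 1 ≤ c) {a b i j : ℤ} (hab : b < a) (hij : j < i)
    (h : a + b < i + j) : 0 < cross (vertex c a - vertex c b) (vertex c i - vertex c j) :=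
  (cross_diag_aux hc hab).1 hij h

theorem cross_diag_eq_zero {c : ℝ} (hc : 1 ≤ c) {a b i j : ℤ} (hab : b < a) (h : a + b = i + j) :
    cross (vertex c a - vertex c b) (vertex c i - vertex c j) = 0 :=
  (cross_diag_aux hc hab).2 h

/-! ### Supporting half-planes of the polygon. -/

/-- The linear function whose nonnegativity says that a point is on the inner side of the `k`-th
edge. -/
def side (c : ℝ) (k : ℤ) (p : Plane) : ℝ :=
  cross (vertex c (k + 1) - vertex c k) (p - vertex c k)

theorem side_vertex_left (c : ℝ) (k : ℤ) : side c k (vertex c k) = 0 := by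
  simp [side, cross]

theorem side_vertex_right (c : ℝ) (k : ℤ) : side c k (vertex c (k + 1)) = 0 := cross_self _

/-- The edge is the diagonal with index sum `2 * k + 1`; the diagonal between `j` and `k` has a
smaller sum for `j < k` and a larger one for `j > k + 1`. -/
theorem side_vertex_pos {c : ℝ} (hc : 1 ≤ c) {k j : ℤ} (h1 : j ≠ k) (h2 : j ≠ k + 1) :
    0 < side c k (vertex c j) := by
  rcases lt_or_gt_of_ne h1 with h | h
  · have := cross_diag_pos hc h (show k < k + 1 by omega) (by omega)
    rw [side, ← neg_sub (vertex c k) (vertex c j), cross_neg_right, cross_swap]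
    simpa using this
  · exact cross_diag_pos hc (by omega) h (by omega)

theorem side_vertex_nonneg {c : ℝ} (hc : 1 ≤ c) (k j : ℤ) : 0 ≤ side c k (vertex c j) := by
  by_cases h1 : j = k
  · rw [h1, side_vertex_left]
  by_cases h2 : j = k + 1
  · rw [h2, side_vertex_right]
  exact (side_vertex_pos hc h1 h2).le

theorem side_comb (c : ℝ) (k : ℤ) (p q : Plane) {a b : ℝ} (h : a + b = 1) :
    side c k (a • p + b • q) = a * side c k p + b * side c k q := by
  obtain rfl : b = 1 - a := by linarith
  simp [side, cross]; ring

theorem side_nonneg {c : ℝ} (hc : 1 ≤ c) (k : ℤ) {p : Plane} (hp : p ∈ Qplus c) :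
    0 ≤ side c k p := by
  have hconv : Convex ℝ {p | 0 ≤ side c k p} := by
    intro p hp q hq a b ha hb hab
    simp only [Set.mem_ofPred_eq] at *
    rw [side_comb c k p q hab]
    positivity
  refine convexHull_min ?_ hconv hp
  rintro _ ⟨j, rfl⟩
  exact side_vertex_nonneg hc k j

/-- A function on `ℤ` that is strictly quasi-convex or strictly quasi-concave. -/
def QuasiConvexOrConcave (F : ℤ → ℝ) : Prop :=
  (∀ i j k, i < j → j < k → F j < F i ∨ F j < F k) ∨
  (∀ i j k, i < j → j < k → F i < F j ∨ F k < F j)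

/-- Along the vertices the ordinate is a strictly convex function of the abscissa. Hence a linear
function is strictly convex, strictly concave or, if `u 0 = 0`, strictly monotone along them. -/
theorem quasiConvexOrConcave_cross {c : ℝ} (hc : 1 ≤ c) {u : Plane} (hu : u ≠ 0) (a : Plane) :
    QuasiConvexOrConcave fun k => cross u (vertex c k - a) := by
  have key : ∀ i j k, i < j → j < k →
      (vertex c k 0 - vertex c j 0) * (vertex c j 1 - vertex c i 1) <
        (vertex c j 0 - vertex c i 0) * (vertex c k 1 - vertex c j 1) := by
    intro i j k hij hjk
    have := cross_diag_pos hc hij hjk (by omega)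
    simp [cross] at this; linarith
  have hx : ∀ i j, i < j → 0 < vertex c j 0 - vertex c i 0 := fun i j h =>
    sub_pos.2 (vertex_zero_strictMono hc h)
  have hF : ∀ i j, cross u (vertex c j - a) - cross u (vertex c i - a) =
      u 0 * (vertex c j 1 - vertex c i 1) - u 1 * (vertex c j 0 - vertex c i 0) := by
    intro i j; simp [cross]; ring
  rcases lt_trichotomy (u 0) 0 with h | h | h
  · right
    intro i j k hij hjk
    by_contra! hcon
    have h1 := hF i j
    have h2 := hF j k
    have := hx i j hij
    have := hx j k hjk
    have := key i j k hij hjk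
    nlinarith
  · left
    intro i j k hij hjk
    have h1 := hF i j
    have h2 := hF j k
    have h3 := hx i j hij
    have h4 := hx j k hjk
    have hu1 : u 1 ≠ 0 := fun h' => hu (plane_ext (by simpa using h) (by simpa using h'))
    simp only [h, zero_mul, zero_sub] at h1 h2
    rcases lt_or_gt_of_ne hu1 with h' | h'
    · right; nlinarith
    · left; nlinarith
  · left
    intro i j k hij hjk
    by_contra! hcon
    have h1 := hF i j
    have h2 := hF j k
    have := hx i j hij
    have := hx j k hjk
    have := key i j k hij hjk
    nlinarith

/-! ### Lines crossing the polygon -/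

/-- The oriented line on which `F` vanishes leaves the polygon through the `k`-th edge. -/
def OutEdge (F : ℤ → ℝ) (k : ℤ) : Prop := F k < 0 ∧ 0 < F (k + 1)

/-- The oriented line on which `F` vanishes leaves the polygon through the `m`-th vertex. -/
def OutVertex (F : ℤ → ℝ) (m : ℤ) : Prop := F m = 0 ∧ (F (m - 1) < 0 ∨ 0 < F (m + 1))

/-- The function that describes the line after the crossing of the `k`-th edge. -/
def crossed (F : ℤ → ℝ) (k : ℤ) (j : ℤ) : ℝ := F k + F (k + 1) - F j

/-- The line described by `F` crosses the edges in the list and then ends at the vertex `m`. -/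
def Exits : (ℤ → ℝ) → List ℤ → ℤ → Prop
  | F, [], m => OutVertex F m
  | F, k :: l, m => OutEdge F k ∧ Exits (crossed F k) l m

namespace QuasiConvexOrConcave

variable {F : ℤ → ℝ}

theorem crossed (hF : QuasiConvexOrConcave F) (k : ℤ) : QuasiConvexOrConcave (crossed F k) := by
  rcases hF with hF | hF
  · right
    intro a b d hab hbd
    have := hF a b d hab hbd
    simpa [ParabolaSurface.crossed] using this
  · left
    intro a b d hab hbd
    have := hF a b d hab hbd
    simpa [ParabolaSurface.crossed] using this

/-- A line leaves a convex set only once: a second exit would produce three indices whose middle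
value violates both the strict quasi-convexity and the quasi-concavity. The next two lemmas exclude
exits at vertices in the same way. -/
theorem outEdge_unique (hF : QuasiConvexOrConcave F) {j k : ℤ} (hj : OutEdge F j)
    (hk : OutEdge F k) : j = k := by
  have key : ∀ j k, OutEdge F j → OutEdge F k → ¬ j < k := by
    rintro j k ⟨h1, h2⟩ ⟨h3, h4⟩ h
    rcases (show j + 1 ≤ k by omega).eq_or_lt with rfl | h'
    · linarith
    rcases hF with hF | hF
    · rcases hF j (j + 1) k (by omega) h' <;> linarith
    · rcases hF (j + 1) k (k + 1) h' (by omega) <;> linarith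
  exact le_antisymm (not_lt.1 (key k j hk hj)) (not_lt.1 (key j k hj hk))

theorem not_outEdge_of_outVertex (hF : QuasiConvexOrConcave F) {m k : ℤ} (hm : OutVertex F m)
    (hk : OutEdge F k) : False := by
  obtain ⟨h0, hm⟩ := hm
  obtain ⟨h1, h2⟩ := hk
  rcases lt_trichotomy m k with h | rfl | h
  · rcases hF with hF | hF
    · rcases hm with hm | hm
      · rcases hF (m - 1) m k (by omega) h <;> linarith
      · rcases (show m + 1 ≤ k by omega).eq_or_lt with rfl | h'
        · linarith
        · rcases hF m (m + 1) k (by omega) h' <;> linarith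
    · rcases hF m k (k + 1) h (by omega) <;> linarith
  · linarith
  · rcases (show k + 1 ≤ m by omega).eq_or_lt with rfl | h'
    · linarith
    rcases hF with hF | hF
    · rcases hF k (k + 1) m (by omega) h' <;> linarith
    · rcases hm with hm | hm
      · rcases (show k + 1 ≤ m - 1 by omega).eq_or_lt with h3 | h3
        · rw [h3] at h2; linarith
        · rcases hF (k + 1) (m - 1) m h3 (by omega) <;> linarith
      · rcases hF (k + 1) m (m + 1) h' (by omega) <;> linarith

theorem outVertex_unique (hF : QuasiConvexOrConcave F) {m m' : ℤ} (hm : OutVertex F m)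
    (hm' : OutVertex F m') : m = m' := by
  have key : ∀ m m', OutVertex F m → OutVertex F m' → ¬ m < m' := by
    rintro m m' ⟨h0, hm⟩ ⟨h0', hm'⟩ h
    rcases hF with hF | hF
    · have : F (m + 1) ≤ 0 := by
        rcases (show m + 1 ≤ m' by omega).eq_or_lt with rfl | h'
        · linarith
        · rcases hF m (m + 1) m' (by omega) h' <;> linarith
      rcases hF (m - 1) m m' (by omega) h <;> rcases hm with hm | hm <;> linarith
    · have : 0 ≤ F (m' - 1) := by
        rcases (show m ≤ m' - 1 by omega).eq_or_lt with h' | h'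
        · rw [← h', h0]
        · rcases hF m (m' - 1) m' h' (by omega) <;> linarith
      rcases hF m m' (m' + 1) h (by omega) <;> rcases hm' with hm' | hm' <;> linarith
  exact le_antisymm (not_lt.1 (key m' m hm' hm)) (not_lt.1 (key m m' hm hm'))

/-- From `a` to `b` the sign goes from positive to negative, so on this stretch of the boundary the
line enters the polygon and cannot leave it as well. -/
theorem not_outEdge_between (hF : QuasiConvexOrConcave F) {a b k : ℤ} (ha : 0 < F a)
    (hb : F b < 0) (h1 : a ≤ k) (h2 : k + 1 ≤ b) (hk : OutEdge F k) : False := by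
  obtain ⟨h3, h4⟩ := hk
  have h5 : a ≠ k := by rintro rfl; linarith
  have h6 : k + 1 ≠ b := by rintro rfl; linarith
  rcases hF with hF | hF
  · rcases hF k (k + 1) b (by omega) (by omega) <;> linarith
  · rcases hF a k (k + 1) (by omega) (by omega) <;> linarith

theorem not_outVertex_between (hF : QuasiConvexOrConcave F) {a b m : ℤ} (ha : 0 < F a)
    (hb : F b < 0) (h1 : a ≤ m) (h2 : m ≤ b) (hm : OutVertex F m) : False := by
  obtain ⟨h0, hm⟩ := hm
  have h5 : a ≠ m := by rintro rfl; linarith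
  have h6 : m ≠ b := by rintro rfl; linarith
  rcases hF with hF | hF
  · rcases hm with hm | hm
    · rcases hF (m - 1) m b (by omega) (by omega) <;> linarith
    · rcases (show m + 1 ≤ b by omega).eq_or_lt with rfl | h'
      · linarith
      · rcases hF m (m + 1) b (by omega) h' <;> linarith
  · rcases hm with hm | hm
    · rcases (show a ≤ m - 1 by omega).eq_or_lt with rfl | h'
      · linarith
      · rcases hF a (m - 1) m h' (by omega) <;> linarith
    · rcases hF a m (m + 1) (by omega) (by omega) <;> linarith

/-- Two consecutive zeros mean that the line runs along an edge. The sign at any other vertex tells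
the direction of travel, hence the end of the edge that is the exit. -/
theorem neighbors_of_zeros (hF : QuasiConvexOrConcave F) {k v : ℤ} (h1 : F k = 0)
    (h2 : F (k + 1) = 0) :
    (0 < F v → 0 < F (k + 1 + 1)) ∧ (F v < 0 → F (k - 1) < 0) := by
  constructor
  · intro hv
    have hk : v ≠ k := by rintro rfl; linarith
    have hk' : v ≠ k + 1 := by rintro rfl; linarith
    rcases hF with hF | hF
    · rcases hF k (k + 1) (k + 1 + 1) (by omega) (by omega) <;> linarith
    · exfalso
      rcases lt_or_gt_of_ne hk with h | h
      · rcases hF v k (k + 1) h (by omega) <;> linarith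
      · rcases hF k (k + 1) v (by omega) (by omega) <;> linarith
  · intro hv
    have hk : v ≠ k := by rintro rfl; linarith
    have hk' : v ≠ k + 1 := by rintro rfl; linarith
    rcases hF with hF | hF
    · exfalso
      rcases lt_or_gt_of_ne hk with h | h
      · rcases hF v k (k + 1) h (by omega) <;> linarith
      · rcases hF k (k + 1) v (by omega) (by omega) <;> linarith
    · rcases hF (k - 1) k (k + 1) (by omega) (by omega) <;> linarith

end QuasiConvexOrConcave

/-! ### The zigzag through the vertices -/

/-- The enumeration `0, 1, -1, 2, -2, …` of the vertices. -/
def zig (n : ℤ) : ℤ := if Even n then -(n / 2) else (n + 1) / 2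

/-- The edge that joins the vertices `zig (n - 1)` and `zig (n + 1)`. -/
def zigEdge (n : ℤ) : ℤ := if Even n then n / 2 else -((n + 1) / 2)

/-- The parity of `n`, as a sign. -/
def sgn (n : ℤ) : ℝ := if Even n then 1 else -1

theorem zig_even {n i : ℤ} (h : n = 2 * i) : zig n = -i := by
  subst h; simp [zig]

theorem zig_odd {n i : ℤ} (h : n = 2 * i + 1) : zig n = i + 1 := by
  subst h
  rw [zig, if_neg (by simp)]; omega

theorem zigEdge_even {n i : ℤ} (h : n = 2 * i) : zigEdge n = i := by
  subst h; simp [zigEdge]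

theorem zigEdge_odd {n i : ℤ} (h : n = 2 * i + 1) : zigEdge n = -i - 1 := by
  subst h
  rw [zigEdge, if_neg (by simp)]; omega

theorem sgn_even {n i : ℤ} (h : n = 2 * i) : sgn n = 1 := by
  subst h; simp [sgn]

theorem sgn_odd {n i : ℤ} (h : n = 2 * i + 1) : sgn n = -1 := by
  subst h; simp [sgn]

theorem sgn_add_one (n : ℤ) : sgn (n + 1) = -sgn n := by
  obtain ⟨i, h | h⟩ := Int.even_or_odd' n
  · rw [sgn_even h, sgn_odd (i := i) (by omega)]
  · rw [sgn_odd h, sgn_even (i := i + 1) (by omega)]; simp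

theorem sgn_sub_one (n : ℤ) : sgn (n - 1) = -sgn n := by
  have := sgn_add_one (n - 1)
  rw [sub_add_cancel] at this
  linarith

theorem sgn_eq (n : ℤ) : sgn n = 1 ∨ sgn n = -1 := by
  unfold sgn; split_ifs <;> simp

/-- The parallelogram with index 0 is degenerate: the edge `zigEdge 0` has slope one and is itself a
segment of the zigzag. The special treatment of `n = 0` below comes from this. -/
theorem zig_neg_one : zig (-1) = zig 0 := by
  rw [zig_odd (n := -1) (i := -1) (by omega), zig_even (n := 0) (i := 0) (by omega)]; rfl

theorem exists_zig (k : ℤ) : ∃ n, 0 ≤ n ∧ zig n = k := by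
  rcases le_or_gt k 0 with h | h
  · exact ⟨2 * (-k), by omega, by rw [zig_even rfl]; ring⟩
  · exact ⟨2 * (k - 1) + 1, by omega, by rw [zig_odd rfl]; ring⟩

theorem exists_zigEdge (k : ℤ) : ∃ n, 0 ≤ n ∧ zigEdge n = k := by
  rcases le_or_gt 0 k with h | h
  · exact ⟨2 * k, by omega, zigEdge_even rfl⟩
  · exact ⟨2 * (-k - 1) + 1, by omega, by rw [zigEdge_odd rfl]; ring⟩

theorem zig_inj {i j : ℤ} (hi : 0 ≤ i) (hj : 0 ≤ j) (h : zig i = zig j) : i = j := by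
  simp only [zig, Int.even_iff] at h
  split_ifs at h <;> omega

theorem zigEdge_inj {i j : ℤ} (hi : 0 ≤ i) (hj : 0 ≤ j) (h : zigEdge i = zigEdge j) : i = j := by
  simp only [zigEdge, Int.even_iff] at h
  split_ifs at h <;> omega

/-- The parity of `n` decides which of the two neighbours on the zigzag is the first end of the
edge; the sign `sgn` absorbs this in later statements. -/
theorem zigEdge_ends (n : ℤ) :
    (sgn n = 1 ∧ zigEdge n = zig (n - 1) ∧ zigEdge n + 1 = zig (n + 1)) ∨
    (sgn n = -1 ∧ zigEdge n = zig (n + 1) ∧ zigEdge n + 1 = zig (n - 1)) := by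
  obtain ⟨i, h | h⟩ := Int.even_or_odd' n
  · left
    rw [zigEdge_even h, zig_odd (n := n + 1) (i := i) (by omega), zig_odd (n := n - 1) (i := i - 1) (by omega)]
    exact ⟨sgn_even h, by ring, rfl⟩
  · right
    rw [zigEdge_odd h, zig_even (n := n + 1) (i := i + 1) (by omega),
      zig_even (n := n - 1) (i := i) (by omega)]
    exact ⟨sgn_odd h, by ring, by ring⟩

theorem outEdge_zigEdge {F : ℤ → ℝ} {n : ℤ} :
    OutEdge F (zigEdge n) ↔ sgn n * F (zig (n - 1)) < 0 ∧ 0 < sgn n * F (zig (n + 1)) := by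
  rcases zigEdge_ends n with ⟨h1, h2, h3⟩ | ⟨h1, h2, h3⟩
  · rw [OutEdge, h1, h3, h2]; simp
  · rw [OutEdge, h1, h3, h2]
    simp [and_comm]

theorem crossed_zigEdge (F : ℤ → ℝ) (n j : ℤ) :
    crossed F (zigEdge n) j = F (zig (n - 1)) + F (zig (n + 1)) - F j := by
  rcases zigEdge_ends n with ⟨-, h2, h3⟩ | ⟨-, h2, h3⟩
  · rw [crossed, h3, h2]
  · rw [crossed, h3, h2]; ring

theorem outVertex_zig {F : ℤ → ℝ} {n δ : ℤ} (hδ : δ = 1 ∨ δ = -1) (h0 : F (zig (n + δ)) = 0)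
    (h : sgn n * δ * F (zig (n - δ)) < 0) : OutVertex F (zig (n + δ)) := by
  refine ⟨h0, ?_⟩
  rcases hδ with rfl | rfl <;>
    rcases zigEdge_ends n with ⟨h1, h2, h3⟩ | ⟨h1, h2, h3⟩ <;> rw [h1] at h <;>
    push_cast at h
  · left; rw [← h3, add_sub_cancel_right, h2]; linarith
  · right; rw [← h2, h3]; linarith
  · right; rw [← sub_eq_add_neg, ← h2, h3]; simp at h; linarith
  · left; rw [← sub_eq_add_neg, ← h3, add_sub_cancel_right, h2]; simp at h; linarith

/-- The combinatorial relation between the sequence of edges `l` (with end vertex `m`) that a line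
crosses, and the sequence `l'` (with end vertex `m'`) crossed by its image under the automorphism
that flips the parallelograms around the edges: the lines walk through the parallelograms, and one
of them crosses each edge `zigEdge n` on the way while the other crosses only those where the walk
turns. -/
inductive FlipRel : ℤ → ℤ → List ℤ → ℤ → List ℤ → ℤ → Prop
  | halt (n δ : ℤ) (hn : 0 ≤ n) (hδ : 0 ≤ n + δ) :
    FlipRel n δ [] (zig (n + δ)) [zigEdge n] (zig n)
  | go (n δ : ℤ) (l : List ℤ) (m : ℤ) (l' : List ℤ) (m' : ℤ) (hn : 0 ≤ n) (hδ : 0 ≤ n + δ)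
    (h : FlipRel (n + δ) δ l m l' m') : FlipRel n δ l m (zigEdge n :: l') m'
  | turn (n δ : ℤ) (l : List ℤ) (m : ℤ) (l' : List ℤ) (m' : ℤ) (hn : 0 ≤ n)
    (h : FlipRel (n - δ) (-δ) l m l' m') : FlipRel n δ (zigEdge n :: l) m (zigEdge n :: l') m'

namespace FlipRel

/-- The rule `turn` lengthens both lists, `go` only the second, and `halt` gives the second one edge
more. This descent drives `Realizes.induction`. -/
theorem length_lt {n δ : ℤ} {l l' : List ℤ} {m m' : ℤ} (h : FlipRel n δ l m l' m') :
    l.length < l'.length := by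
  induction h <;> simp <;> omega

/-- Until its first turn the walk moves in the direction `δ`, so the next edge of `l`, or the final
vertex, has a zigzag index at or past the current position. -/
theorem beyond {n δ : ℤ} {l l' : List ℤ} {m m' : ℤ} (hδ : δ = 1 ∨ δ = -1)
    (h : FlipRel n δ l m l' m') :
    (l = [] ∧ ∃ j, 0 ≤ j ∧ m = zig j ∧ 1 ≤ δ * (j - n)) ∨
    (∃ j t, 0 ≤ j ∧ l = zigEdge j :: t ∧ 0 ≤ δ * (j - n)) := by
  induction h with
  | halt n δ h1 h2 => left; exact ⟨rfl, _, h2, rfl, by rcases hδ with rfl | rfl <;> omega⟩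
  | go n δ l m l' m' h1 h2 h ih =>
    rcases ih hδ with ⟨rfl, j, h3, h4, h5⟩ | ⟨j, t, h3, h4, h5⟩
    · left; exact ⟨rfl, j, h3, h4, by rcases hδ with rfl | rfl <;> omega⟩
    · right; exact ⟨j, t, h3, h4, by rcases hδ with rfl | rfl <;> omega⟩
  | turn n δ l m l' m' h1 h ih => right; exact ⟨n, l, h1, rfl, by simp⟩

/-- By `beyond`, the head of `l` or the final vertex decides at which index the rule `go` gives way
to `turn` or `halt`. So the flip of a list is the same on every surface. -/
theorem functional {n δ : ℤ} {l l₁ l₂ : List ℤ} {m m₁ m₂ : ℤ} (hδ : δ = 1 ∨ δ = -1)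
    (h₁ : FlipRel n δ l m l₁ m₁) (h₂ : FlipRel n δ l m l₂ m₂) : l₁ = l₂ ∧ m₁ = m₂ := by
  induction h₁ generalizing l₂ m₂ with
  | halt n δ h1 h2 =>
    generalize hm : zig (n + δ) = m at h₂
    generalize hl : ([] : List ℤ) = l at h₂
    cases h₂ with
    | halt => exact ⟨rfl, rfl⟩
    | go _ _ _ _ _ _ h3 h4 h =>
      rcases beyond hδ h with ⟨-, j, hj, e, h5⟩ | ⟨j, t, -, e, -⟩
      · rw [e] at hm
        have := zig_inj h2 hj hm
        rcases hδ with rfl | rfl <;> omega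
      · rw [e] at hl; cases hl
    | turn => cases hl
  | go n δ l m l' m' h1 h2 h ih =>
    cases h₂ with
    | halt =>
      rcases beyond hδ h with ⟨-, j, hj, e, h5⟩ | ⟨j, t, -, e, -⟩
      · have := zig_inj h2 hj e
        rcases hδ with rfl | rfl <;> omega
      · cases e
    | go _ _ _ _ _ _ h3 h4 h' =>
      obtain ⟨rfl, rfl⟩ := ih hδ h'
      exact ⟨rfl, rfl⟩
    | turn _ _ _ _ _ _ h3 h' =>
      rcases beyond hδ h with ⟨e, -⟩ | ⟨j, t, hj, e, h5⟩
      · cases e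
      · have := zigEdge_inj h1 hj (List.cons.inj e).1
        rcases hδ with rfl | rfl <;> omega
  | turn n δ l m l' m' h1 h ih =>
    generalize hl : zigEdge n :: l = l0 at h₂
    cases h₂ with
    | halt => cases hl
    | go _ _ _ _ _ _ h3 h4 h' =>
      rcases beyond hδ h' with ⟨e, -⟩ | ⟨j, t, hj, e, h5⟩
      · rw [e] at hl; cases hl
      · rw [e] at hl
        have := zigEdge_inj h1 hj (List.cons.inj hl).1
        rcases hδ with rfl | rfl <;> omega
    | turn _ _ _ _ _ _ h3 h' =>
      obtain rfl := (List.cons.inj hl).2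
      obtain ⟨rfl, rfl⟩ := ih (by rcases hδ with rfl | rfl <;> simp) h'
      exact ⟨rfl, rfl⟩

end FlipRel

/-- `F` and `G` describe the positions, in the parallelogram around the edge `zigEdge n`, of a line
and of its image under the flip of the parallelograms. The walk of the lines arrives at `n` from
`n - δ`. -/
structure Flipped (q F G : ℤ → ℝ) (n δ : ℤ) : Prop where
  pos : ∀ j, 1 ≤ j → 0 < q j
  stepF : ∀ j, 1 ≤ j → F (zig j) - F (zig (j - 1)) = δ * sgn j * q j
  stepG : ∀ j, 1 ≤ j → G (zig j) - G (zig (j - 1)) = sgn n * q j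
  left : F (zig n) = -G (zig (n - δ))
  right : F (zig (n - δ)) = -G (zig n)
  delta : δ = 1 ∨ δ = -1
  nonneg : 0 ≤ n
  nonneg_sub : 0 ≤ n - δ

/-- The rotation around the midpoint of an edge exchanges its ends. -/
theorem crossed_zig_add {F : ℤ → ℝ} {n δ : ℤ} (hδ : δ = 1 ∨ δ = -1) :
    crossed F (zigEdge n) (zig (n + δ)) = F (zig (n - δ)) := by
  rw [crossed_zigEdge]
  rcases hδ with rfl | rfl
  · ring
  · rw [← sub_eq_add_neg, sub_neg_eq_add]; ring

theorem crossed_zig_sub {F : ℤ → ℝ} {n δ : ℤ} (hδ : δ = 1 ∨ δ = -1) :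
    crossed F (zigEdge n) (zig (n - δ)) = F (zig (n + δ)) := by
  have := crossed_zig_add (F := F) (n := n) (δ := -δ) (by omega)
  rwa [sub_neg_eq_add, ← sub_eq_add_neg] at this

theorem sgn_add_delta {n δ : ℤ} (hδ : δ = 1 ∨ δ = -1) : sgn (n + δ) = -sgn n := by
  rcases hδ with rfl | rfl
  · exact sgn_add_one n
  · exact sgn_sub_one n

theorem sgn_sub_delta {n δ : ℤ} (hδ : δ = 1 ∨ δ = -1) : sgn (n - δ) = -sgn n :=
  sgn_add_delta (by omega : -δ = 1 ∨ -δ = -1)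

theorem sgn_mul_self (n : ℤ) : sgn n * sgn n = 1 := by
  rcases sgn_eq n with h | h <;> simp [h]

/-- If `sgn n * G` decreases along the zigzag, then a line that passes through the vertex `zig n`
leaves the polygon there. -/
theorem exits_iff_of_antitone {G' : ℤ → ℝ} {n : ℤ} (hn : 0 ≤ n)
    (mono : ∀ {i j : ℤ}, 0 ≤ i → i < j → sgn n * G' (zig j) < sgn n * G' (zig i))
    (h0 : G' (zig n) = 0) {l : List ℤ} {m : ℤ} : Exits G' l m ↔ l = [] ∧ m = zig n := by
  have hout : OutVertex G' (zig n) := by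
    have := outVertex_zig (F := G') (n := n + 1) (δ := -1) (by simp) (by simpa using h0) (by
      have := mono hn (show n < n + 1 - -1 by omega)
      rw [h0] at this
      rw [sgn_add_one]; push_cast; linarith)
    simpa using this
  constructor
  · intro hex
    cases l with
    | nil =>
      refine ⟨rfl, ?_⟩
      obtain ⟨j, hj, rfl⟩ := exists_zig m
      have e := hex.1
      congr 1
      rcases lt_trichotomy j n with h3 | h3 | h3
      · have := mono hj h3
        rw [h0, e] at this; simp at this
      · exact h3
      · have := mono hn h3
        rw [h0, e] at this; simp at this
    | cons k t =>
      exfalso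
      obtain ⟨j, hj, rfl⟩ := exists_zigEdge k
      obtain ⟨h3, h4⟩ := outEdge_zigEdge.1 hex.1
      -- The maximum replaces the index -1, another name of the vertex `zig 0`, so that monotonicity
      -- on nonnegative indices applies.
      have h3' : sgn j * G' (zig (max (j - 1) 0)) < 0 := by
        rcases hj.eq_or_lt with rfl | hj
        · rw [zero_sub, zig_neg_one] at h3; simpa using h3
        · rwa [max_eq_left (by omega)]
      have hsgn : sgn j = -sgn n := by
        by_contra hne
        have : sgn j = sgn n := by
          rcases sgn_eq j with h5 | h5 <;> rcases sgn_eq n with h6 | h6 <;> simp_all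
        rw [this] at h3' h4
        have := mono (show 0 ≤ max (j - 1) 0 by omega) (show max (j - 1) 0 < j + 1 by omega)
        linarith
      -- Opposite parity rules out `j = n`, so the zero at `zig n` does not lie strictly between the
      -- ends of the edge along the zigzag.
      have hpar : (j - n) % 2 = 1 := by
        obtain ⟨a, ha | ha⟩ := Int.even_or_odd' j <;> obtain ⟨b, hb | hb⟩ := Int.even_or_odd' n
        · rw [sgn_even ha, sgn_even hb] at hsgn; norm_num at hsgn
        · omega
        · omega
        · rw [sgn_odd ha, sgn_odd hb] at hsgn; norm_num at hsgn
      rw [hsgn] at h3' h4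
      rcases lt_or_ge n (j + 1) with h5 | h5
      · have h6 : n ≤ max (j - 1) 0 := by omega
        rcases h6.eq_or_lt with h7 | h7
        · rw [← h7, h0] at h3'; simp at h3'
        · have := mono hn h7
          rw [h0] at this; linarith
      · rcases h5.eq_or_lt with h7 | h7
        · rw [h7, h0] at h4; simp at h4
        · have := mono (by omega) h7
          rw [h0] at this; linarith
  · rintro ⟨rfl, rfl⟩
    exact hout

namespace Flipped

variable {q F G : ℤ → ℝ} {n δ : ℤ}

/-- The steps in `stepG` all have the same sign: the line described by `G` has a direction between
those of the two kinds of zigzag segments and orders the vertices along the zigzag. -/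
theorem mono (h : Flipped q F G n δ) {i j : ℤ} (hi : 0 ≤ i) (hij : i < j) :
    sgn n * G (zig i) < sgn n * G (zig j) := by
  refine lt_of_step_pos (f := fun k => sgn n * G (zig k)) (a := 0) ?_ i j hi hij
  intro k hk
  have h1 := h.stepG (k + 1) (by omega)
  have h2 := h.pos (k + 1) (by omega)
  rw [add_sub_cancel_right] at h1
  rcases sgn_eq n with e | e <;> rw [e] at h1 ⊢ <;> linarith

theorem mono_le (h : Flipped q F G n δ) {i j : ℤ} (hi : 0 ≤ i) (hij : i ≤ j) :
    sgn n * G (zig i) ≤ sgn n * G (zig j) := by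
  rcases hij.eq_or_lt with rfl | h'
  · rfl
  · exact (h.mono hi h').le

/-- The relation at a third corner of the parallelogram. Its partner is the corner opposite to `zig
n`, the rotated copy of `zig n` behind the edge; therefore `crossed` appears. -/
theorem zig_add (h : Flipped q F G n δ) :
    F (zig (n + δ)) = -crossed G (zigEdge n) (zig n) := by
  rw [crossed_zigEdge]
  have h1 := h.left
  have h2 := h.right
  have h4 := h.nonneg
  obtain rfl | rfl := h.delta
  · have h3 := h.stepF (n + 1) (by omega)
    have h5 := h.stepG (n + 1) (by omega)
    rw [add_sub_cancel_right] at h3 h5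
    rw [sgn_add_one] at h3
    push_cast at h3
    linarith
  · rw [sub_neg_eq_add] at h1 h2
    rw [← sub_eq_add_neg]
    rcases h4.eq_or_lt with rfl | h4
    · have := zig_neg_one
      simp only [zero_sub, this] at *
      linarith
    · have h3 := h.stepF n (by omega)
      have h5 := h.stepG n (by omega)
      push_cast at h3
      linarith

/-- The walk continues to the next parallelogram. The line of `F` gets there without crossing the
edge, so only `G` is rotated. -/
theorem go (h : Flipped q F G n δ) (h0 : 0 ≤ n + δ) :
    Flipped q F (crossed G (zigEdge n)) (n + δ) δ where
  pos := h.pos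
  stepF := h.stepF
  stepG j hj := by
    have := h.stepG j hj
    rw [sgn_add_delta h.delta]
    simp only [crossed]; linarith
  left := by rw [add_sub_cancel_right]; exact h.zig_add
  right := by rw [add_sub_cancel_right, crossed_zig_add h.delta]; exact h.left
  delta := h.delta
  nonneg := h0
  nonneg_sub := by rw [add_sub_cancel_right]; exact h.nonneg

/-- Here both lines cross the edge and are in the rotated polygon, where the walk goes back to the
neighbour `n - δ`. -/
theorem turn (h : Flipped q F G n δ) :
    Flipped q (crossed F (zigEdge n)) (crossed G (zigEdge n)) (n - δ) (-δ) where
  pos := h.pos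
  stepF j hj := by
    have := h.stepF j hj
    push_cast
    simp only [crossed]; linarith
  stepG j hj := by
    have := h.stepG j hj
    rw [sgn_sub_delta h.delta]
    simp only [crossed]; linarith
  left := by
    rw [sub_neg_eq_add, sub_add_cancel, crossed_zig_sub h.delta]
    exact h.zig_add
  right := by
    rw [sub_neg_eq_add, sub_add_cancel, crossed_zig_sub h.delta]
    have h1 := h.zig_add
    have h2 := h.left
    have h3 := h.right
    rw [crossed_zigEdge] at h1 ⊢
    obtain rfl | rfl := h.delta
    · linarith
    · rw [← sub_eq_add_neg] at *
      rw [sub_neg_eq_add] at h2 h3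
      linarith
  delta := by have := h.delta; omega
  nonneg := h.nonneg_sub
  nonneg_sub := by have := h.nonneg; omega

/-- The line described by `G` crosses the edge `zigEdge n` transversally. -/
theorem outEdge (h : Flipped q F G n δ) (h1 : 0 ≤ sgn n * δ * G (zig n))
    (h2 : sgn n * δ * G (zig (n - δ)) < 0) (h3 : 1 ≤ n ∨ 0 < sgn n * δ * G (zig n)) :
    OutEdge G (zigEdge n) := by
  rw [outEdge_zigEdge]
  have hn := h.nonneg
  have m1 := h.mono hn (show n < n + 1 by omega)
  obtain rfl | rfl := h.delta
  · simp at *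
    exact ⟨h2, by linarith⟩
  · push_cast at *
    rw [sub_neg_eq_add] at h2
    refine ⟨?_, by linarith⟩
    rcases hn.eq_or_lt with rfl | h4
    · have h3 := h3.resolve_left (by omega)
      rw [zero_sub, zig_neg_one]
      linarith
    · have m2 := h.mono (show 0 ≤ n - 1 by omega) (show n - 1 < n by omega)
      linarith

/-- An exit through `zigEdge j` needs a sign change along the zigzag between `j - 1` and `j + 1`, in
a sense fixed by the parity of `j`. By monotonicity it is the change located between `n - δ` and
`n`, and equal parities leave only `j = n`. -/
theorem eq_zigEdge (h : Flipped q F G n δ) (h1 : 0 ≤ sgn n * δ * G (zig n))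
    (h2 : sgn n * δ * G (zig (n - δ)) < 0) {k : ℤ} (hk : OutEdge G k) : k = zigEdge n := by
  obtain ⟨j, hj, rfl⟩ := exists_zigEdge k
  have hn := h.nonneg
  have hn' := h.nonneg_sub
  rw [outEdge_zigEdge] at hk
  obtain ⟨h3, h4⟩ := hk
  congr 1
  have hsgn : sgn j = sgn n := by
    by_contra hne
    have : sgn j = -sgn n := by
      rcases sgn_eq j with h5 | h5 <;> rcases sgn_eq n with h6 | h6 <;> simp_all
    rw [this] at h3 h4
    rcases hj.eq_or_lt with rfl | hj
    · rw [zero_sub, zig_neg_one] at h3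
      have := h.mono le_rfl (show (0 : ℤ) < 0 + 1 by omega)
      linarith
    · have := h.mono (show 0 ≤ j - 1 by omega) (show j - 1 < j + 1 by omega)
      linarith
  have hpar : (j - n) % 2 = 0 := by
    obtain ⟨a, ha | ha⟩ := Int.even_or_odd' j <;> obtain ⟨b, hb | hb⟩ := Int.even_or_odd' n
    · omega
    · rw [sgn_even ha, sgn_odd hb] at hsgn; norm_num at hsgn
    · rw [sgn_odd ha, sgn_even hb] at hsgn; norm_num at hsgn
    · omega
  rw [hsgn] at h3 h4
  have h3' : sgn n * G (zig (max (j - 1) 0)) < 0 := by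
    rcases hj.eq_or_lt with rfl | hj
    · rw [zero_sub, zig_neg_one] at h3; simpa using h3
    · rwa [max_eq_left (by omega)]
  have key1 : ∀ i, 0 ≤ i → 0 ≤ sgn n * G (zig i) → max (j - 1) 0 < i := by
    intro i hi h5
    by_contra! h6
    have := h.mono_le hi h6
    linarith
  have key2 : ∀ i, 0 ≤ i → sgn n * G (zig i) ≤ 0 → i < j + 1 := by
    intro i hi h5
    by_contra! h6
    have := h.mono_le (by omega) h6
    linarith
  obtain rfl | rfl := h.delta
  · have := key1 n hn (by simpa using h1)
    have := key2 (n - 1) hn' (by simp at h2; linarith)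
    omega
  · push_cast at *
    have := key1 (n - -1) hn' (by linarith)
    have := key2 n hn (by linarith)
    omega

theorem ne_zero (h : Flipped q F G n δ) (h1 : 0 < sgn n * δ * G (zig n))
    (h2 : sgn n * δ * G (zig (n - δ)) < 0) (m : ℤ) : G m ≠ 0 := by
  obtain ⟨j, hj, rfl⟩ := exists_zig m
  intro h0
  have hn := h.nonneg
  have hn' := h.nonneg_sub
  have e : sgn n * G (zig j) = 0 := by rw [h0, mul_zero]
  rcases lt_trichotomy j n with h3 | rfl | h3
  · have m1 := h.mono hj h3
    obtain rfl | rfl := h.delta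
    · have m2 := h.mono_le hj (show j ≤ n - 1 by omega)
      rw [e] at m2; simp at h2; linarith
    · push_cast at *; linarith
  · rw [h0] at h1; simp at h1
  · have m1 := h.mono hn h3
    obtain rfl | rfl := h.delta
    · push_cast at *; linarith
    · have m2 := h.mono_le hn' (show n - -1 ≤ j by omega)
      push_cast at *; linarith

/-- What remains of the line described by `G`, after the crossing of `zigEdge n`, if it passes
through the vertex `zig n` then. -/
theorem halt_iff (h : Flipped q F G n δ) (h0 : crossed G (zigEdge n) (zig n) = 0) {l : List ℤ}
    {m : ℤ} : Exits (crossed G (zigEdge n)) l m ↔ l = [] ∧ m = zig n := by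
  refine exits_iff_of_antitone h.nonneg (fun {i j} hi hij => ?_) h0
  have := h.mono hi hij
  simp only [crossed]; linarith

end Flipped

namespace Flipped

variable {q F G : ℤ → ℝ} {n δ : ℤ}

/-- The walk cannot run off the degenerate end of the zigzag: for `n = 0` and `δ = -1` the value of
`crossed` at `zig 0` is that of `G` at `zig 1`, which has the wrong sign. -/
theorem add_nonneg (h : Flipped q F G n δ) (h2 : sgn n * δ * G (zig (n - δ)) < 0)
    (h3 : 0 ≤ sgn n * δ * crossed G (zigEdge n) (zig n)) : 0 ≤ n + δ := by
  have hn := h.nonneg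
  obtain rfl | rfl := h.delta
  · omega
  · by_contra hcon
    obtain rfl : n = 0 := by omega
    rw [crossed_zigEdge, zero_sub, zig_neg_one] at h3
    simp at h2 h3
    linarith

theorem strict_go (h : Flipped q F G n δ) (h2 : sgn n * δ * G (zig (n - δ)) < 0)
    (h3 : 0 < sgn n * δ * crossed G (zigEdge n) (zig n)) :
    0 < sgn (n + δ) * δ * crossed G (zigEdge n) (zig (n + δ)) ∧
      sgn (n + δ) * δ * crossed G (zigEdge n) (zig (n + δ - δ)) < 0 := by
  rw [sgn_add_delta h.delta, crossed_zig_add h.delta, add_sub_cancel_right]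
  constructor <;> linarith

theorem strict_turn (h : Flipped q F G n δ) (h1 : 0 < sgn n * δ * G (zig n))
    (h3 : sgn n * δ * crossed G (zigEdge n) (zig n) < 0) :
    0 < sgn (n - δ) * (-δ : ℤ) * crossed G (zigEdge n) (zig (n - δ)) ∧
      sgn (n - δ) * (-δ : ℤ) * crossed G (zigEdge n) (zig (n - δ - -δ)) < 0 := by
  rw [sgn_sub_delta h.delta, crossed_zig_sub h.delta, sub_neg_eq_add, sub_add_cancel]
  push_cast
  refine ⟨?_, by linarith⟩
  have hn := h.nonneg
  obtain rfl | rfl := h.delta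
  · have := h.mono hn (show n < n + 1 by omega)
    push_cast at *; linarith
  · rw [← sub_eq_add_neg]
    rcases hn.eq_or_lt with rfl | hn
    · rw [zero_sub, zig_neg_one]; linarith
    · have := h.mono (show 0 ≤ n - 1 by omega) (show n - 1 < n by omega)
      push_cast at *; linarith

/-- The corner relations turn the signs of `F` at the ends of the edge into the signs of `G` at `zig
n` before and after the crossing. This separates `go` from `turn`. -/
theorem outEdge_left_iff (h : Flipped q F G n δ) :
    OutEdge F (zigEdge n) ↔ 0 < sgn n * δ * G (zig n) ∧
      sgn n * δ * crossed G (zigEdge n) (zig n) < 0 := by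
  rw [outEdge_zigEdge]
  have h1 := h.right
  have h2 := h.zig_add
  obtain rfl | rfl := h.delta
  · rw [h1, h2]; simp
  · rw [← sub_eq_add_neg] at h2
    rw [sub_neg_eq_add] at h1
    rw [h1, h2]; simp [and_comm]

theorem outVertex_left (h : Flipped q F G n δ) (h1 : 0 < sgn n * δ * G (zig n))
    (h3 : crossed G (zigEdge n) (zig n) = 0) : OutVertex F (zig (n + δ)) :=
  outVertex_zig h.delta (by rw [h.zig_add, h3, neg_zero]) (by rw [h.right]; linarith)

theorem sign_ne_zero (h : Flipped q F G n δ) : sgn n * δ ≠ 0 := by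
  rcases sgn_eq n with h1 | h1 <;> obtain rfl | rfl := h.delta <;> simp [h1]

/-- Each crossing of the line of `G` is one parallelogram of the walk. The sign of `crossed G` at
the far corner `zig n` tells how it leaves this parallelogram: past the corner, at the corner, or on
the other side of it, which gives `go`, `halt` and `turn`. -/
theorem exits_left (w : List ℤ) : ∀ {F G : ℤ → ℝ} {n δ m : ℤ}, Flipped q F G n δ →
    0 < sgn n * δ * G (zig n) → sgn n * δ * G (zig (n - δ)) < 0 → Exits G w m →
    ∃ l m', FlipRel n δ l m' w m ∧ Exits F l m' := by
  induction w with
  | nil =>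
    intro F G n δ m h h1 h2 hex
    exact absurd hex.1 (h.ne_zero h1 h2 m)
  | cons k w ih =>
    intro F G n δ m h h1 h2 ⟨hk, hex⟩
    obtain rfl := h.eq_zigEdge h1.le h2 hk
    rcases lt_trichotomy 0 (sgn n * δ * crossed G (zigEdge n) (zig n)) with h3 | h3 | h3
    · have h0 := h.add_nonneg h2 h3.le
      obtain ⟨h4, h5⟩ := h.strict_go h2 h3
      obtain ⟨l, m', hf, hl⟩ := ih (h.go h0) h4 h5 hex
      exact ⟨l, m', .go _ _ _ _ _ _ h.nonneg h0 hf, hl⟩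
    · have h0 := h.add_nonneg h2 h3.le
      have h3 := (mul_eq_zero.1 h3.symm).resolve_left h.sign_ne_zero
      obtain ⟨rfl, rfl⟩ := (h.halt_iff h3).1 hex
      exact ⟨[], _, .halt _ _ h.nonneg h0, h.outVertex_left h1 h3⟩
    · obtain ⟨h4, h5⟩ := h.strict_turn h1 h3
      obtain ⟨l, m', hf, hl⟩ := ih h.turn h4 h5 hex
      exact ⟨_, m', .turn _ _ _ _ _ _ h.nonneg hf, h.outEdge_left_iff.2 ⟨h1, h3⟩, hl⟩

/-- The line described by `F` runs along an edge if it joins the two corners of the parallelogram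
that are not joined by the line described by `G`. -/
theorem outVertex_left_of_zero (h : Flipped q F G n δ) (hF : QuasiConvexOrConcave F)
    (h1 : G (zig n) = 0) (h2 : sgn n * δ * G (zig (n - δ)) < 0)
    (h3 : crossed G (zigEdge n) (zig n) = 0) : OutVertex F (zig (n + δ)) := by
  have e1 : F (zig (n - δ)) = 0 := by rw [h.right, h1, neg_zero]
  have e2 : F (zig (n + δ)) = 0 := by rw [h.zig_add, h3, neg_zero]
  have e3 : 0 < sgn n * δ * F (zig n) := by rw [h.left]; linarith
  refine ⟨e2, ?_⟩
  obtain rfl | rfl := h.delta <;> rcases zigEdge_ends n with ⟨h4, h5, h6⟩ | ⟨h4, h5, h6⟩ <;>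
    rw [h4] at e3 <;> try simp only [← sub_eq_add_neg, sub_neg_eq_add] at e1 e2 ⊢
  · rw [← h6] at e2 ⊢
    rw [← h5] at e1
    right; exact (hF.neighbors_of_zeros (v := zig n) e1 e2).1 (by push_cast at e3; linarith)
  · rw [← h6] at e1
    rw [← h5] at e2 ⊢
    left; exact (hF.neighbors_of_zeros (v := zig n) e2 e1).2 (by push_cast at e3; linarith)
  · rw [← h6] at e1
    rw [← h5] at e2 ⊢
    left; exact (hF.neighbors_of_zeros (v := zig n) e2 e1).2 (by push_cast at e3; linarith)
  · rw [← h6] at e2 ⊢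
    rw [← h5] at e1
    right; exact (hF.neighbors_of_zeros (v := zig n) e1 e2).1 (by push_cast at e3; linarith)

theorem start_sign (h : Flipped q F G n δ) (h1 : G (zig n) = 0) :
    sgn n * δ * G (zig (n - δ)) < 0 := by
  have hn := h.nonneg
  have hn' := h.nonneg_sub
  obtain rfl | rfl := h.delta
  · have := h.mono hn' (show n - 1 < n by omega)
    rw [h1] at this
    simp at *; exact this
  · have := h.mono hn (show n < n - -1 by omega)
    rw [h1] at this
    push_cast at *; linarith

/-- A nonempty sequence of edges crossed by the line described by `G`, from the vertex `zig n`,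
gives a sequence of edges crossed by the line described by `F`. -/
theorem exits_left_start (h : Flipped q F G n δ) (hF : QuasiConvexOrConcave F)
    (h1 : G (zig n) = 0) {k m : ℤ} {w : List ℤ} (hex : Exits G (k :: w) m)
    (h3 : 0 ≤ sgn n * δ * crossed G (zigEdge n) (zig n)) :
    ∃ l m', FlipRel n δ l m' (k :: w) m ∧ Exits F l m' := by
  have h2 := h.start_sign h1
  obtain ⟨hk, hex⟩ := hex
  obtain rfl := h.eq_zigEdge (by rw [h1]; simp) h2 hk
  have h0 := h.add_nonneg h2 h3
  rcases h3.eq_or_lt with h3 | h3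
  · have h3 := (mul_eq_zero.1 h3.symm).resolve_left h.sign_ne_zero
    obtain ⟨rfl, rfl⟩ := (h.halt_iff h3).1 hex
    exact ⟨[], _, .halt _ _ h.nonneg h0, h.outVertex_left_of_zero hF h1 h2 h3⟩
  · obtain ⟨h4, h5⟩ := h.strict_go h2 h3
    obtain ⟨l, m', hf, hl⟩ := exits_left w (h.go h0) h4 h5 hex
    exact ⟨l, m', .go _ _ _ _ _ _ h.nonneg h0 hf, hl⟩

/-- The index in the zigzag of the next edge or vertex. -/
def exitIndex : List ℤ → ℤ → ℤ
  | [], m => if m ≤ 0 then -2 * m else 2 * m - 1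
  | k :: _, _ => if 0 ≤ k then 2 * k else -2 * k - 1

/-- The function `exitIndex` inverts `zig` and `zigEdge`. The vertices with zigzag index at most `n`
form an interval of integers with ends `zig (n - 1)` and `zig n`, and the line of `F` enters the
polygon between these ends, so its exit lies farther out. -/
theorem exitIndex_not_lt (h : Flipped q F G n 1) (hF : QuasiConvexOrConcave F)
    (h1 : 0 < sgn n * G (zig n)) (h2 : sgn n * G (zig (n - 1)) < 0) {l : List ℤ} {m : ℤ}
    (hex : Exits F l m) : n ≤ exitIndex l m := by
  by_contra! hcon
  have e1 := h.left
  have e2 := h.right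
  have hn := h.nonneg
  obtain ⟨i, hi | hi⟩ := Int.even_or_odd' n
  · rw [sgn_even hi, one_mul] at h1 h2
    rw [zig_even hi] at e1 e2 h1
    rw [zig_odd (n := n - 1) (i := i - 1) (by omega)] at e1 e2 h2
    cases l with
    | nil =>
      refine hF.not_outVertex_between (a := -i) (b := i - 1 + 1) (by linarith) (by linarith)
        ?_ ?_ hex <;> simp only [exitIndex] at hcon <;> split_ifs at hcon <;> omega
    | cons k t =>
      refine hF.not_outEdge_between (a := -i) (b := i - 1 + 1) (by linarith) (by linarith)
        ?_ ?_ hex.1 <;> simp only [exitIndex] at hcon <;> split_ifs at hcon <;> omega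
  · rw [sgn_odd hi] at h1 h2
    rw [zig_odd hi] at e1 e2 h1
    rw [zig_even (n := n - 1) (i := i) (by omega)] at e1 e2 h2
    cases l with
    | nil =>
      refine hF.not_outVertex_between (a := -i) (b := i + 1) (by linarith) (by linarith)
        ?_ ?_ hex <;> simp only [exitIndex] at hcon <;> split_ifs at hcon <;> omega
    | cons k t =>
      refine hF.not_outEdge_between (a := -i) (b := i + 1) (by linarith) (by linarith)
        ?_ ?_ hex.1 <;> simp only [exitIndex] at hcon <;> split_ifs at hcon <;> omega

/-- The list `l` becomes shorter only at turns, so the steps `go` need a second induction, on `N`.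
Outward they are bounded by the next exit of `F` (`exitIndex_not_lt`), and inward by the index 0. -/
theorem exits_right (l : List ℤ) : ∀ (N : ℕ) {F G : ℤ → ℝ} {n δ m : ℤ}, Flipped q F G n δ →
    QuasiConvexOrConcave F → 0 < sgn n * δ * G (zig n) → sgn n * δ * G (zig (n - δ)) < 0 →
    Exits F l m → (δ = 1 → exitIndex l m < n + N) → (δ = -1 → n < N) →
    ∃ w m', FlipRel n δ l m w m' ∧ Exits G w m' := by
  induction l with
  | nil =>
    intro N
    induction N with
    | zero =>
      intro F G n δ m h hF h1 h2 hex hN hN'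
      obtain rfl | rfl := h.delta
      · simp at h1 h2 hN
        have := h.exitIndex_not_lt hF h1 h2 hex
        omega
      · have := h.nonneg
        simp at hN'; omega
    | succ N ih =>
      intro F G n δ m h hF h1 h2 hex hN hN'
      have hout := h.outEdge h1.le h2 (.inr h1)
      rcases lt_trichotomy 0 (sgn n * δ * crossed G (zigEdge n) (zig n)) with h3 | h3 | h3
      · have h0 := h.add_nonneg h2 h3.le
        obtain ⟨h4, h5⟩ := h.strict_go h2 h3
        obtain ⟨w, m', hf, hw⟩ := ih (h.go h0) hF h4 h5 hex (by push_cast at *; omega)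
          (by push_cast at *; omega)
        exact ⟨_, m', .go _ _ _ _ _ _ h.nonneg h0 hf, hout, hw⟩
      · have h0 := h.add_nonneg h2 h3.le
        have h3 := (mul_eq_zero.1 h3.symm).resolve_left h.sign_ne_zero
        obtain rfl := hF.outVertex_unique hex (h.outVertex_left h1 h3)
        exact ⟨_, _, .halt _ _ h.nonneg h0, hout, (h.halt_iff h3).2 ⟨rfl, rfl⟩⟩
      · exact (hF.not_outEdge_of_outVertex hex (h.outEdge_left_iff.2 ⟨h1, h3⟩)).elim
  | cons k l ihl =>
    intro N
    induction N with
    | zero =>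
      intro F G n δ m h hF h1 h2 hex hN hN'
      obtain rfl | rfl := h.delta
      · simp at h1 h2 hN
        have := h.exitIndex_not_lt hF h1 h2 hex
        omega
      · have := h.nonneg
        simp at hN'; omega
    | succ N ih =>
      intro F G n δ m h hF h1 h2 hex hN hN'
      have hout := h.outEdge h1.le h2 (.inr h1)
      rcases lt_trichotomy 0 (sgn n * δ * crossed G (zigEdge n) (zig n)) with h3 | h3 | h3
      · have h0 := h.add_nonneg h2 h3.le
        obtain ⟨h4, h5⟩ := h.strict_go h2 h3
        obtain ⟨w, m', hf, hw⟩ := ih (h.go h0) hF h4 h5 hex (by push_cast at *; omega)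
          (by push_cast at *; omega)
        exact ⟨_, m', .go _ _ _ _ _ _ h.nonneg h0 hf, hout, hw⟩
      · have h3 := (mul_eq_zero.1 h3.symm).resolve_left h.sign_ne_zero
        exact (hF.not_outEdge_of_outVertex (h.outVertex_left h1 h3) hex.1).elim
      · obtain rfl := hF.outEdge_unique hex.1 (h.outEdge_left_iff.2 ⟨h1, h3⟩)
        obtain ⟨h4, h5⟩ := h.strict_turn h1 h3
        -- A bound that is generous enough for the stretch after the turn in either direction.
        obtain ⟨w, m', hf, hw⟩ := ihl (n.natAbs + (exitIndex l m).natAbs + 2) h.turn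
          (hF.crossed _) h4 h5 hex.2 (by have := h.nonneg_sub; omega)
          (by have := h.nonneg; omega)
        exact ⟨_, m', .turn _ _ _ _ _ _ h.nonneg hf, hout, hw⟩

/-- A sequence of edges crossed by the line described by `F`, from the vertex `zig (n - δ)`,
gives a sequence of edges crossed by the line described by `G`. -/
theorem exits_right_start (h : Flipped q F G n δ) (hF : QuasiConvexOrConcave F) (hn : 1 ≤ n)
    (h1 : G (zig n) = 0) {l : List ℤ} {m : ℤ} (hex : Exits F l m)
    (hm : l = [] → m ≠ zig (n - δ)) :
    ∃ w m', FlipRel n δ l m w m' ∧ Exits G w m' := by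
  have h2 := h.start_sign h1
  have hout := h.outEdge (by rw [h1]; simp) h2 (.inl hn)
  have h0 : 0 ≤ n + δ := by have := h.delta; omega
  rcases lt_trichotomy 0 (sgn n * δ * crossed G (zigEdge n) (zig n)) with h3 | h3 | h3
  · obtain ⟨h4, h5⟩ := h.strict_go h2 h3
    obtain ⟨w, m', hf, hw⟩ := exits_right l (n.natAbs + (exitIndex l m).natAbs + 2) (h.go h0) hF
      h4 h5 hex (by omega) (by omega)
    exact ⟨_, m', .go _ _ _ _ _ _ h.nonneg h0 hf, hout, hw⟩
  · have h3 := (mul_eq_zero.1 h3.symm).resolve_left h.sign_ne_zero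
    have hv := h.outVertex_left_of_zero hF h1 h2 h3
    cases l with
    | nil =>
      obtain rfl := hF.outVertex_unique hex hv
      exact ⟨_, _, .halt _ _ h.nonneg h0, hout, (h.halt_iff h3).2 ⟨rfl, rfl⟩⟩
    | cons k t => exact (hF.not_outEdge_of_outVertex hv hex.1).elim
  -- In this case the line of `F` would leave the polygon at its own starting vertex, against `hm`.
  · have hv : OutVertex F (zig (n - δ)) := by
      have hd := h.delta
      refine outVertex_zig (n := n) (δ := -δ) (by omega) ?_ ?_
      · rw [← sub_eq_add_neg, h.right, h1, neg_zero]
      · rw [sub_neg_eq_add, h.zig_add]; push_cast; linarith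
    cases l with
    | nil => exact (hm rfl (hF.outVertex_unique hex hv)).elim
    | cons k t => exact (hF.not_outEdge_of_outVertex hv hex.1).elim

end Flipped

/-! ### Realized sequences of edges -/

/-- The linear function that describes the line through the vertex `k₀` in the direction `u`. -/
def lineFn (c : ℝ) (u : Plane) (k₀ k : ℤ) : ℝ := cross u (vertex c k - vertex c k₀)

theorem lineFn_self (c : ℝ) (u : Plane) (k : ℤ) : lineFn c u k k = 0 := by
  simp [lineFn, cross]

/-- The geodesic that starts at the vertex `k₀` of `Q_c^+` in the direction `u` crosses the edges in
the list `l` and then arrives at the vertex `m`. Both polygons are identified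
by the rotation by `π`. -/
structure Realizes (c : ℝ) (u : Plane) (k₀ : ℤ) (l : List ℤ) (m : ℤ) : Prop where
  ne_zero : u ≠ 0
  exits : Exits (lineFn c u k₀) l m
  ne : l = [] → m ≠ k₀

theorem Exits.shift {F F' : ℤ → ℝ} {l : List ℤ} {m : ℤ} (e : ℤ) (h : Exits F l m)
    (hF : ∀ k, F' (k + e) = F k) : Exits F' (l.map (· + e)) (m + e) := by
  induction l generalizing F F' with
  | nil =>
    refine ⟨by rw [hF]; exact h.1, ?_⟩
    have := h.2
    rwa [show m + e - 1 = m - 1 + e by ring, show m + e + 1 = m + 1 + e by ring, hF, hF]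
  | cons k l ih =>
    have e1 : F' (k + e + 1) = F (k + 1) := by rw [add_right_comm, hF]
    refine ⟨⟨by rw [hF]; exact h.1.1, by rw [e1]; exact h.1.2⟩, ih h.2 fun j => ?_⟩
    simp only [crossed, hF, e1]

/-- A reflection changes the sign of determinants and maps the edge from `k` to `k + 1` to the edge
with index `-k - 1`. -/
theorem Exits.refl {F F' : ℤ → ℝ} {l : List ℤ} {m : ℤ} (h : Exits F l m)
    (hF : ∀ k, F' (-k) = -F k) : Exits F' (l.map (fun k => -k - 1)) (-m) := by
  induction l generalizing F F' with
  | nil =>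
    refine ⟨by rw [hF, h.1, neg_zero], ?_⟩
    have := h.2
    rw [show -m - 1 = -(m + 1) by ring, show -m + 1 = -(m - 1) by ring, hF, hF]
    simpa [or_comm] using this
  | cons k l ih =>
    have e1 : F' (-k - 1) = -F (k + 1) := by rw [← hF]; congr 1; ring
    have e2 : F' (-k - 1 + 1) = -F k := by rw [← hF]; congr 1; ring
    refine ⟨⟨by rw [e1]; simpa using h.1.2, by rw [e2]; simpa using h.1.1⟩, ih h.2 fun j => ?_⟩
    simp only [crossed, hF, e1, e2]; ring

theorem lin_ne_zero {c : ℝ} {u : Plane} (hu : u ≠ 0) : lin c u ≠ 0 := by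
  intro h
  apply hu
  rw [← linInv_lin c u, h]
  apply plane_ext <;> simp [linInv]

theorem linInv_ne_zero {c : ℝ} {u : Plane} (hu : u ≠ 0) : linInv c u ≠ 0 := by
  intro h
  apply hu
  rw [← lin_linInv c u, h]
  apply plane_ext <;> simp [lin]

theorem refl_refl (u : Plane) : refl (refl u) = u := by
  apply plane_ext <;> simp [refl]

theorem refl_ne_zero {u : Plane} (hu : u ≠ 0) : refl u ≠ 0 := by
  intro h
  apply hu
  rw [← refl_refl u, h]
  apply plane_ext <;> simp [refl]

namespace Realizes

variable {c : ℝ} {u : Plane} {k₀ m : ℤ} {l : List ℤ}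

theorem shift (h : Realizes c u k₀ l m) :
    Realizes c (lin c u) (k₀ + 1) (l.map (· + 1)) (m + 1) where
  ne_zero := lin_ne_zero h.ne_zero
  exits := h.exits.shift 1 fun k => by rw [lineFn, vertex_succ_sub, cross_lin]; rfl
  ne hl := by simpa using h.ne (by simpa using hl)

theorem unshift (h : Realizes c u k₀ l m) :
    Realizes c (linInv c u) (k₀ - 1) (l.map (· + -1)) (m - 1) where
  ne_zero := linInv_ne_zero h.ne_zero
  exits := h.exits.shift (-1) fun k => by
    rw [lineFn, ← cross_lin c, lin_linInv, ← vertex_succ_sub]; simp [lineFn]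
  ne hl := by simpa using h.ne (by simpa using hl)

theorem refl (h : Realizes c u k₀ l m) :
    Realizes c (refl u) (-k₀) (l.map (fun k => -k - 1)) (-m) where
  ne_zero := refl_ne_zero h.ne_zero
  exits := h.exits.refl fun k => by
    rw [lineFn, vertex_neg', vertex_neg', ← refl_sub, cross_refl]; rfl
  ne hl := by simpa using h.ne (by simpa using hl)

end Realizes

/-! ### The flip on lines and directions, and the resulting induction. -/

/-- The linear map with the matrix `B_c`. -/
def bvec (u : Plane) : Plane := ![-u 0 + 2 * u 1, u 1]

theorem bvec_bvec (u : Plane) : bvec (bvec u) = u := by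
  apply plane_ext <;> simp [bvec]

theorem bvec_smul (r : ℝ) (u : Plane) : bvec (r • u) = r • bvec u := by
  apply plane_ext <;> simp [bvec]; ring

theorem refl_smul (r : ℝ) (u : Plane) : refl (r • u) = r • refl u := by
  apply plane_ext <;> simp [refl]

theorem lin_smul (c r : ℝ) (u : Plane) : lin c (r • u) = r • lin c u := by
  apply plane_ext <;> simp [lin] <;> ring

/-- Even steps of the zigzag are horizontal and odd ones have slope one. The coefficients are
positive because of the bounds on `i`, so `u 1` and `u 0 - u 1` carry all the signs. -/
theorem zig_step (c : ℝ) (j : ℤ) (hj : 1 ≤ j) :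
    ∃ i : ℤ, 0 ≤ i ∧ ((j = 2 * i ∧ 0 < i ∧
      ∀ u, cross u (vertex c (zig j) - vertex c (zig (j - 1))) = 2 * vertex c i 0 * u 1) ∨
    (j = 2 * i + 1 ∧ ∀ u, cross u (vertex c (zig j) - vertex c (zig (j - 1))) =
      (vertex c i 0 + vertex c (i + 1) 0) * (u 0 - u 1))) := by
  obtain ⟨i, hi | hi⟩ := Int.even_or_odd' j
  · refine ⟨i, by omega, .inl ⟨hi, by omega, fun u => ?_⟩⟩
    rw [zig_even hi, zig_odd (n := j - 1) (i := i - 1) (by omega), sub_add_cancel,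
      ← neg_sub, vertex_sub_neg, cross_neg_right, cross_smul_right]
    simp [cross]
  · refine ⟨i, by omega, .inr ⟨hi, fun u => ?_⟩⟩
    rw [zig_odd hi, zig_even (n := j - 1) (i := i) (by omega), vertex_succ_sub_neg,
      cross_smul_right]
    simp [cross]

theorem lineFn_sub (c : ℝ) (u : Plane) (k i j : ℤ) :
    lineFn c u k i - lineFn c u k j = cross u (vertex c i - vertex c j) := by
  simp [lineFn, cross]; ring

theorem cross_zig_pos {c : ℝ} (hc : 1 ≤ c) {u : Plane} {ε : ℝ} (h1 : 0 < ε * u 1)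
    (h2 : 0 < ε * (u 0 - u 1)) {j : ℤ} (hj : 1 ≤ j) :
    0 < ε * cross u (vertex c (zig j) - vertex c (zig (j - 1))) := by
  obtain ⟨i, hi, ⟨rfl, h, e⟩ | ⟨rfl, e⟩⟩ := zig_step c j hj
  · rw [e]
    have := mul_pos (vertex_zero_pos hc h) h1
    linarith
  · rw [e]
    have := mul_pos (vertex_add_pos hc hi) h2
    linarith

/-- The map `bvec` has determinant -1, negates horizontal vectors and fixes vectors of slope one, so
only the odd steps change sign. -/
theorem cross_bvec_zig (c : ℝ) (u : Plane) {j : ℤ} (hj : 1 ≤ j) :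
    cross (bvec u) (vertex c (zig j) - vertex c (zig (j - 1))) =
      sgn j * cross u (vertex c (zig j) - vertex c (zig (j - 1))) := by
  obtain ⟨i, hi, ⟨rfl, h, e⟩ | ⟨rfl, e⟩⟩ := zig_step c j hj
  · rw [e, e, sgn_even rfl]; simp [bvec]
  · rw [e, e, sgn_odd rfl]; simp [bvec]; ring

/-- The direction of the flipped line. -/
def flipVec (u : Plane) (n δ : ℤ) : Plane := (δ * sgn n) • bvec u

theorem sign_mul_self {n δ : ℤ} (hδ : δ = 1 ∨ δ = -1) : (δ * sgn n) * (δ * sgn n) = 1 := by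
  rcases hδ with rfl | rfl <;> rcases sgn_eq n with h | h <;> simp [h]

theorem flipVec_flipVec (u : Plane) {n δ : ℤ} (hδ : δ = 1 ∨ δ = -1) :
    flipVec (flipVec u n δ) n δ = u := by
  rw [flipVec, flipVec, bvec_smul, smul_smul, sign_mul_self hδ, one_smul, bvec_bvec]

/-- The flip moves the corner `zig n` of the parallelogram to the adjacent corner `zig (n - δ)`,
where the image line starts. The sign in `flipVec` makes the relation `left` hold for both parities
and both values of `δ`. -/
theorem flipped_lineFn {c : ℝ} (hc : 1 ≤ c) {u : Plane} {n δ : ℤ} (h1 : 0 < sgn n * u 1)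
    (h2 : 0 < sgn n * (u 0 - u 1)) (hδ : δ = 1 ∨ δ = -1) (hn : 0 ≤ n) (hn' : 0 ≤ n - δ) :
    Flipped (fun j => sgn n * cross u (vertex c (zig j) - vertex c (zig (j - 1))))
      (lineFn c (flipVec u n δ) (zig (n - δ))) (lineFn c u (zig n)) n δ where
  pos j hj := cross_zig_pos hc h1 h2 hj
  stepF j hj := by
    rw [lineFn_sub, flipVec, cross_smul_left, cross_bvec_zig c u hj]; ring
  stepG j hj := by
    rw [lineFn_sub, ← mul_assoc, sgn_mul_self, one_mul]
  left := by
    rcases hδ with rfl | rfl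
    · rw [lineFn, flipVec, cross_smul_left, cross_bvec_zig c u (by omega), lineFn, ← cross_neg_right,
        neg_sub]
      have := sgn_mul_self n
      push_cast
      rw [one_mul, ← mul_assoc, this, one_mul]
    · rw [lineFn, flipVec, cross_smul_left, ← neg_sub, cross_neg_right, sub_neg_eq_add]
      have := cross_bvec_zig c u (j := n + 1) (by omega)
      rw [add_sub_cancel_right] at this
      rw [this, lineFn, sgn_add_one]
      have := sgn_mul_self n
      push_cast
      linear_combination (-cross u (vertex c (zig (n + 1)) - vertex c (zig n))) * this
  right := by simp [lineFn_self]
  delta := hδ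
  nonneg := hn
  nonneg_sub := hn'

theorem ne_zero_of_pos {u : Plane} {ε : ℝ} (h : 0 < ε * u 1) : u ≠ 0 := by
  rintro rfl; simp at h

theorem flipVec_ne_zero {u : Plane} {n δ : ℤ} (hδ : δ = 1 ∨ δ = -1) (h : u ≠ 0) :
    flipVec u n δ ≠ 0 := by
  intro h0
  apply h
  rw [← flipVec_flipVec u (n := n) hδ, h0]
  apply plane_ext <;> simp [flipVec, bvec]

/-- The flip takes a line that crosses at least one edge, in a direction between the horizontal one
and the direction of slope one, to a line that crosses fewer edges. -/
theorem Realizes.flip {c : ℝ} (hc : 1 ≤ c) {u : Plane} {n k m : ℤ} {w : List ℤ} (hn : 0 ≤ n)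
    (h1 : 0 < sgn n * u 1) (h2 : 0 < sgn n * (u 0 - u 1)) (h : Realizes c u (zig n) (k :: w) m) :
    1 ≤ n ∧ ∃ δ l m', (δ = 1 ∨ δ = -1) ∧ FlipRel n δ l m' (k :: w) m ∧
      Realizes c (flipVec u n δ) (zig (n - δ)) l m' := by
  have hG : lineFn c u (zig n) (zig n) = 0 := lineFn_self _ _ _
  -- For `n = 0` the line would start at the vertex 0 and leave through the edge 0, which contains
  -- this vertex.
  have hn1 : 1 ≤ n := by
    by_contra hcon
    obtain rfl : n = 0 := by omega
    have hf := flipped_lineFn hc h1 h2 (δ := -1) (by simp) hn (by simp)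
    have hk := h.exits.1
    obtain rfl := hf.eq_zigEdge (by rw [hG]; simp) (hf.start_sign hG) hk
    have := hk.1
    rw [zigEdge_even (n := 0) (i := 0) rfl] at this
    rw [zig_even (n := 0) (i := 0) rfl, neg_zero] at this
    rw [lineFn_self] at this
    exact this.false
  refine ⟨hn1, ?_⟩
  -- The side by which the line leaves its first parallelogram determines the direction of the walk;
  -- if it hits the far corner, either choice serves.
  obtain ⟨δ, hδ, hD⟩ : ∃ δ : ℤ, (δ = 1 ∨ δ = -1) ∧
      0 ≤ sgn n * δ * crossed (lineFn c u (zig n)) (zigEdge n) (zig n) := by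
    rcases le_total 0 (sgn n * crossed (lineFn c u (zig n)) (zigEdge n) (zig n)) with h3 | h3
    · exact ⟨1, by simp, by push_cast; linarith⟩
    · exact ⟨-1, by simp, by push_cast; linarith⟩
  have hn' : 0 ≤ n - δ := by omega
  have hf := flipped_lineFn hc h1 h2 hδ hn hn'
  have hv := flipVec_ne_zero hδ (ne_zero_of_pos h1) (n := n)
  obtain ⟨l, m', hr, hl⟩ :=
    hf.exits_left_start (quasiConvexOrConcave_cross hc hv _) hG h.exits hD
  refine ⟨δ, l, m', hδ, hr, hv, hl, ?_⟩
  rintro rfl rfl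
  rcases hr.beyond hδ with ⟨-, j, hj, e, h5⟩ | ⟨j, t, -, e, -⟩
  · have := zig_inj hn' hj e
    rcases hδ with rfl | rfl <;> omega
  · cases e

/-- The flip of a line whose direction is not between the horizontal one
and the direction of slope one. -/
theorem Realizes.unflip {c : ℝ} (hc : 1 ≤ c) {u : Plane} {n δ m : ℤ} {l : List ℤ}
    (hδ : δ = 1 ∨ δ = -1) (hn : 0 ≤ n - δ) (h1 : 0 < δ * u 1) (h2 : 0 < -δ * (u 0 - u 1))
    (h : Realizes c u (zig (n - δ)) l m) :
    1 ≤ n ∧ ∃ w m', FlipRel n δ l m w m' ∧ Realizes c (flipVec u n δ) (zig n) w m' := by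
  have hq := quasiConvexOrConcave_cross hc h.ne_zero (vertex c (zig (n - δ)))
  -- Otherwise the line starts at an end of the edge 0, which has slope one, and its direction
  -- points out of the polygon there. It would end where it begins.
  have hn1 : 1 ≤ n := by
    by_contra hcon
    obtain rfl : δ = -1 := by omega
    have key : OutVertex (lineFn c u (zig (n - -1))) (zig (n - -1)) := by
      refine ⟨lineFn_self _ _ _, ?_⟩
      have e0 : zig 0 = 0 := zig_even (i := 0) rfl
      have e1 : zig 1 = 1 := zig_odd (i := 0) rfl
      have e2 : 0 < lineFn c u 0 1 := by
        have := vertex_succ_sub_neg c 0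
        simp only [zero_add, neg_zero] at this
        rw [lineFn, this, cross_smul_right]
        have hp := vertex_add_pos hc le_rfl
        rw [zero_add] at hp
        refine mul_pos hp ?_
        simp [cross] at h2 ⊢; linarith
      rcases (show n = -1 ∨ n = 0 by omega) with rfl | rfl
      · right; rw [sub_self, e0]; exact e2
      · left; rw [zero_sub, neg_neg, e1]
        have := lineFn_sub c u 1 0 1
        rw [lineFn_self, sub_zero] at this
        rw [sub_self, this, ← neg_sub, cross_neg_right]
        exact neg_neg_of_pos e2
    cases l with
    | nil => exact h.ne rfl (hq.outVertex_unique h.exits key)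
    | cons k t => exact hq.not_outEdge_of_outVertex key h.exits.1
  refine ⟨hn1, ?_⟩
  have hs := sgn_mul_self n
  have hδ2 : (δ : ℝ) * δ = 1 := by rcases hδ with rfl | rfl <;> simp
  have hf := flipped_lineFn hc (u := flipVec u n δ) (n := n) (δ := δ) (by
      simp only [flipVec, bvec, Pi.smul_apply, smul_eq_mul, Matrix.cons_val_one,
        Matrix.cons_val_fin_one]
      have : sgn n * (δ * sgn n * u 1) = (sgn n * sgn n) * (δ * u 1) := by ring
      rw [this, hs, one_mul]; exact h1) (by
      simp only [flipVec, bvec, Pi.smul_apply, smul_eq_mul, Matrix.cons_val_one,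
        Matrix.cons_val_fin_one, Matrix.cons_val_zero]
      have : sgn n * (δ * sgn n * (-u 0 + 2 * u 1) - δ * sgn n * u 1) =
        (sgn n * sgn n) * (-δ * (u 0 - u 1)) := by ring
      rw [this, hs, one_mul]; exact h2) hδ (by omega) hn
  rw [flipVec_flipVec u hδ] at hf
  obtain ⟨w, m', hr, hw⟩ := hf.exits_right_start hq hn1 (lineFn_self _ _ _) h.exits h.ne
  refine ⟨w, m', hr, flipVec_ne_zero hδ h.ne_zero, hw, ?_⟩
  rintro rfl
  have := hr.length_lt
  simp at this

theorem mul_pos_iff_neg {r x : ℝ} (hr : r < 0) : 0 < r * x ↔ x < 0 :=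
  ⟨fun h => by nlinarith, fun h => mul_pos_of_neg_of_neg hr h⟩

theorem map_shift (l : List ℤ) (e : ℤ) : (l.map (· + e)).map (· + -e) = l := by
  simp [List.map_map, Function.comp_def]

theorem map_refl (l : List ℤ) : (l.map (fun k => -k - 1)).map (fun k => -k - 1) = l := by
  simp [List.map_map, Function.comp_def]

/-- Seen from the vertex `k₀`, the ends `-k₀` and `-k₀ + 1` of the edge lie in the horizontal
direction and in the direction of slope one. A line through the interior of this edge has a
direction between them. -/
theorem Realizes.signs {c : ℝ} (hc : 1 ≤ c) {u : Plane} {k₀ m : ℤ} {w : List ℤ}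
    (h : Realizes c u k₀ (-k₀ :: w) m) :
    ∃ n, 0 ≤ n ∧ zig n = k₀ ∧ 0 < sgn n * u 1 ∧ 0 < sgn n * (u 0 - u 1) := by
  obtain ⟨h1, h2⟩ := h.exits.1
  have e0 := lineFn_sub c u k₀ (-k₀) k₀
  have e1 := lineFn_sub c u k₀ (-k₀ + 1) k₀
  rw [lineFn_self, sub_zero] at e0 e1
  rw [e0] at h1
  rw [e1] at h2
  rcases lt_trichotomy k₀ 0 with hk | rfl | hk
  · refine ⟨2 * (-k₀), by omega, by rw [zig_even rfl, neg_neg], ?_⟩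
    have v1 := vertex_sub_neg c (-k₀)
    have v2 := vertex_succ_sub_neg c (-k₀)
    rw [neg_neg] at v1 v2
    rw [v1, cross_smul_right] at h1
    rw [v2, cross_smul_right] at h2
    have p1 := vertex_zero_pos hc (show 0 < -k₀ by omega)
    have p2 := vertex_add_pos hc (show 0 ≤ -k₀ by omega)
    rw [sgn_even rfl]
    constructor
    · by_contra! hcon
      simp [cross] at h1
      nlinarith
    · have := pos_of_mul_pos_right h2 p2.le
      simpa [cross] using this
  · simp [cross] at h1
  · refine ⟨2 * (k₀ - 1) + 1, by omega, by rw [zig_odd rfl]; ring, ?_⟩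
    have v1 := vertex_sub_neg c k₀
    have v2 := vertex_succ_sub_neg c (k₀ - 1)
    rw [sub_add_cancel, show -(k₀ - 1) = -k₀ + 1 by ring] at v2
    rw [← neg_sub, v1, cross_neg_right, cross_smul_right] at h1
    rw [← neg_sub, v2, cross_neg_right, cross_smul_right] at h2
    have p1 := vertex_zero_pos hc hk
    have p2 := vertex_add_pos hc (show 0 ≤ k₀ - 1 by omega)
    rw [sub_add_cancel] at p2
    rw [sgn_odd rfl]
    simp [cross] at h1 h2
    constructor
    · by_contra! hcon
      nlinarith
    · by_contra! hcon
      nlinarith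

/-- Induction over realized sequences of edges, modulo the symmetries of the polygon and the
flip. -/
theorem Realizes.induction {c : ℝ} (hc : 1 ≤ c) {Φ : Plane → ℤ → List ℤ → ℤ → Prop}
    (base : ∀ u k₀ m, Realizes c u k₀ [] m → Φ u k₀ [] m)
    (shift : ∀ u k₀ l m, Φ u k₀ l m → Φ (lin c u) (k₀ + 1) (l.map (· + 1)) (m + 1))
    (unshift : ∀ u k₀ l m, Φ u k₀ l m → Φ (linInv c u) (k₀ - 1) (l.map (· + -1)) (m - 1))
    (reflect : ∀ u k₀ l m, Φ u k₀ l m → Φ (ParabolaSurface.refl u) (-k₀)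
      (l.map (fun k => -k - 1)) (-m))
    (flip : ∀ u n δ l m' w m, 1 ≤ n → (δ = 1 ∨ δ = -1) → FlipRel n δ l m' w m →
      0 < sgn n * u 1 → 0 < sgn n * (u 0 - u 1) → Realizes c u (zig n) w m →
      Realizes c (flipVec u n δ) (zig (n - δ)) l m' →
      Φ (flipVec u n δ) (zig (n - δ)) l m' → Φ u (zig n) w m)
    {u : Plane} {k₀ : ℤ} {l : List ℤ} {m : ℤ} (h : Realizes c u k₀ l m) : Φ u k₀ l m := by
  induction hN : l.length using Nat.strong_induction_on generalizing u k₀ l m with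
  | _ N ih =>
    subst hN
    cases l with
    | nil => exact base u k₀ m h
    | cons k₁ w =>
      -- A shift changes `k₀ + k₁` by two, so shifts lead to `k₀ + k₁ = 0`. There `Realizes.signs`
      -- puts the direction into the sector where the flip shortens the list.
      have even : ∀ (e : ℤ) {u : Plane} {k₀ k₁ m : ℤ} {w' : List ℤ}, w'.length = w.length →
          k₀ + k₁ = e + e → Realizes c u k₀ (k₁ :: w') m → Φ u k₀ (k₁ :: w') m := by
        intro e
        induction e using Int.induction_on with
        | zero =>
          intro u k₀ k₁ m w' hw hs h
          obtain rfl : k₁ = -k₀ := by omega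
          obtain ⟨n, hn, rfl, h1, h2⟩ := h.signs hc
          obtain ⟨hn1, δ, l', m', hδ, hf, hr⟩ := h.flip hc hn h1 h2
          refine flip u n δ l' m' _ m hn1 hδ hf h1 h2 h hr (ih _ ?_ hr rfl)
          have := hf.length_lt
          simp at this ⊢; omega
        | succ e ihe =>
          intro u k₀ k₁ m w' hw hs h
          have := shift _ _ _ _ (ihe (k₀ := k₀ - 1) (k₁ := k₁ + -1) (by simp [hw]) (by omega)
            h.unshift)
          rw [lin_linInv, ← List.map_cons (f := (· + -1)), sub_add_cancel, sub_add_cancel] at this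
          simpa [List.map_map, Function.comp_def] using this
        | pred e ihe =>
          intro u k₀ k₁ m w' hw hs h
          have := unshift _ _ _ _ (ihe (k₀ := k₀ + 1) (k₁ := k₁ + 1) (by simp [hw]) (by omega)
            h.shift)
          rw [linInv_lin, ← List.map_cons (f := (· + 1)), map_shift, add_sub_cancel_right,
            add_sub_cancel_right] at this
          exact this
      rcases Int.even_or_odd (k₀ + k₁) with ⟨e, he⟩ | ⟨e, he⟩
      · exact even e rfl he h
      -- The reflection sends `k₀ + k₁` to `-(k₀ + k₁) - 1` and thus changes the parity.
      · have := reflect _ _ _ _ (even (-e - 1) (k₀ := -k₀) (k₁ := -k₁ - 1) (by simp) (by omega)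
          h.refl)
        rw [refl_refl, ← List.map_cons (f := fun k => -k - 1), map_refl, neg_neg, neg_neg] at this
        exact this

/-! ### The sequences of edges do not depend on the surface -/

/-- The linear functions that describe lines in the directions `u` and `u'` order the vertices of
the two polygons in the same way. -/
def OrderEquiv (c : ℝ) (u : Plane) (c' : ℝ) (u' : Plane) : Prop :=
  ∀ i j, 0 < cross u (vertex c i - vertex c j) ↔ 0 < cross u' (vertex c' i - vertex c' j)

theorem cross_diag_pos_iff {c : ℝ} (hc : 1 ≤ c) {a b i j : ℤ} (hab : b < a) (hij : j < i) :
    (0 < cross (vertex c a - vertex c b) (vertex c i - vertex c j) ↔ a + b < i + j) ∧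
    (cross (vertex c a - vertex c b) (vertex c i - vertex c j) < 0 ↔ i + j < a + b) := by
  rcases lt_trichotomy (a + b) (i + j) with h | h | h
  · have := cross_diag_pos hc hab hij h
    exact ⟨iff_of_true this h, iff_of_false (by linarith) (by omega)⟩
  · have := cross_diag_eq_zero hc hab h
    rw [this, h]; simp
  · have := cross_diag_pos hc hij hab h
    rw [cross_swap] at this
    exact ⟨iff_of_false (by linarith) (by omega), iff_of_true (by linarith) h⟩

/-- The signs are equivalent to inequalities between indices in which the surface does not occur. -/
theorem orderEquiv_diag {c c' : ℝ} (hc : 1 ≤ c) (hc' : 1 ≤ c') (a b : ℤ) :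
    OrderEquiv c (vertex c a - vertex c b) c' (vertex c' a - vertex c' b) := by
  have key : ∀ {c : ℝ}, 1 ≤ c → ∀ i j, 
      (0 < cross (vertex c a - vertex c b) (vertex c i - vertex c j) ↔
        (b < a ∧ (j < i ∧ a + b < i + j ∨ i < j ∧ i + j < a + b)) ∨
        (a < b ∧ (j < i ∧ i + j < a + b ∨ i < j ∧ a + b < i + j))) := by
    intro c hc i j
    rcases lt_trichotomy a b with h | rfl | h
    · rw [← neg_sub, cross_neg_left]
      rcases lt_trichotomy i j with h' | rfl | h'
      · rw [← neg_sub (vertex c j), cross_neg_right, neg_neg, (cross_diag_pos_iff hc h h').1]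
        omega
      · simp [cross]
      · rw [neg_pos, (cross_diag_pos_iff hc h h').2]; omega
    · simp [cross]
    · rcases lt_trichotomy i j with h' | rfl | h'
      · rw [← neg_sub (vertex c j), cross_neg_right, neg_pos, (cross_diag_pos_iff hc h h').2]
        omega
      · simp [cross]
      · rw [(cross_diag_pos_iff hc h h').1]; omega
  intro i j
  rw [key hc, key hc']

namespace OrderEquiv

variable {c c' : ℝ} {u u' : Plane}

theorem neg_iff (h : OrderEquiv c u c' u') (i j : ℤ) : cross u (vertex c i - vertex c j) < 0 ↔
    cross u' (vertex c' i - vertex c' j) < 0 := by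
  have := h j i
  rwa [← neg_sub, cross_neg_right, ← neg_sub (vertex c' i), cross_neg_right, neg_pos, neg_pos]
    at this

theorem zero_iff (h : OrderEquiv c u c' u') (i j : ℤ) : cross u (vertex c i - vertex c j) = 0 ↔
    cross u' (vertex c' i - vertex c' j) = 0 := by
  have h1 := h i j
  have h2 := h.neg_iff i j
  constructor <;> intro h0 <;> rw [h0] at h1 h2 <;> simp at h1 h2 <;> linarith

theorem smul (h : OrderEquiv c u c' u') {r : ℝ} (hr : r ≠ 0) :
    OrderEquiv c (r • u) c' (r • u') := by
  intro i j
  rw [cross_smul_left, cross_smul_left]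
  rcases lt_or_gt_of_ne hr with h' | h'
  · rw [mul_pos_iff_neg h', mul_pos_iff_neg h', h.neg_iff]
  · rw [mul_pos_iff_of_pos_left h', mul_pos_iff_of_pos_left h', h i j]

/-- Every direction of the open sector between the horizontal and slope one orders the vertices
along the zigzag, up to the sign of `ε`, on every surface. -/
theorem of_zig (hc : 1 ≤ c) (hc' : 1 ≤ c') {ε : ℝ} (h1 : 0 < ε * u 1)
    (h2 : 0 < ε * (u 0 - u 1)) (h1' : 0 < ε * u' 1) (h2' : 0 < ε * (u' 0 - u' 1)) :
    OrderEquiv c u c' u' := by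
  have key : ∀ {c : ℝ} {u : Plane}, 1 ≤ c → 0 < ε * u 1 → 0 < ε * (u 0 - u 1) → ∀ i j, 0 ≤ i →
      0 ≤ j → (0 < ε * cross u (vertex c (zig i) - vertex c (zig j)) ↔ j < i) := by
    intro c u hc h1 h2 i j hi hj
    have mono := lt_of_step_pos (f := fun k => ε * lineFn c u 0 (zig k)) (a := 0) fun k hk => by
      have := cross_zig_pos hc h1 h2 (show 1 ≤ k + 1 by omega)
      rw [add_sub_cancel_right, ← lineFn_sub c u 0] at this
      linarith
    rw [← lineFn_sub c u 0, mul_sub, sub_pos]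
    constructor
    · intro h
      by_contra! hcon
      rcases hcon.eq_or_lt with rfl | hcon
      · exact h.false
      · exact (h.trans (mono _ _ hi hcon)).false
    · exact mono _ _ hj
  have hε : ε ≠ 0 := by rintro rfl; simp at h1
  intro i j
  obtain ⟨a, ha, rfl⟩ := exists_zig i
  obtain ⟨b, hb, rfl⟩ := exists_zig j
  rcases lt_or_gt_of_ne hε with h' | h'
  · have e1 := key hc h1 h2 b a hb ha
    have e2 := key hc' h1' h2' b a hb ha
    rw [mul_pos_iff_neg h', ← neg_sub, cross_neg_right, neg_lt_zero] at e1 e2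
    rw [e1, e2]
  · have e1 := key hc h1 h2 a b ha hb
    have e2 := key hc' h1' h2' a b ha hb
    rw [mul_pos_iff_of_pos_left h'] at e1 e2
    rw [e1, e2]

end OrderEquiv

/-- Each sequence of edges that is realized in `S_c` is realized in `S_{c'}`. -/
theorem Realizes.transfer {c c' : ℝ} (hc : 1 ≤ c) (hc' : 1 ≤ c') {u : Plane} {k₀ m : ℤ}
    {l : List ℤ} (h : Realizes c u k₀ l m) :
    ∃ u', Realizes c' u' k₀ l m ∧ OrderEquiv c u c' u' := by
  refine h.induction hc (Φ := fun u k₀ l m => ∃ u', Realizes c' u' k₀ l m ∧ OrderEquiv c u c' u')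
    ?_ ?_ ?_ ?_ ?_
  · intro u k₀ m h
    have hm := h.ne rfl
    have hv : ∀ {c : ℝ}, 1 ≤ c → vertex c m - vertex c k₀ ≠ 0 := fun hc h0 =>
      hm (vertex_injective hc (sub_eq_zero.1 h0))
    obtain ⟨t, ht⟩ := eq_smul_of_cross_eq_zero h.ne_zero h.exits.1
    have ht0 : t ≠ 0 := by rintro rfl; rw [zero_smul] at ht; exact hv hc ht
    -- Without crossings the line runs along a diagonal; the partner direction is the same multiple
    -- of the corresponding diagonal.
    have hu : u = t⁻¹ • (vertex c m - vertex c k₀) := by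
      rw [ht, smul_smul, inv_mul_cancel₀ ht0, one_smul]
    have hoe := (orderEquiv_diag hc hc' m k₀).smul (inv_ne_zero ht0)
    rw [← hu] at hoe
    refine ⟨_, ⟨smul_ne_zero (inv_ne_zero ht0) (hv hc'), ?_, h.ne⟩, hoe⟩
    exact ⟨(hoe.zero_iff m k₀).1 h.exits.1, h.exits.2.imp (hoe.neg_iff _ _).1 (hoe _ _).1⟩
  · rintro u k₀ l m ⟨u', hr, hoe⟩
    refine ⟨_, hr.shift, fun i j => ?_⟩
    have := hoe (i - 1) (j - 1)
    rw [← cross_lin c u, ← cross_lin c' u', ← vertex_succ_sub, ← vertex_succ_sub] at this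
    simpa using this
  · rintro u k₀ l m ⟨u', hr, hoe⟩
    refine ⟨_, hr.unshift, fun i j => ?_⟩
    have := hoe (i + 1) (j + 1)
    rw [← cross_lin c (linInv c u), ← cross_lin c' (linInv c' u'), lin_linInv, lin_linInv, ← vertex_succ_sub,
      ← vertex_succ_sub]
    exact this
  · rintro u k₀ l m ⟨u', hr, hoe⟩
    refine ⟨_, hr.refl, fun i j => ?_⟩
    have := hoe.neg_iff (-i) (-j)
    obtain ⟨i, rfl⟩ : ∃ k, i = -k := ⟨-i, by ring⟩
    obtain ⟨j, rfl⟩ : ∃ k, j = -k := ⟨-j, by ring⟩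
    rw [neg_neg, neg_neg] at this
    rw [vertex_neg', vertex_neg', vertex_neg', vertex_neg', ← refl_sub, ← refl_sub, cross_refl,
      cross_refl, neg_pos, neg_pos, this]
  · rintro u n δ l m' w m hn hδ hf h1 h2 hr hr' ⟨u', hu', hoe⟩
    have hs := sgn_mul_self n
    -- The diagonals from -1 to 1 and from 0 to 1 are horizontal and of slope one. Testing on them
    -- transfers the signs of `u 1` and `u 0 - u 1`, so `Realizes.unflip` applies to the partner
    -- direction. This is why the induction carries `OrderEquiv`.
    have e1 := hoe 1 (-1)
    have e2 := hoe.neg_iff 1 (-1)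
    have e3 := hoe 1 0
    have e4 := hoe.neg_iff 1 0
    have v0 : ∀ {c : ℝ}, 1 ≤ c → ∀ u, cross u (vertex c 1 - vertex c (-1)) = -2 * u 1 := by
      intro c hc u
      have := vertex_succ_zero c 0
      rw [vertex_zero, zero_add] at this
      rw [vertex_sub_neg, cross_smul_right, this]; simp [cross]
    have v1 : ∀ {c : ℝ}, 1 ≤ c → ∀ u, cross u (vertex c 1 - vertex c 0) = u 0 - u 1 := by
      intro c hc u
      have := vertex_succ_sub_neg c 0
      have h' := vertex_succ_zero c 0
      rw [vertex_zero, zero_add] at h'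
      simp only [zero_add, neg_zero, h', vertex_zero] at this
      rw [vertex_zero, this, cross_smul_right]; simp [cross]
    have f1 : (flipVec u n δ) 1 = δ * (sgn n * u 1) := by simp [flipVec, bvec, mul_assoc]
    have f2 : (flipVec u n δ) 0 - (flipVec u n δ) 1 = -δ * (sgn n * (u 0 - u 1)) := by
      simp [flipVec, bvec]; ring
    rw [v0 hc, v0 hc', f1] at e1 e2
    rw [v1 hc, v1 hc', f2] at e3 e4
    have g : 0 < δ * u' 1 ∧ 0 < -δ * (u' 0 - u' 1) := by
      rcases hδ with rfl | rfl
      · have := e2.1 (by push_cast; linarith)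
        have := e4.1 (by push_cast; linarith)
        constructor <;> push_cast <;> linarith
      · have := e1.1 (by push_cast; linarith)
        have := e3.1 (by push_cast; linarith)
        constructor <;> push_cast <;> linarith
    obtain ⟨-, w', m'', hf', hr''⟩ := hu'.unflip hc' hδ (by omega) g.1 g.2
    -- The flip of a list is unique, so the list found on the second surface is the given one.
    obtain ⟨rfl, rfl⟩ := hf.functional hδ hf'
    refine ⟨_, hr'', OrderEquiv.of_zig hc hc' (ε := sgn n) h1 h2 ?_ ?_⟩
    · have : sgn n * flipVec u' n δ 1 = sgn n * sgn n * (δ * u' 1) := by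
        simp [flipVec, bvec]; ring
      rw [this, hs, one_mul]; exact g.1
    · have : sgn n * (flipVec u' n δ 0 - flipVec u' n δ 1) =
          sgn n * sgn n * (-δ * (u' 0 - u' 1)) := by
        simp [flipVec, bvec]; ring
      rw [this, hs, one_mul]; exact g.2

/-! ### The directions of realized sequences -/

/-- The vectors in the directions that are images of the horizontal direction or the direction of
slope one under the group generated by `A_c`, `B_c` and the linear part of `T_c`. -/
inductive InOrbit (c : ℝ) : Plane → Prop
  | horizontal (r : ℝ) (hr : r ≠ 0) : InOrbit c (r • ![1, 0])
  | slopeOne (r : ℝ) (hr : r ≠ 0) : InOrbit c (r • ![1, 1])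
  | refl (u : Plane) (h : InOrbit c u) : InOrbit c (ParabolaSurface.refl u)
  | bvec (u : Plane) (h : InOrbit c u) : InOrbit c (ParabolaSurface.bvec u)
  | lin (u : Plane) (h : InOrbit c u) : InOrbit c (ParabolaSurface.lin c u)

namespace InOrbit

variable {c : ℝ} {u : Plane}

theorem smul (h : InOrbit c u) {r : ℝ} (hr : r ≠ 0) : InOrbit c (r • u) := by
  induction h with
  | horizontal s hs => rw [smul_smul]; exact .horizontal _ (mul_ne_zero hr hs)
  | slopeOne s hs => rw [smul_smul]; exact .slopeOne _ (mul_ne_zero hr hs)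
  | refl u h ih => rw [← refl_smul]; exact .refl _ ih
  | bvec u h ih => rw [← bvec_smul]; exact .bvec _ ih
  | lin u h ih => rw [← lin_smul]; exact .lin _ ih

/-- The reflection conjugates the linear part of $T_c$ to its inverse, so `InOrbit` needs no
constructor for inverses. -/
theorem linInv (h : InOrbit c u) : InOrbit c (ParabolaSurface.linInv c u) := by
  have : ParabolaSurface.linInv c u =
      ParabolaSurface.refl (ParabolaSurface.lin c (ParabolaSurface.refl u)) := by
    apply plane_ext <;> simp [ParabolaSurface.linInv, ParabolaSurface.lin,
      ParabolaSurface.refl] <;> ring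
  rw [this]
  exact .refl _ (.lin _ (.refl _ h))

theorem diag (hc : 1 ≤ c) {a b : ℤ} (hab : a ≠ b) : InOrbit c (vertex c a - vertex c b) := by
  have shift : ∀ (e : ℤ) {a b : ℤ}, InOrbit c (vertex c a - vertex c b) →
      InOrbit c (vertex c (a + e) - vertex c (b + e)) := by
    intro e
    induction e using Int.induction_on with
    | zero => intro a b h; simpa using h
    | succ e ih =>
      intro a b h
      rw [← add_assoc, ← add_assoc, vertex_succ_sub]
      exact .lin _ (ih h)
    | pred e ih =>
      intro a b h
      have := (ih h).linInv
      rw [show a + -(e : ℤ) = a + (-e - 1) + 1 by ring,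
        show b + -(e : ℤ) = b + (-e - 1) + 1 by ring, vertex_succ_sub, linInv_lin] at this
      exact this
  rcases Int.even_or_odd (a + b) with ⟨e, he⟩ | ⟨e, he⟩
  · have h0 : vertex c (a - e) 0 ≠ 0 := fun h => by
      have := (vertex_zero_strictMono hc).injective (h.trans (congrFun (vertex_zero c) 0).symm)
      omega
    have := shift e (vertex_sub_neg c (a - e) ▸ InOrbit.horizontal _ (mul_ne_zero two_ne_zero h0))
    rwa [show a - e + e = a by ring, show -(a - e) + e = b by omega] at this
  · have h0 : vertex c (a - e - 1) 0 + vertex c (a - e - 1 + 1) 0 ≠ 0 := fun h => by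
      have h1 : vertex c (a - e - 1 + 1) 0 = vertex c (-(a - e - 1)) 0 := by
        rw [(vertex_neg c _).1]; linarith
      have := (vertex_zero_strictMono hc).injective h1
      omega
    have := shift e (vertex_succ_sub_neg c (a - e - 1) ▸ InOrbit.slopeOne _ h0)
    rwa [show a - e - 1 + 1 + e = a by ring, show -(a - e - 1) + e = b by omega] at this

/-- The reflection and the shift only relabel lists; the case of `bvec` needs an argument. On the
boundary of the sector between the horizontal and slope one, `bvec` fixes the direction up to sign;
outside of the sector `Realizes.unflip` applies, and inside it `Realizes.flip`. -/
theorem exists_realizes (hc : 1 ≤ c) (h : InOrbit c u) :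
    ∃ r : ℝ, r ≠ 0 ∧ ∃ k₀ l m, Realizes c (r • u) k₀ l m := by
  induction h with
  | horizontal s hs =>
    refine ⟨s⁻¹, inv_ne_zero hs, -1, [], 1, ?_⟩
    rw [smul_smul, inv_mul_cancel₀ hs, one_smul]
    refine ⟨fun h => by simpa using congrFun h 0, ⟨?_, .inr ?_⟩, by simp⟩
    · simp [lineFn, cross, (vertex_neg c 1).2]
    · have := vertex_one_lt hc (show (1 : ℤ) < 1 + 1 by omega) (by omega)
      simp [lineFn, cross, (vertex_neg c 1).2] at this ⊢; linarith
  | slopeOne s hs =>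
    refine ⟨s⁻¹, inv_ne_zero hs, 0, [], 1, ?_⟩
    rw [smul_smul, inv_mul_cancel₀ hs, one_smul]
    have h1 := vertex_step_one c 0
    simp only [vertex_zero, zero_add] at h1
    refine ⟨fun h => by simpa using congrFun h 0, ⟨?_, .inr ?_⟩, by simp⟩
    · simp [lineFn, cross, vertex_zero] at h1 ⊢; linarith
    · have := vertex_diff_lt hc (show (1 : ℤ) < 1 + 1 by omega) (by omega)
      simp [lineFn, cross, vertex_zero] at this h1 ⊢; linarith
  | refl u h ih =>
    obtain ⟨r, hr, k₀, l, m, hu⟩ := ih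
    exact ⟨r, hr, _, _, _, refl_smul r u ▸ hu.refl⟩
  | lin u h ih =>
    obtain ⟨r, hr, k₀, l, m, hu⟩ := ih
    exact ⟨r, hr, _, _, _, lin_smul c r u ▸ hu.shift⟩
  | bvec u h ih =>
    obtain ⟨r, hr, k₀, l, m, hu⟩ := ih
    set v := r • u with hv
    have hbv : ∀ {s : ℝ}, s ≠ 0 → ∀ {k₀ l m}, Realizes c (s • ParabolaSurface.bvec v) k₀ l m →
        ∃ r : ℝ, r ≠ 0 ∧ ∃ k₀ l m, Realizes c (r • ParabolaSurface.bvec u) k₀ l m := by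
      intro s hs k₀ l m h
      rw [hv, bvec_smul, smul_smul] at h
      exact ⟨_, mul_ne_zero hs hr, _, _, _, h⟩
    have hflip : ∀ {n δ : ℤ}, δ = 1 ∨ δ = -1 → (δ * sgn n : ℝ) ≠ 0 := fun hδ =>
      left_ne_zero_of_mul_eq_one (sign_mul_self hδ)
    obtain ⟨j, hj, rfl⟩ := exists_zig k₀
    rcases lt_trichotomy (v 1 * (v 0 - v 1)) 0 with h0 | h0 | h0
    · rcases lt_trichotomy (v 1) 0 with h1 | h1 | h1
      · have h2 : 0 < v 0 - v 1 := by nlinarith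
        rw [show zig j = zig (j + -1 - -1) by ring_nf] at hu
        obtain ⟨-, w, m', -, hw⟩ := hu.unflip hc (n := j + -1) (δ := -1) (by simp) (by omega)
          (by push_cast; linarith) (by push_cast; linarith)
        exact hbv (hflip (by simp)) hw
      · rw [h1, zero_mul] at h0; exact (h0.false).elim
      · have h2 : v 0 - v 1 < 0 := by nlinarith
        rw [show zig j = zig (j + 1 - 1) by ring_nf] at hu
        obtain ⟨-, w, m', -, hw⟩ := hu.unflip hc (n := j + 1) (δ := 1) (by simp) (by omega)
          (by push_cast; linarith) (by push_cast; linarith)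
        exact hbv (hflip (by simp)) hw
    · rcases mul_eq_zero.1 h0 with h0 | h0
      · refine hbv (s := -1) (by simp) (k₀ := zig j) (l := l) (m := m) ?_
        convert hu using 1
        apply plane_ext <;> simp [ParabolaSurface.bvec, h0]
      · refine hbv (s := 1) (by simp) (k₀ := zig j) (l := l) (m := m) ?_
        convert hu using 1
        apply plane_ext <;> simp [ParabolaSurface.bvec]
        linarith
    · have hs : 0 < sgn j * v 1 ∧ 0 < sgn j * (v 0 - v 1) ∨
          0 < -sgn j * v 1 ∧ 0 < -sgn j * (v 0 - v 1) := by
        rcases pos_and_pos_or_neg_and_neg_of_mul_pos h0 with ⟨h1, h2⟩ | ⟨h1, h2⟩ <;>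
          rcases sgn_eq j with e | e <;> rw [e]
        · left; constructor <;> linarith
        · right; constructor <;> linarith
        · right; constructor <;> linarith
        · left; constructor <;> linarith
      rcases hs with ⟨h1, h2⟩ | ⟨h1, h2⟩
      -- Inside the sector the values along the zigzag are distinct, so the line meets no second
      -- vertex without a crossing.
      · cases l with
        | nil =>
          exfalso
          have hf := flipped_lineFn hc h1 h2 (δ := -1) (by simp) hj (by omega)
          obtain ⟨i, hi, rfl⟩ := exists_zig m
          have hne := hu.ne rfl
          have e1 : lineFn c v (zig j) (zig i) = 0 := hu.exits.1
          have e2 := lineFn_self c v (zig j)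
          rcases lt_trichotomy i j with h3 | rfl | h3
          · have := hf.mono hi h3
            rw [e1, e2] at this; exact this.false
          · exact hne rfl
          · have := hf.mono hj h3
            rw [e1, e2] at this; exact this.false
        | cons k w =>
          obtain ⟨-, δ, l', m', hδ, -, hl⟩ := hu.flip hc hj h1 h2
          exact hbv (hflip hδ) hl
      -- With this sign the direction points out of the polygon at the starting vertex.
      · exfalso
        have mono := lt_of_step_pos (f := fun k => -sgn j * lineFn c v (zig j) (zig k)) (a := 0)
          fun k hk => by
            have := cross_zig_pos hc h1 h2 (show 1 ≤ k + 1 by omega)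
            rw [add_sub_cancel_right, ← lineFn_sub c v (zig j)] at this
            linarith
        obtain ⟨rfl, rfl⟩ := (exits_iff_of_antitone hj (fun {a b} ha hab => by
          have := mono a b ha hab
          linarith) (lineFn_self c v _)).1 hu.exits
        exact hu.ne rfl rfl

theorem of_realizes (hc : 1 ≤ c) {k₀ m : ℤ} {l : List ℤ} (h : Realizes c u k₀ l m) :
    InOrbit c u := by
  refine h.induction hc (Φ := fun u _ _ _ => InOrbit c u) ?_ ?_ ?_ ?_ ?_
  · intro u k₀ m h
    have hm := h.ne rfl
    have hv := diag hc hm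
    obtain ⟨t, ht⟩ := eq_smul_of_cross_eq_zero h.ne_zero h.exits.1
    have ht0 : t ≠ 0 := by
      rintro rfl
      rw [zero_smul] at ht
      exact hm (vertex_injective hc (sub_eq_zero.1 ht))
    have hu : u = t⁻¹ • (vertex c m - vertex c k₀) := by
      rw [ht, smul_smul, inv_mul_cancel₀ ht0, one_smul]
    rw [hu]
    exact hv.smul (inv_ne_zero ht0)
  · exact fun u _ _ _ h => .lin _ h
  · exact fun u _ _ _ h => h.linInv
  · exact fun u _ _ _ h => .refl _ h
  · intro u n δ l m' w m hn hδ hf h1 h2 hr hr' h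
    have := (InOrbit.bvec _ h).smul (left_ne_zero_of_mul_eq_one (sign_mul_self (n := n) hδ))
    rw [← flipVec_flipVec u (n := n) hδ]
    exact this

end InOrbit

/-! ### Points of the surface -/

theorem edge_subset (c : ℝ) (k : ℤ) : edge c k ⊆ Qplus c :=
  (convex_convexHull ℝ _).segment_subset (vertex_mem c k) (vertex_mem c (k + 1))

/-- The rotation by `π` around the midpoint of the `k`-th edge. -/
def flipPt (c : ℝ) (k : ℤ) (p : Plane) : Plane := vertex c k + vertex c (k + 1) - p

theorem flipPt_flipPt (c : ℝ) (k : ℤ) (p : Plane) : flipPt c k (flipPt c k p) = p := by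
  simp [flipPt]

theorem flipPt_mem {c : ℝ} {k : ℤ} {p : Plane} (hp : p ∈ edge c k) : flipPt c k p ∈ edge c k := by
  obtain ⟨a, b, ha, hb, hab, rfl⟩ := hp
  refine ⟨b, a, hb, ha, by rw [add_comm, hab], ?_⟩
  obtain rfl : b = 1 - a := by linarith
  apply plane_ext <;> simp [flipPt] <;> ring

theorem flipPt_left (c : ℝ) (k : ℤ) : flipPt c k (vertex c k) = vertex c (k + 1) := by
  simp [flipPt]

theorem flipPt_right (c : ℝ) (k : ℤ) : flipPt c k (vertex c (k + 1)) = vertex c k := by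
  simp [flipPt]

theorem side_edge {c : ℝ} {k : ℤ} {p : Plane} (hp : p ∈ edge c k) : side c k p = 0 := by
  obtain ⟨a, b, ha, hb, hab, rfl⟩ := hp
  rw [side_comb c k _ _ hab, side_vertex_left, side_vertex_right]; simp

theorem edge_interior {c : ℝ} {k : ℤ} {p : Plane} (hp : p ∈ edge c k)
    (hv : p ∉ Set.range (vertex c)) :
    ∃ a b : ℝ, 0 < a ∧ 0 < b ∧ a + b = 1 ∧ p = a • vertex c k + b • vertex c (k + 1) := by
  obtain ⟨a, b, ha, hb, hab, rfl⟩ := hp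
  refine ⟨a, b, ha.lt_of_ne ?_, hb.lt_of_ne ?_, hab, rfl⟩
  · rintro rfl
    exact hv ⟨k + 1, by simp at hab; simp [hab]⟩
  · rintro rfl
    exact hv ⟨k, by simp at hab; simp [hab]⟩

theorem side_pos_of_mem_edge {c : ℝ} (hc : 1 ≤ c) {k j : ℤ} {p : Plane} (hp : p ∈ edge c k)
    (hv : p ∉ Set.range (vertex c)) (hjk : j ≠ k) : 0 < side c j p := by
  obtain ⟨a, b, ha, hb, hab, rfl⟩ := edge_interior hp hv
  rw [side_comb c j _ _ hab]
  have h1 := side_vertex_nonneg hc j k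
  have h2 := side_vertex_nonneg hc j (k + 1)
  by_cases h : k = j + 1
  · have := side_vertex_pos hc (k := j) (j := k + 1) (by omega) (by omega)
    nlinarith [mul_pos hb this, mul_nonneg ha.le h1]
  · have := side_vertex_pos hc (k := j) (j := k) (by omega) h
    nlinarith [mul_pos ha this, mul_nonneg hb.le h2]

theorem edge_unique {c : ℝ} (hc : 1 ≤ c) {k j : ℤ} {p : Plane} (hk : p ∈ edge c k)
    (hj : p ∈ edge c j) (hv : p ∉ Set.range (vertex c)) : j = k := by
  by_contra h
  have := side_pos_of_mem_edge hc hk hv h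
  rw [side_edge hj] at this
  exact this.false

theorem cross_edges_pos {c : ℝ} (hc : 1 ≤ c) (k : ℤ) :
    0 < cross (vertex c (k + 1) - vertex c k) (vertex c (k + 1 + 1) - vertex c (k + 1)) :=
  cross_diag_pos hc (by omega) (by omega) (by omega)

theorem eq_zero_of_cross {u v w : Plane} (h : cross u v ≠ 0) (h1 : cross u w = 0)
    (h2 : cross v w = 0) : w = 0 := by
  simp only [cross] at *
  apply plane_ext
  · have : (u 0 * v 1 - u 1 * v 0) * w 0 = 0 := by linear_combination v 0 * h1 - u 0 * h2
    simpa using (mul_eq_zero.1 this).resolve_left h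
  · have : (u 0 * v 1 - u 1 * v 0) * w 1 = 0 := by linear_combination v 1 * h1 - u 1 * h2
    simpa using (mul_eq_zero.1 this).resolve_left h

theorem eq_vertex_of_sides {c : ℝ} (hc : 1 ≤ c) {k : ℤ} {p : Plane} (h1 : side c k p = 0)
    (h2 : side c (k + 1) p = 0) : p = vertex c (k + 1) := by
  rw [← sub_eq_zero]
  refine eq_zero_of_cross (cross_edges_pos hc k).ne' ?_ h2
  rw [← h1, side, ← sub_eq_zero, ← cross_sub_right, ← neg_eq_zero, ← cross_neg_right]
  simpa using cross_self _

/-- Vertices are extreme points: the functions of the two adjacent edges vanish at the vertex and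
are nonnegative on the polygon, so they vanish at `p`. -/
theorem eq_vertex_of_comb {c : ℝ} (hc : 1 ≤ c) {k : ℤ} {p q : Plane} (hp : p ∈ Qplus c)
    (hq : q ∈ Qplus c) {a b : ℝ} (ha : 0 < a) (hb : 0 ≤ b) (hab : a + b = 1)
    (h : a • p + b • q = vertex c k) : p = vertex c k := by
  have key : ∀ j, side c j (vertex c k) = 0 → side c j p = 0 := by
    intro j hj
    rw [← h, side_comb c j _ _ hab] at hj
    have h1 := side_nonneg hc j hp
    have h2 := side_nonneg hc j hq
    have h3 := mul_nonneg ha.le h1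
    have h4 := mul_nonneg hb h2
    exact (mul_eq_zero.1 (show a * side c j p = 0 by linarith)).resolve_left ha.ne'
  obtain ⟨k, rfl⟩ : ∃ j, k = j + 1 := ⟨k - 1, by ring⟩
  exact eq_vertex_of_sides hc (key k (side_vertex_right c k)) (key _ (side_vertex_left c _))

/-- On the line that carries the edge, the conditions from the two neighbouring edges confine the
parameter to `[0, 1]`. -/
theorem mem_edge_of_side {c : ℝ} (hc : 1 ≤ c) {k : ℤ} {p : Plane} (hp : p ∈ Qplus c)
    (h : side c k p = 0) : p ∈ edge c k := by
  have hne : vertex c (k + 1) - vertex c k ≠ 0 :=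
    sub_ne_zero.2 fun h => by have := vertex_injective hc h; omega
  obtain ⟨s, hs⟩ := eq_smul_of_cross_eq_zero hne h
  have e : p = (1 - s) • vertex c k + s • vertex c (k + 1) := by
    rw [sub_eq_iff_eq_add] at hs
    rw [hs]
    apply plane_ext <;> simp <;> ring
  have h1 := side_nonneg hc (k - 1) hp
  have h2 := side_nonneg hc (k + 1) hp
  rw [e, side_comb c _ _ _ (by ring)] at h1 h2
  rw [side_vertex_left] at h2
  have e1 := side_vertex_right c (k - 1)
  rw [sub_add_cancel] at e1
  rw [e1] at h1
  have p1 := side_vertex_pos hc (k := k - 1) (j := k + 1) (by omega) (by omega)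
  have p2 := side_vertex_pos hc (k := k + 1) (j := k) (by omega) (by omega)
  refine ⟨1 - s, s, ?_, ?_, by ring, e.symm⟩
  · by_contra! hcon; nlinarith
  · by_contra! hcon; nlinarith

/-- The point of `S_c` that comes from a point of `Q_c^+` or, after the rotation by `π`, of
`Q_c^-`. (The value outside of `Q_c^+` is irrelevant.) -/
noncomputable def pt (c : ℝ) (ε : Bool) (p : Plane) : S c :=
  open Classical in
  if h : p ∈ Qplus c then (if ε then inPlus ⟨p, h⟩ else inMinus (rot ⟨p, h⟩))
  else inPlus ⟨_, vertex_mem c 0⟩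

theorem pt_true {c : ℝ} {p : Plane} (h : p ∈ Qplus c) : pt c true p = inPlus ⟨p, h⟩ := by
  simp [pt, h]

theorem pt_false {c : ℝ} {p : Plane} (h : p ∈ Qplus c) : pt c false p = inMinus (rot ⟨p, h⟩) := by
  simp [pt, h]

theorem continuousOn_pt (c : ℝ) (ε : Bool) : ContinuousOn (pt c ε) (Qplus c) := by
  rw [continuousOn_iff_continuous_domRestrict]
  cases ε
  · have : (Qplus c).domRestrict (pt c false) = fun p => inMinus (rot p) := by
      funext p; exact pt_false p.2
    rw [this]
    refine continuous_quot_mk.comp (continuous_inr.comp ?_)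
    exact (continuous_subtype_val.neg).subtype_mk _
  · have : (Qplus c).domRestrict (pt c true) = fun p => inPlus p := by
      funext p; exact pt_true p.2
    rw [this]
    exact continuous_quot_mk.comp continuous_inl

/-- Once $Q_c^-$ is rotated onto $Q_c^+$, the gluing translation becomes the rotation around the
midpoint of the edge, with a change of polygon. -/
theorem pt_flipPt {c : ℝ} {k : ℤ} {p : Plane} (hp : p ∈ edge c k) (ε : Bool) :
    pt c (!ε) (flipPt c k p) = pt c ε p := by
  have key : ∀ {p}, p ∈ edge c k → pt c true p = pt c false (flipPt c k p) := by
    intro p hp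
    rw [pt_true (edge_subset c k hp), pt_false (edge_subset c k (flipPt_mem hp))]
    refine Quot.sound (Glue.edge k _ _ hp ?_)
    simp [rot, flipPt]
  cases ε
  · have := key (flipPt_mem hp)
    rwa [flipPt_flipPt] at this
  · exact (key hp).symm

/-- A predicate that respects the gluing descends to the quotient. Suitable choices of `R`
distinguish the points of the surface. -/
theorem pt_congr {c : ℝ} {R : Bool → Plane → Prop}
    (hR : ∀ k p, p ∈ edge c k → (R true p ↔ R false (flipPt c k p))) {ε ε' : Bool} {p p' : Plane}
    (hp : p ∈ Qplus c) (hp' : p' ∈ Qplus c) (h : pt c ε p = pt c ε' p') : R ε p ↔ R ε' p' := by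
  let f : S c → Prop := Quot.lift
    (fun x : Qplus c ⊕ Qminus c => Sum.elim (fun p => R true p.1) (fun q => R false (-q.1)) x) (by
      rintro _ _ ⟨k, p, q, hp, hq⟩
      simp only [Sum.elim_inl, Sum.elim_inr]
      rw [hR k p hp, hq, flipPt, neg_sub])
  have hf : ∀ ε p, p ∈ Qplus c → (f (pt c ε p) ↔ R ε p) := by
    intro ε p hp
    cases ε
    · rw [pt_false hp]
      simp [f, inMinus, rot]
    · rw [pt_true hp]
      simp [f, inPlus]
  rw [← hf ε p hp, h, hf ε' p' hp']

theorem flipPt_vertex {c : ℝ} {k : ℤ} {p : Plane} (hc : 1 ≤ c) (hp : p ∈ edge c k) :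
    flipPt c k p ∈ Set.range (vertex c) ↔ p ∈ Set.range (vertex c) := by
  have key : ∀ {p}, p ∈ edge c k → p ∈ Set.range (vertex c) →
      flipPt c k p ∈ Set.range (vertex c) := by
    rintro p hp ⟨j, rfl⟩
    have h := side_edge hp
    have : j = k ∨ j = k + 1 := by
      by_contra! hcon
      exact (side_vertex_pos hc hcon.1 hcon.2).ne' h
    rcases this with rfl | rfl
    · exact ⟨_, (flipPt_left c j).symm⟩
    · exact ⟨_, (flipPt_right c k).symm⟩
  refine ⟨fun h => ?_, key hp⟩
  have := key (flipPt_mem hp) h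
  rwa [flipPt_flipPt] at this

theorem pt_vertex_mem (c : ℝ) (ε : Bool) (k : ℤ) : pt c ε (vertex c k) ∈ singular c := by
  cases ε
  · rw [← pt_flipPt (left_mem_segment ℝ _ _), flipPt_left]
    exact ⟨k + 1, (pt_true (vertex_mem c _)).symm⟩
  · exact ⟨k, (pt_true (vertex_mem c k)).symm⟩

theorem pt_mem_singular {c : ℝ} (hc : 1 ≤ c) {ε : Bool} {p : Plane} (hp : p ∈ Qplus c) :
    pt c ε p ∈ singular c ↔ p ∈ Set.range (vertex c) := by
  constructor
  · rintro ⟨k, hk⟩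
    have := pt_congr (R := fun _ p => p ∈ Set.range (vertex c)) (ε := true) (p := vertex c k)
      (ε' := ε) (p' := p) (fun k p hp => (flipPt_vertex hc hp).symm) (vertex_mem c k) hp
      (by rw [pt_true (vertex_mem c k)]; exact hk)
    exact this.1 ⟨k, rfl⟩
  · rintro ⟨k, rfl⟩
    exact pt_vertex_mem c ε k

/-- The alternative in the conclusion respects the gluing, as a point other than a vertex lies on at
most one edge; `pt_congr` applies to it. -/
theorem pt_eq {c : ℝ} (hc : 1 ≤ c) {ε ε' : Bool} {p p' : Plane} (hp : p ∈ Qplus c)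
    (hp' : p' ∈ Qplus c) (hv : p ∉ Set.range (vertex c)) (h : pt c ε p = pt c ε' p') :
    (ε' = ε ∧ p' = p) ∨ (ε' = !ε ∧ ∃ k, p ∈ edge c k ∧ p' = flipPt c k p) := by
  have key : ∀ k q ε₁, q ∈ edge c k →
      ((ε₁ = ε ∧ q = p) ∨ (ε₁ = !ε ∧ ∃ k, p ∈ edge c k ∧ q = flipPt c k p)) →
      (((!ε₁) = ε ∧ flipPt c k q = p) ∨
        ((!ε₁) = !ε ∧ ∃ j, p ∈ edge c j ∧ flipPt c k q = flipPt c j p)) := by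
    rintro k q ε₁ hq (⟨rfl, rfl⟩ | ⟨rfl, j, hj, rfl⟩)
    · exact .inr ⟨rfl, k, hq, rfl⟩
    · have hv' : flipPt c j p ∉ Set.range (vertex c) := fun h => hv ((flipPt_vertex hc hj).1 h)
      obtain rfl := edge_unique hc (flipPt_mem hj) hq hv'
      exact .inl ⟨by simp, flipPt_flipPt _ _ _⟩
  refine (pt_congr (R := fun ε₁ q => (ε₁ = ε ∧ q = p) ∨
    (ε₁ = !ε ∧ ∃ k, p ∈ edge c k ∧ q = flipPt c k p)) (fun k q hq => ⟨key k q true hq, fun h' => ?_⟩)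
    hp hp' h).1 (.inl ⟨rfl, rfl⟩)
  have := key k _ false (flipPt_mem hq) h'
  rwa [flipPt_flipPt] at this

/-! ### Geodesics and sequences of edges -/

/-- During the times `t₀ ≤ t ≤ t₁`, `γ` is straight with velocity `v` and stays in one of
the polygons; the polygon `Q_c^-` is rotated by `π`. -/
def Straight (c : ℝ) (γ : ℝ → S c) (ε : Bool) (v a : Plane) (t₀ t₁ : ℝ) : Prop :=
  ∀ t ∈ Set.Icc t₀ t₁, a + (t - t₀) • v ∈ Qplus c ∧ γ t = pt c ε (a + (t - t₀) • v)

/-- From time `t₀` to time `T`, `γ` is a geodesic that starts at the point `a` of the polygon `ε`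
with velocity `v`, crosses the edges in the list `l`, and arrives at the vertex `m`. The polygon
`Q_c^-` is rotated by `π`. -/
inductive Geod (c : ℝ) (γ : ℝ → S c) (T : ℝ) :
    ℝ → Bool → Plane → Plane → List ℤ → ℤ → Prop
  | nil {t₀ : ℝ} {ε : Bool} {v a : Plane} {m : ℤ} (ht : t₀ < T) (hs : Straight c γ ε v a t₀ T)
      (hm : a + (T - t₀) • v = vertex c m) : Geod c γ T t₀ ε v a [] m
  | cons {t₀ t₁ : ℝ} {ε : Bool} {v a : Plane} {k : ℤ} {l : List ℤ} {m : ℤ} (ht : t₀ < t₁)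
      (hs : Straight c γ ε v a t₀ t₁) (he : a + (t₁ - t₀) • v ∈ edge c k)
      (hv : a + (t₁ - t₀) • v ∉ Set.range (vertex c))
      (hk : 0 < cross v (vertex c (k + 1) - vertex c k))
      (h : Geod c γ T t₁ (!ε) (-v) (flipPt c k (a + (t₁ - t₀) • v)) l m) :
      Geod c γ T t₀ ε v a (k :: l) m

theorem Straight.trans {c : ℝ} {γ : ℝ → S c} {ε : Bool} {v a : Plane} {t₀ t₁ t₂ : ℝ}
    (h : Straight c γ ε v a t₀ t₁) (h' : Straight c γ ε v (a + (t₁ - t₀) • v) t₁ t₂) :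
    Straight c γ ε v a t₀ t₂ := by
  intro t ht
  rcases le_total t t₁ with h1 | h1
  · exact h t ⟨ht.1, h1⟩
  · have := h' t ⟨h1, ht.2⟩
    rwa [add_assoc, ← add_smul, show t₁ - t₀ + (t - t₁) = t - t₀ by ring] at this

theorem Straight.mem_left {c : ℝ} {γ : ℝ → S c} {ε : Bool} {v a : Plane} {t₀ t₁ : ℝ}
    (h : Straight c γ ε v a t₀ t₁) (ht : t₀ ≤ t₁) : a ∈ Qplus c ∧ γ t₀ = pt c ε a := by
  simpa using h t₀ ⟨le_rfl, ht⟩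

theorem Straight.mem_right {c : ℝ} {γ : ℝ → S c} {ε : Bool} {v a : Plane} {t₀ t₁ : ℝ}
    (h : Straight c γ ε v a t₀ t₁) (ht : t₀ ≤ t₁) :
    a + (t₁ - t₀) • v ∈ Qplus c ∧ γ t₁ = pt c ε (a + (t₁ - t₀) • v) :=
  h t₁ ⟨ht, le_rfl⟩

theorem Straight.congr {c : ℝ} {γ γ' : ℝ → S c} {ε : Bool} {v a : Plane} {t₀ t₁ : ℝ}
    (h : Straight c γ ε v a t₀ t₁) (hγ : ∀ t ∈ Set.Icc t₀ t₁, γ' t = γ t) :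
    Straight c γ' ε v a t₀ t₁ := fun t ht => by rw [hγ t ht]; exact h t ht

theorem side_add {c : ℝ} (k : ℤ) (a v : Plane) (s : ℝ) :
    side c k (a + s • v) = side c k a - s * cross v (vertex c (k + 1) - vertex c k) := by
  simp [side, cross]; ring

theorem Straight.continuousOn {c : ℝ} {γ : ℝ → S c} {ε : Bool} {v a : Plane} {t₀ t₁ : ℝ}
    (h : Straight c γ ε v a t₀ t₁) : ContinuousOn γ (Set.Icc t₀ t₁) := by
  refine ContinuousOn.congr (f := fun t => pt c ε (a + (t - t₀) • v)) ?_ fun t ht => (h t ht).2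
  refine (continuousOn_pt c ε).comp ?_ fun t ht => (h t ht).1
  fun_prop

theorem Straight.notMem_singular {c : ℝ} (hc : 1 ≤ c) {γ : ℝ → S c} {ε : Bool} {v a : Plane}
    {t₀ t₁ : ℝ} (hv : v ≠ 0) (h : Straight c γ ε v a t₀ t₁) {t : ℝ} (ht : t ∈ Set.Ioo t₀ t₁) :
    γ t ∉ singular c := by
  have ht' := Set.Ioo_subset_Icc_self ht
  obtain ⟨h1, h2⟩ := h t ht'
  rw [h2, pt_mem_singular hc h1]
  rintro ⟨k, hk⟩
  have hlt := ht.1.trans ht.2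
  have hl := (h.mem_left hlt.le).1
  have hr := (h.mem_right hlt.le).1
  have hpos : 0 < t₁ - t₀ := by linarith
  have := eq_vertex_of_comb hc hl hr (a := (t₁ - t) / (t₁ - t₀)) (b := (t - t₀) / (t₁ - t₀))
    (div_pos (by linarith [ht.2]) hpos) (div_nonneg (by linarith [ht.1]) hpos.le)
    (by field_simp; ring) (k := k) (by
      rw [hk]
      apply plane_ext <;> simp <;> field_simp <;> ring)
  rw [this, left_eq_add, smul_eq_zero] at hk
  rcases hk with hk | hk
  · linarith [ht.1]
  · exact hv hk

namespace Geod

variable {c : ℝ} {γ : ℝ → S c} {T t₀ : ℝ} {ε : Bool} {v a : Plane} {l : List ℤ} {m : ℤ}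

theorem lt (h : Geod c γ T t₀ ε v a l m) : t₀ < T := by
  induction h with
  | nil ht => exact ht
  | cons ht _ _ _ _ _ ih => exact ht.trans ih

theorem start (h : Geod c γ T t₀ ε v a l m) : a ∈ Qplus c ∧ γ t₀ = pt c ε a := by
  cases h with
  | nil ht hs => exact hs.mem_left ht.le
  | cons ht hs => exact hs.mem_left ht.le

theorem congr {γ' : ℝ → S c} (h : Geod c γ T t₀ ε v a l m)
    (hγ : ∀ t ∈ Set.Icc t₀ T, γ' t = γ t) : Geod c γ' T t₀ ε v a l m := by
  induction h with
  | nil ht hs hm => exact nil ht (hs.congr hγ) hm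
  | cons ht hs he hv hk h ih =>
    exact cons ht (hs.congr fun t h1 => hγ t ⟨h1.1, h1.2.trans h.lt.le⟩) he hv hk
      (ih fun t h1 => hγ t ⟨ht.le.trans h1.1, h1.2⟩)

theorem continuousOn (h : Geod c γ T t₀ ε v a l m) : ContinuousOn γ (Set.Icc t₀ T) := by
  induction h with
  | nil ht hs hm => exact hs.continuousOn
  | cons ht hs he hv hk h ih =>
    rw [← Set.Icc_union_Icc_eq_Icc ht.le h.lt.le]
    exact hs.continuousOn.union_of_isClosed ih isClosed_Icc isClosed_Icc

theorem notMem_singular (hc : 1 ≤ c) (hv : v ≠ 0) (h : Geod c γ T t₀ ε v a l m) {t : ℝ}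
    (ht : t ∈ Set.Ioo t₀ T) : γ t ∉ singular c := by
  induction h with
  | nil _ hs _ => exact hs.notMem_singular hc hv ht
  | @cons t₀ t₁ _ _ _ _ _ _ ht' hs he hv' hk h ih =>
    rcases lt_trichotomy t t₁ with h1 | rfl | h1
    · exact hs.notMem_singular hc hv ⟨ht.1, h1⟩
    · rw [(hs.mem_right ht'.le).2, pt_mem_singular hc (hs.mem_right ht'.le).1]
      exact hv'
    · exact ih (neg_ne_zero.2 hv) ⟨h1, ht.2⟩

/-- A geodesic that ends at a vertex does so at the end of its last piece. -/
theorem extend (h : Geod c γ T t₀ ε v a l m) {t' : ℝ} {a' : Plane} (ht : t' < t₀)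
    (hs : Straight c γ ε v a' t' t₀) (ha : a' + (t₀ - t') • v = a) :
    Geod c γ T t' ε v a' l m := by
  subst ha
  have key : ∀ s : ℝ, a' + (t₀ - t') • v + (s - t₀) • v = a' + (s - t') • v := by
    intro s
    rw [add_assoc, ← add_smul]
    congr 2; ring
  cases h with
  | nil ht' hs' hm => exact nil (ht.trans ht') (hs.trans hs') (by rw [← key, hm])
  | cons ht' hs' he hv hk h =>
    rw [key] at he hv h
    exact cons (ht.trans ht') (hs.trans hs') he hv hk h

/-- A geodesic with the direction of the edge stays on this edge until it reaches a vertex. The edge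
belongs to both polygons, so the piece can be drawn in the first one and no crossing is recorded. -/
theorem switch (hc : 1 ≤ c) {k : ℤ} {b : Plane} (hb : b ∈ edge c k)
    (hk : cross v (vertex c (k + 1) - vertex c k) = 0)
    (h : Geod c γ T t₀ (!ε) (-v) (flipPt c k b) l m) : ∃ m', Geod c γ T t₀ ε v b [] m' := by
  have hside : ∀ s : ℝ, side c k (flipPt c k b + s • -v) = 0 := by
    intro s
    rw [side_add, side_edge (flipPt_mem hb), cross_neg_left, hk]; simp
  have hflip : ∀ s : ℝ, flipPt c k (flipPt c k b + s • -v) = b + s • v := by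
    intro s; simp only [flipPt, smul_neg]; abel
  cases h with
  | nil ht hs hm =>
    have hst : Straight c γ ε v b t₀ T := by
      intro t h1
      obtain ⟨h2, h3⟩ := hs t h1
      have h4 := mem_edge_of_side hc h2 (hside _)
      rw [← hflip]
      exact ⟨edge_subset c k (flipPt_mem h4), by rw [h3, ← pt_flipPt h4, Bool.not_not]⟩
    have h4 := mem_edge_of_side hc (hs.mem_right ht.le).1 (hside _)
    obtain ⟨m', hm'⟩ := (flipPt_vertex hc h4).2 ⟨m, hm.symm⟩
    exact ⟨m', nil ht hst (by rw [← hflip, hm'])⟩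
  | @cons _ t₁ _ _ _ j _ _ ht hs he hv hk' h =>
    have h4 := mem_edge_of_side hc (hs.mem_right ht.le).1 (hside _)
    obtain rfl := edge_unique hc h4 he hv
    rw [cross_neg_left, hk] at hk'
    simp at hk'

/-- At the final vertex, nonnegativity of the two adjacent edge functions at the starting point
yields `OutVertex`: if both of its alternatives failed, the starting point would be that vertex. -/
theorem exits (hc : 1 ≤ c) (hv : v ≠ 0) (h : Geod c γ T t₀ ε v a l m) :
    Exits (fun k => cross v (vertex c k - a)) l m := by
  induction h with
  | @nil t₀ ε v a m ht hs hm =>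
    have ha := (hs.mem_left ht.le).1
    have hpos : 0 < T - t₀ := by linarith
    obtain ⟨j, rfl⟩ : ∃ j, m = j + 1 := ⟨m - 1, by ring⟩
    have hne : a ≠ vertex c (j + 1) := by
      rintro rfl
      rw [add_eq_left, smul_eq_zero] at hm
      rcases hm with hm | hm
      · exact hpos.ne' hm
      · exact hv hm
    have e1 := side_add (c := c) j a v (T - t₀)
    have e2 := side_add (c := c) (j + 1) a v (T - t₀)
    rw [hm, side_vertex_right] at e1
    rw [hm, side_vertex_left] at e2
    have n1 := side_nonneg hc j ha
    have n2 := side_nonneg hc (j + 1) ha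
    refine ⟨by beta_reduce; rw [← hm]; simp [cross]; ring, ?_⟩
    rw [add_sub_cancel_right]
    beta_reduce
    have f1 : cross v (vertex c j - a) = -cross v (vertex c (j + 1) - vertex c j) := by
      rw [← hm]; simp [cross]; ring
    have f2 : cross v (vertex c (j + 1 + 1) - a)
        = cross v (vertex c (j + 1 + 1) - vertex c (j + 1)) := by
      rw [← hm]; simp [cross]; ring
    rw [f1, f2]
    by_contra! hcon
    apply hne
    apply eq_vertex_of_sides hc
    · nlinarith [hcon.1]
    · nlinarith [hcon.2]
  | @cons t₀ t₁ ε v a k l m ht hs he hv' hk h ih =>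
    obtain ⟨α, β, hα, hβ, hαβ, e⟩ := edge_interior he hv'
    obtain rfl : α = 1 - β := by linarith
    have key : ∀ p, cross v (p - a) = cross v (p - (a + (t₁ - t₀) • v)) := by
      intro p; simp [cross]; ring
    refine ⟨⟨?_, ?_⟩, ?_⟩
    · have : cross v (vertex c k - a) = -(β * cross v (vertex c (k + 1) - vertex c k)) := by
        rw [key, e]; simp [cross]; ring
      simp only [this]; nlinarith
    · have : cross v (vertex c (k + 1) - a)
          = (1 - β) * cross v (vertex c (k + 1) - vertex c k) := by
        rw [key, e]; simp [cross]; ring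
      simp only [this]; nlinarith
    · convert ih (neg_ne_zero.2 hv) using 2 with j
      simp [crossed, flipPt, cross]; ring

end Geod

/-- The velocity, up to the rotation by `π` of `Q_c^-`. -/
def fold (ε : Bool) (v : Plane) : Plane := if ε then v else -v

theorem fold_not (ε : Bool) (v : Plane) : fold (!ε) v = -fold ε v := by
  cases ε <;> simp [fold]

theorem fold_fold (ε : Bool) (v : Plane) : fold ε (fold ε v) = v := by
  cases ε <;> simp [fold]

theorem fold_ne_zero {ε : Bool} {v : Plane} (hv : v ≠ 0) : fold ε v ≠ 0 := by
  cases ε <;> simpa [fold] using hv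

theorem fold_eq (ε : Bool) (v : Plane) : fold ε v = v ∨ fold ε v = -v := by
  cases ε <;> simp [fold]

theorem StraightOn.straight {c : ℝ} {x y : S c} {σ : Path x y} {v : Plane} {t₀ t₁ : ℝ}
    (h : StraightOn σ v t₀ t₁) (h0 : 0 ≤ t₀) (h1 : t₁ ≤ 1) :
    ∃ ε a, Straight c σ.extend ε (fold ε v) a t₀ t₁ := by
  obtain ⟨p, hp | hp⟩ := h
  · refine ⟨true, p + t₀ • v, fun t ht => ?_⟩
    have ht' : t ∈ Set.Icc (0 : ℝ) 1 := ⟨h0.trans ht.1, ht.2.trans h1⟩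
    obtain ⟨h2, h3⟩ := hp ⟨t, ht'⟩ ht.1 ht.2
    have e : p + t₀ • v + (t - t₀) • fold true v = p + t • v := by
      simp only [fold, if_true]; rw [add_assoc, ← add_smul]; congr 2; ring
    rw [e, Path.extend_apply _ ht', h3]
    exact ⟨h2, (pt_true h2).symm⟩
  · refine ⟨false, -(p + t₀ • v), fun t ht => ?_⟩
    have ht' : t ∈ Set.Icc (0 : ℝ) 1 := ⟨h0.trans ht.1, ht.2.trans h1⟩
    obtain ⟨h2, h3⟩ := hp ⟨t, ht'⟩ ht.1 ht.2
    have e : -(p + t₀ • v) + (t - t₀) • fold false v = -(p + t • v) := by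
      simp only [fold]
      apply plane_ext <;> simp <;> ring
    have h4 : -(p + t • v) ∈ Qplus c := h2
    rw [e, Path.extend_apply _ ht', h3]
    refine ⟨h4, ?_⟩
    rw [pt_false h4]
    simp [rot]

theorem Straight.straightOn {c : ℝ} {x y : S c} {σ : Path x y} {v : Plane} {t₀ t₁ : ℝ} {ε : Bool}
    {a : Plane} (h : Straight c σ.extend ε (fold ε v) a t₀ t₁) : StraightOn σ v t₀ t₁ := by
  cases ε
  · refine ⟨-a - t₀ • v, .inr fun t h1 h2 => ?_⟩
    obtain ⟨h3, h4⟩ := h t ⟨h1, h2⟩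
    have e : -a - t₀ • v + (t : ℝ) • v = -(a + ((t : ℝ) - t₀) • fold false v) := by
      apply plane_ext <;> simp [fold] <;> ring
    rw [e]
    refine ⟨by simpa [Qminus] using h3, ?_⟩
    rw [pt_false h3, Path.extend_extends'] at h4
    exact h4
  · refine ⟨a - t₀ • v, .inl fun t h1 h2 => ?_⟩
    obtain ⟨h3, h4⟩ := h t ⟨h1, h2⟩
    have e : a - t₀ • v + (t : ℝ) • v = a + ((t : ℝ) - t₀) • fold true v := by
      apply plane_ext <;> simp [fold] <;> ring
    rw [e]
    refine ⟨h3, ?_⟩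
    rw [pt_true h3, Path.extend_extends'] at h4
    exact h4

/-- A saddle connection is described by a sequence of edges. -/
theorem IsSaddleConnectionWith.geod {c : ℝ} (hc : 1 ≤ c) {x y : S c} {σ : Path x y} {v : Plane}
    (h : IsSaddleConnectionWith σ v) :
    ∃ ε k₀ l m, Geod c σ.extend 1 0 ε (fold ε v) (vertex c k₀) l m := by
  obtain ⟨n, τ, hτ, h0, h1, hs⟩ := h.straight
  have hr : ∀ i, τ i ∈ Set.Icc (0 : ℝ) 1 := fun i =>
    ⟨h0 ▸ hτ.monotone (Fin.zero_le i), h1 ▸ hτ.monotone (Fin.le_last i)⟩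
  -- Backward induction over the cuts: a piece in the same polygon is merged with its successor, a
  -- change of polygon is recorded as a crossing, and a change along an edge is undone by
  -- `Geod.switch`.
  have key : ∀ i, i = Fin.last n ∨
      ∃ ε a l m, Geod c σ.extend 1 (τ i) ε (fold ε v) a l m := by
    intro i
    induction i using Fin.reverseInduction with
    | last => exact .inl rfl
    | cast i ih =>
      right
      obtain ⟨ε, a, hst⟩ := (hs i).straight (hr _).1 (hr _).2
      have hlt : τ i.castSucc < τ i.succ := hτ Fin.castSucc_lt_succ
      obtain ⟨hb, hb'⟩ := hst.mem_right hlt.le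
      rcases ih with ih | ⟨ε', a', l, m, ih⟩
      · rw [ih, h1] at hst hb hb' hlt
        have : pt c ε (a + (1 - τ i.castSucc) • fold ε v) ∈ singular c := by
          rw [← hb', Path.extend_one]; exact h.target_mem
        obtain ⟨m, hm⟩ := (pt_mem_singular hc hb).1 this
        exact ⟨ε, a, [], m, .nil hlt hst hm.symm⟩
      · have hv : a + (τ i.succ - τ i.castSucc) • fold ε v ∉ Set.range (vertex c) := by
          rw [← pt_mem_singular hc hb (ε := ε), ← hb', Path.extend_apply _ (hr _)]
          refine h.interior_notMem _ ?_ ?_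
          · intro h2
            have := congrArg Subtype.val h2
            simp only [Set.Icc.coe_zero] at this
            linarith [(hr i.castSucc).1]
          · intro h2
            have := congrArg Subtype.val h2
            simp only [Set.Icc.coe_one] at this
            linarith [ih.lt]
        rcases pt_eq hc hb ih.start.1 hv (hb'.symm.trans ih.start.2) with
          ⟨rfl, e⟩ | ⟨rfl, k, hk, e⟩
        · exact ⟨_, a, l, m, ih.extend hlt hst e.symm⟩
        · rw [fold_not, e] at ih
          -- The geodesic reaches the edge from the inner side.
          have h2 : 0 ≤ cross (fold ε v) (vertex c (k + 1) - vertex c k) := by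
            have e1 := side_add (c := c) k a (fold ε v) (τ i.succ - τ i.castSucc)
            rw [side_edge hk] at e1
            have := side_nonneg hc k (hst.mem_left hlt.le).1
            by_contra! hcon
            nlinarith
          rcases h2.eq_or_lt with h2 | h2
          · obtain ⟨m', hm'⟩ := ih.switch hc hk h2.symm
            exact ⟨ε, a, [], m', hm'.extend hlt hst rfl⟩
          · exact ⟨ε, a, _, m, .cons hlt hst hk hv h2 ih⟩
  rcases key 0 with h2 | ⟨ε, a, l, m, h2⟩
  · rw [h2, h1] at h0
    norm_num at h0
  · rw [h0] at h2
    have : pt c ε a ∈ singular c := by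
      rw [← h2.start.2, Path.extend_zero]; exact h.source_mem
    obtain ⟨k₀, rfl⟩ := (pt_mem_singular hc h2.start.1).1 this
    exact ⟨ε, k₀, l, m, h2⟩

theorem Geod.cuts {c : ℝ} {γ : ℝ → S c} {T t₀ : ℝ} {ε : Bool} {v a : Plane} {l : List ℤ} {m : ℤ}
    (h : Geod c γ T t₀ ε (fold ε v) a l m) :
    ∃ (n : ℕ) (τ : Fin (n + 1) → ℝ), StrictMono τ ∧ τ 0 = t₀ ∧ τ (Fin.last n) = T ∧
      ∀ i : Fin n, ∃ ε' a', Straight c γ ε' (fold ε' v) a' (τ i.castSucc) (τ i.succ) := by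
  generalize hw : fold ε v = w at h
  induction h with
  | @nil t₀ ε w a m ht hs hm =>
    subst hw
    refine ⟨1, ![t₀, T], ?_, rfl, rfl, fun i => ⟨ε, a, ?_⟩⟩
    · rw [Fin.strictMono_iff_lt_succ]
      intro i; fin_cases i; simpa using ht
    · fin_cases i; simpa using hs
  | @cons t₀ t₁ ε w a k l m ht hs he hv hk h ih =>
    subst hw
    obtain ⟨n, τ, h1, h2, h3, h4⟩ := ih (fold_not _ _)
    refine ⟨n + 1, Fin.cons t₀ τ, ?_, rfl, by rw [← Fin.succ_last, Fin.cons_succ, h3], fun i => ?_⟩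
    · rw [Fin.strictMono_iff_lt_succ]
      intro i
      refine Fin.cases ?_ (fun i => ?_) i
      · simpa [h2] using ht
      · rw [← Fin.succ_castSucc, Fin.cons_succ, Fin.cons_succ]
        exact h1 Fin.castSucc_lt_succ
    · refine Fin.cases ?_ (fun i => ?_) i
      · refine ⟨ε, a, ?_⟩
        simpa [h2] using hs
      · rw [← Fin.succ_castSucc, Fin.cons_succ, Fin.cons_succ]
        exact h4 i

/-- A geodesic that joins vertices is a saddle connection. -/
theorem Geod.isSaddleConnectionWith {c : ℝ} (hc : 1 ≤ c) {x y : S c} {σ : Path x y} {ε : Bool}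
    {v : Plane} {k₀ : ℤ} {l : List ℤ} {m : ℤ} (hv : v ≠ 0) (hy : y ∈ singular c)
    (h : Geod c σ.extend 1 0 ε (fold ε v) (vertex c k₀) l m) : IsSaddleConnectionWith σ v := by
  refine ⟨hv, ?_, hy, fun t h0 h1 => ?_, ?_⟩
  · have := h.start.2
    rw [Path.extend_zero] at this
    rw [this]
    exact pt_vertex_mem c ε k₀
  · rw [← Path.extend_extends']
    exact h.notMem_singular hc (fold_ne_zero hv)
      ⟨unitInterval.pos_iff_ne_zero.2 h0, unitInterval.lt_one_iff_ne_one.2 h1⟩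
  · obtain ⟨n, τ, h1, h2, h3, h4⟩ := h.cuts
    refine ⟨n, τ, h1, h2, h3, fun i => ?_⟩
    obtain ⟨ε', a', h5⟩ := h4 i
    exact h5.straightOn

theorem Geod.finish {c : ℝ} {γ : ℝ → S c} {T t₀ : ℝ} {ε : Bool} {v a : Plane} {l : List ℤ} {m : ℤ}
    (h : Geod c γ T t₀ ε v a l m) : ∃ ε', γ T = pt c ε' (vertex c m) := by
  induction h with
  | nil ht hs hm => exact ⟨_, by rw [← hm]; exact (hs.mem_right ht.le).2⟩
  | cons _ _ _ _ _ _ ih => exact ih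

theorem Geod.scale {c : ℝ} {γ : ℝ → S c} {T t₀ : ℝ} {ε : Bool} {v a : Plane} {l : List ℤ} {m : ℤ}
    (h : Geod c γ T t₀ ε v a l m) {r : ℝ} (hr : 0 < r) :
    Geod c (fun t => γ (r * t)) (T / r) (t₀ / r) ε (r • v) a l m := by
  have key : ∀ s s₀ : ℝ, (s / r - s₀ / r) • r • v = (s - s₀) • v := by
    intro s s₀
    rw [smul_smul]; congr 1; field_simp
  have hst : ∀ {ε v a t₀ t₁}, Straight c γ ε v a t₀ t₁ →
      Straight c (fun t => γ (r * t)) ε (r • v) a (t₀ / r) (t₁ / r) := by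
    intro ε v a t₀ t₁ h t ht
    have h1 : t₀ ≤ r * t := by have := ht.1; rwa [div_le_iff₀' hr] at this
    have h2 : r * t ≤ t₁ := by have := ht.2; rwa [le_div_iff₀' hr] at this
    have := h _ ⟨h1, h2⟩
    rwa [show (r * t - t₀) • v = (t - t₀ / r) • r • v by
      rw [smul_smul]; congr 1; field_simp] at this
  clear key
  have key : ∀ (s s₀ : ℝ) (v : Plane), (s / r - s₀ / r) • r • v = (s - s₀) • v := by
    intro s s₀ v
    rw [smul_smul]; congr 1; field_simp
  induction h with
  | nil ht hs hm => exact nil (div_lt_div_of_pos_right ht hr) (hst hs) (by rw [key, hm])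
  | cons ht hs he hv hk h ih =>
    refine cons (div_lt_div_of_pos_right ht hr) (hst hs) (by rwa [key]) (by rwa [key])
      (by rw [cross_smul_left]; positivity) ?_
    rw [key, ← smul_neg]
    exact ih

/-- Every sequence of edges that is crossed by a line is crossed by a geodesic. -/
theorem exists_geod_of_exits {c : ℝ} (hc : 1 ≤ c) {v a : Plane} {l : List ℤ} {m : ℤ} {F : ℤ → ℝ}
    (hv : v ≠ 0) (ha : a ∈ Qplus c) (hF : ∀ k, F k = cross v (vertex c k - a))
    (h : Exits F l m) (h1 : ∀ k, OutEdge F k → 0 < side c k a) (h2 : l = [] → a ≠ vertex c m)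
    (ε : Bool) (t₀ : ℝ) : ∃ T γ, Geod c γ T t₀ ε v a l m := by
  induction l generalizing v a F ε t₀ with
  | nil =>
    obtain ⟨h3, h4⟩ := h
    rw [hF] at h3
    obtain ⟨s, hs⟩ := eq_smul_of_cross_eq_zero hv h3
    have hs' : vertex c m = a + s • v := by rw [← hs]; abel
    have hne : s ≠ 0 := by rintro rfl; exact h2 rfl (by simpa using hs'.symm)
    -- `OutVertex` fixes the orientation: the vertex lies ahead on the line and not behind.
    have hpos : 0 < s := by
      refine lt_of_le_of_ne ?_ hne.symm
      obtain ⟨j, rfl⟩ : ∃ j, m = j + 1 := ⟨m - 1, by ring⟩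
      rw [add_sub_cancel_right, hF, hF] at h4
      rcases h4 with h4 | h4
      · have e := side_add (c := c) j a v s
        rw [← hs', side_vertex_right] at e
        have e' : cross v (vertex c j - a) = -cross v (vertex c (j + 1) - vertex c j) := by
          rw [hs']; simp [cross]; ring
        have := side_nonneg hc j ha
        by_contra! hcon
        nlinarith
      · have e := side_add (c := c) (j + 1) a v s
        rw [← hs', side_vertex_left] at e
        have e' : cross v (vertex c (j + 1 + 1) - a)
            = cross v (vertex c (j + 1 + 1) - vertex c (j + 1)) := by
          rw [hs']; simp [cross]; ring
        have := side_nonneg hc (j + 1) ha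
        by_contra! hcon
        nlinarith
    refine ⟨t₀ + s, fun t => pt c ε (a + (t - t₀) • v), .nil (by linarith) ?_ ?_⟩
    · intro t ht
      refine ⟨?_, rfl⟩
      refine (convex_convexHull ℝ _).segment_subset ha (vertex_mem c m) ⟨1 - (t - t₀) / s,
        (t - t₀) / s, ?_, div_nonneg (by linarith [ht.1]) hpos.le, by ring, ?_⟩
      · rw [sub_nonneg, div_le_one hpos]; linarith [ht.2]
      · rw [hs']
        apply plane_ext <;> simp <;> field_simp <;> ring
    · rw [hs']; congr 2; ring
  | cons k l ih =>
    obtain ⟨⟨h3, h4⟩, h5⟩ := h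
    have h6 := h1 k ⟨h3, h4⟩
    rw [hF] at h3 h4
    set e := cross v (vertex c (k + 1) - vertex c k) with he
    have he' : e = cross v (vertex c (k + 1) - a) - cross v (vertex c k - a) := by
      rw [he, ← cross_sub_right]; congr 1; abel
    have hpos : 0 < e := by linarith
    -- The edge function decreases at the rate `e` along `v`, so `s` is the time of arrival at the
    -- edge.
    set s := side c k a / e with hs
    have hspos : 0 < s := by positivity
    have hside : side c k (a + s • v) = 0 := by rw [side_add, ← he, hs]; field_simp; ring
    have hne : vertex c (k + 1) - vertex c k ≠ 0 :=
      sub_ne_zero.2 fun h => by have := vertex_injective hc h; omega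
    obtain ⟨β, hβ⟩ := eq_smul_of_cross_eq_zero hne hside
    have e1 : cross v (vertex c k - a) = -(β * e) := by
      have : cross v (vertex c k - a) = -cross v (a + s • v - vertex c k) := by
        simp [cross]; ring
      rw [this, hβ, cross_smul_right]
    have e2 : cross v (vertex c (k + 1) - a) = (1 - β) * e := by linarith
    have hβ0 : 0 < β := by by_contra! hcon; nlinarith
    have hβ1 : β < 1 := by by_contra! hcon; nlinarith
    have hmem : a + s • v ∈ edge c k := by
      refine ⟨1 - β, β, by linarith, hβ0.le, by ring, ?_⟩
      rw [sub_eq_iff_eq_add] at hβ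
      rw [hβ]
      apply plane_ext <;> simp <;> ring
    have hnv : a + s • v ∉ Set.range (vertex c) := by
      rintro ⟨j, hj⟩
      have : j = k ∨ j = k + 1 := by
        by_contra! hcon
        rw [← hj] at hside
        exact (side_vertex_pos hc hcon.1 hcon.2).ne' hside
      have e3 : cross v (vertex c j - a) = 0 := by rw [hj]; simp [cross]; ring
      rcases this with rfl | rfl
      · linarith
      · linarith
    have hnv' : flipPt c k (a + s • v) ∉ Set.range (vertex c) := by
      rwa [flipPt_vertex hc hmem]
    obtain ⟨T, γ, hγ⟩ := ih (v := -v) (a := flipPt c k (a + s • v)) (neg_ne_zero.2 hv)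
      (edge_subset c k (flipPt_mem hmem))
      (fun j => by rw [crossed, hF, hF, hF]; simp [flipPt, cross]; ring) h5 (fun j hj => by
        -- The new starting point lies on the edge `k` alone, and the line cannot leave through it
        -- at once, since `crossed` exchanges the signs at its ends.
        refine side_pos_of_mem_edge hc (flipPt_mem hmem) hnv' ?_
        rintro rfl
        have := hj.1
        simp only [crossed, hF] at this
        linarith) (fun _ h => hnv' ⟨m, h.symm⟩) (!ε) (t₀ + s)
    refine ⟨T, fun t => if t ≤ t₀ + s then pt c ε (a + (t - t₀) • v) else γ t, ?_⟩
    have hst : Straight c (fun t => if t ≤ t₀ + s then pt c ε (a + (t - t₀) • v) else γ t)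
        ε v a t₀ (t₀ + s) := by
      intro t ht
      refine ⟨?_, if_pos ht.2⟩
      refine (convex_convexHull ℝ _).segment_subset ha (edge_subset c k hmem)
        ⟨1 - (t - t₀) / s, (t - t₀) / s, ?_, div_nonneg (by linarith [ht.1]) hspos.le, by ring, ?_⟩
      · rw [sub_nonneg, div_le_one hspos]; linarith [ht.2]
      · apply plane_ext <;> simp <;> field_simp <;> ring
    refine .cons (t₁ := t₀ + s) (by linarith) hst ?_ ?_ hpos ?_
    · simpa using hmem
    · simpa using hnv
    · rw [add_sub_cancel_left]
      refine hγ.congr fun t ht => ?_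
      split_ifs with h
      · obtain rfl : t = t₀ + s := le_antisymm h ht.1
        rw [hγ.start.2, pt_flipPt hmem, add_sub_cancel_left]
      · rfl

/-- A realized sequence of edges is crossed by a saddle connection. -/
theorem Realizes.exists_saddleConnection {c : ℝ} (hc : 1 ≤ c) {u : Plane} {k₀ : ℤ} {l : List ℤ}
    {m : ℤ} (h : Realizes c u k₀ l m) (ε : Bool) :
    ∃ r : ℝ, 0 < r ∧ ∃ y, ∃ σ : Path (pt c ε (vertex c k₀)) y,
      Geod c σ.extend 1 0 ε (r • u) (vertex c k₀) l m ∧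
      IsSaddleConnectionWith σ (fold ε (r • u)) := by
  obtain ⟨T, γ, hγ⟩ := exists_geod_of_exits hc h.ne_zero (vertex_mem c k₀) (fun _ => rfl) h.exits
    (fun k hk => by
      refine side_vertex_pos hc ?_ ?_
      · rintro rfl; have := hk.1; simp [cross] at this
      · rintro rfl; have := hk.2; simp [cross] at this)
    (fun hl he => h.ne hl (vertex_injective hc he).symm) ε 0
  have hT := hγ.lt
  have h1 := hγ.scale hT
  rw [div_self hT.ne', zero_div] at h1
  let σ : Path (pt c ε (vertex c k₀)) (γ T) :=
    { toFun := fun t => γ (T * t)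
      continuous_toFun := by
        have := h1.continuousOn
        rw [continuousOn_iff_continuous_domRestrict] at this
        exact this
      source' := by simpa using hγ.start.2
      target' := by simp }
  have h2 : Geod c σ.extend 1 0 ε (T • u) (vertex c k₀) l m :=
    h1.congr fun t ht => by rw [Path.extend_apply _ ht]; rfl
  refine ⟨T, hT, γ T, σ, h2, ?_⟩
  obtain ⟨ε', hε'⟩ := hγ.finish
  refine Geod.isSaddleConnectionWith hc (ε := ε) (fold_ne_zero (smul_ne_zero hT.ne' h.ne_zero))
    (hε' ▸ pt_vertex_mem c ε' m) (by rw [fold_fold]; exact h2)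

theorem Geod.realizes {c : ℝ} (hc : 1 ≤ c) {γ : ℝ → S c} {T t₀ : ℝ} {ε : Bool} {v : Plane}
    {k₀ : ℤ} {l : List ℤ} {m : ℤ} (hv : v ≠ 0) (h : Geod c γ T t₀ ε v (vertex c k₀) l m) :
    Realizes c v k₀ l m := by
  refine ⟨hv, h.exits hc hv, ?_⟩
  rintro rfl rfl
  cases h with
  | nil ht hs hm =>
    rw [add_eq_left, smul_eq_zero] at hm
    rcases hm with hm | hm
    · linarith
    · exact hv hm

/-- The directions of the saddle connections. -/
theorem hasSaddleConnection_mk {c : ℝ} (hc : 1 ≤ c) {u : Plane} (hu : u ≠ 0) :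
    HasSaddleConnection c (Projectivization.mk ℝ u hu) ↔ InOrbit c u := by
  constructor
  · rintro ⟨x, y, σ, v, hv, h, he⟩
    obtain ⟨ε, k₀, l, m, hg⟩ := h.geod hc
    have h1 := InOrbit.of_realizes hc (hg.realizes hc (fold_ne_zero hv))
    rw [Projectivization.mk_eq_mk_iff'] at he
    obtain ⟨r, hr⟩ := he
    have hr0 : r ≠ 0 := by rintro rfl; apply hv; simp [← hr]
    have : u = r⁻¹ • v := by rw [← hr, smul_smul, inv_mul_cancel₀ hr0, one_smul]
    rw [this]
    rcases fold_eq ε v with h2 | h2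
    · rw [h2] at h1
      exact h1.smul (inv_ne_zero hr0)
    · rw [h2] at h1
      have := h1.smul (neg_ne_zero.2 (inv_ne_zero hr0))
      rwa [smul_neg, neg_smul, neg_neg] at this
  · intro h
    obtain ⟨r, hr, k₀, l, m, h1⟩ := h.exists_realizes hc
    obtain ⟨s, hs, y, σ, -, h2⟩ := h1.exists_saddleConnection hc true
    refine ⟨_, _, σ, _, h2.ne_zero, h2, ?_⟩
    rw [Projectivization.mk_eq_mk_iff']
    exact ⟨s * r, by simp [fold, smul_smul]⟩

/-! ### Homotopies of paths that cross the same edges -/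

/-- From time `t₀` to time `T`, the path `γ` starts at the point `a` of the polygon `ε`, crosses
the edges in the list `l`, and arrives at the vertex `m`. -/
inductive Follows (c : ℝ) (γ : ℝ → S c) (T : ℝ) : ℝ → Bool → Plane → List ℤ → ℤ → Prop
  | nil {t₀ : ℝ} {ε : Bool} {m : ℤ} (p : ℝ → Plane) (ht : t₀ < T)
      (hp : ContinuousOn p (Set.Icc t₀ T))
      (hγ : ∀ t ∈ Set.Icc t₀ T, p t ∈ Qplus c ∧ γ t = pt c ε (p t))
      (hv : ∀ t ∈ Set.Ioo t₀ T, p t ∉ Set.range (vertex c))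
      (hm : p T = vertex c m) : Follows c γ T t₀ ε (p t₀) [] m
  | cons {t₀ t₁ : ℝ} {ε : Bool} {k : ℤ} {l : List ℤ} {m : ℤ} (p : ℝ → Plane) (ht : t₀ < t₁)
      (hp : ContinuousOn p (Set.Icc t₀ t₁))
      (hγ : ∀ t ∈ Set.Icc t₀ t₁, p t ∈ Qplus c ∧ γ t = pt c ε (p t))
      (hv : ∀ t ∈ Set.Ioc t₀ t₁, p t ∉ Set.range (vertex c))
      (he : p t₁ ∈ edge c k)
      (h : Follows c γ T t₁ (!ε) (flipPt c k (p t₁)) l m) :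
      Follows c γ T t₀ ε (p t₀) (k :: l) m

theorem Geod.follows {c : ℝ} (hc : 1 ≤ c) {γ : ℝ → S c} {T t₀ : ℝ} {ε : Bool} {v a : Plane}
    {l : List ℤ} {m : ℤ} (hv : v ≠ 0) (h : Geod c γ T t₀ ε v a l m) :
    Follows c γ T t₀ ε a l m := by
  induction h with
  | @nil t₀ ε v a m ht hs hm =>
    have := Follows.nil (γ := γ) (ε := ε) (fun t => a + (t - t₀) • v) ht (by fun_prop) hs
      (fun t h1 => by
        have h2 := hs t (Set.Ioo_subset_Icc_self h1)
        rw [← pt_mem_singular hc h2.1 (ε := ε), ← h2.2]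
        exact hs.notMem_singular hc hv h1) hm
    simpa using this
  | @cons t₀ t₁ ε v a k l m ht hs he hv' hk h ih =>
    have := Follows.cons (γ := γ) (ε := ε) (fun t => a + (t - t₀) • v) ht (by fun_prop) hs
      (fun t h1 => by
        rcases h1.2.eq_or_lt with rfl | h3
        · exact hv'
        have h2 := hs t (Set.Ioc_subset_Icc_self h1)
        rw [← pt_mem_singular hc h2.1 (ε := ε), ← h2.2]
        exact hs.notMem_singular hc hv ⟨h1.1, h3⟩) he (ih (neg_ne_zero.2 hv))
    simpa using this

theorem Follows.lt {c : ℝ} {γ : ℝ → S c} {T t₀ : ℝ} {ε : Bool} {a : Plane} {l : List ℤ} {m : ℤ}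
    (h : Follows c γ T t₀ ε a l m) : t₀ < T := by
  induction h with
  | nil _ ht => exact ht
  | cons _ ht _ _ _ _ _ ih => exact ht.trans ih

theorem Follows.start {c : ℝ} {γ : ℝ → S c} {T t₀ : ℝ} {ε : Bool} {a : Plane} {l : List ℤ} {m : ℤ}
    (h : Follows c γ T t₀ ε a l m) : γ t₀ = pt c ε a := by
  cases h with
  | nil _ ht _ hγ => exact (hγ _ ⟨le_rfl, ht.le⟩).2
  | cons _ ht _ hγ => exact (hγ _ ⟨le_rfl, ht.le⟩).2

theorem Follows.finish {c : ℝ} {γ : ℝ → S c} {T t₀ : ℝ} {ε : Bool} {a : Plane} {l : List ℤ} {m : ℤ}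
    (h : Follows c γ T t₀ ε a l m) :
    γ T = pt c (l.foldl (fun e _ => !e) ε) (vertex c m) := by
  induction h with
  | nil _ ht _ hγ _ hm => rw [(hγ _ ⟨ht.le, le_rfl⟩).2, hm]; rfl
  | cons _ _ _ _ _ _ _ ih => exact ih

/-- Vertices are extreme points; for this reason homotopies along straight segments avoid the
singular points. -/
theorem notMem_range_vertex_of_comb {c : ℝ} (hc : 1 ≤ c) {p q : Plane} (hp : p ∈ Qplus c)
    (hq : q ∈ Qplus c) (hp' : p ∉ Set.range (vertex c)) (hq' : q ∉ Set.range (vertex c)) {s : ℝ}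
    (hs : s ∈ Set.Icc (0 : ℝ) 1) : (1 - s) • p + s • q ∉ Set.range (vertex c) := by
  rintro ⟨k, hk⟩
  rcases hs.2.eq_or_lt with rfl | h1
  · exact hq' ⟨k, by simpa using hk⟩
  · exact hp' ⟨k, (eq_vertex_of_comb hc hp hq (by linarith) hs.1 (by ring) hk.symm).symm⟩

/-- The affine map that sends `t₀` to `t₀'` and `t₁` to `t₁'`. -/
noncomputable def rescale (t₀ t₁ t₀' t₁' t : ℝ) : ℝ :=
  t₀' + (t - t₀) / (t₁ - t₀) * (t₁' - t₀')

section rescale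

variable {t₀ t₁ t₀' t₁' t : ℝ}

theorem continuous_rescale : Continuous (rescale t₀ t₁ t₀' t₁') := by
  unfold rescale; fun_prop

theorem rescale_left : rescale t₀ t₁ t₀' t₁' t₀ = t₀' := by simp [rescale]

theorem rescale_right (h : t₀ < t₁) : rescale t₀ t₁ t₀' t₁' t₁ = t₁' := by
  rw [rescale, div_self (by linarith)]; ring

theorem rescale_gt (h : t₀ < t₁) (h' : t₀' < t₁') (ht : t₀ < t) : t₀' < rescale t₀ t₁ t₀' t₁' t := by
  have : 0 < (t - t₀) / (t₁ - t₀) * (t₁' - t₀') :=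
    mul_pos (div_pos (by linarith) (by linarith)) (by linarith)
  unfold rescale; linarith

theorem rescale_lt (h : t₀ < t₁) (h' : t₀' < t₁') (ht : t < t₁) : rescale t₀ t₁ t₀' t₁' t < t₁' := by
  have : (t - t₀) / (t₁ - t₀) < 1 := by rw [div_lt_one (by linarith)]; linarith
  unfold rescale; nlinarith

theorem rescale_mem (h : t₀ < t₁) (h' : t₀' < t₁') (ht : t ∈ Set.Icc t₀ t₁) :
    rescale t₀ t₁ t₀' t₁' t ∈ Set.Icc t₀' t₁' := by
  constructor
  · rcases ht.1.eq_or_lt with rfl | h1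
    · rw [rescale_left]
    · exact (rescale_gt h h' h1).le
  · rcases ht.2.eq_or_lt with rfl | h1
    · rw [rescale_right h]
    · exact (rescale_lt h h' h1).le

end rescale

/-- The homotopy along straight segments between two paths in the same polygon. -/
noncomputable def straightHomotopy (c : ℝ) (ε : Bool) (p q : ℝ → Plane) (s t : ℝ) : S c :=
  pt c ε ((1 - s) • p t + s • q t)

theorem straightHomotopy_mem {c : ℝ} {p q : Plane} (hp : p ∈ Qplus c) (hq : q ∈ Qplus c) {s : ℝ}
    (hs : s ∈ Set.Icc (0 : ℝ) 1) : (1 - s) • p + s • q ∈ Qplus c :=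
  convex_convexHull ℝ _ hp hq (by linarith [hs.2]) hs.1 (by ring)

theorem continuousOn_straightHomotopy {c : ℝ} (ε : Bool) {p q : ℝ → Plane} {I : Set ℝ}
    (hp : ContinuousOn p I) (hq : ContinuousOn q I) (hp' : ∀ t ∈ I, p t ∈ Qplus c)
    (hq' : ∀ t ∈ I, q t ∈ Qplus c) :
    ContinuousOn (Function.uncurry (straightHomotopy c ε p q)) (Set.Icc 0 1 ×ˢ I) := by
  refine (continuousOn_pt c ε).comp (f := fun x : ℝ × ℝ => (1 - x.1) • p x.2 + x.1 • q x.2) ?_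
    fun x hx => straightHomotopy_mem (hp' _ hx.2) (hq' _ hx.2) hx.1
  have h1 : ContinuousOn (fun x : ℝ × ℝ => p x.2) (Set.Icc 0 1 ×ˢ I) :=
    hp.comp continuous_snd.continuousOn fun x hx => hx.2
  have h2 : ContinuousOn (fun x : ℝ × ℝ => q x.2) (Set.Icc 0 1 ×ˢ I) :=
    hq.comp continuous_snd.continuousOn fun x hx => hx.2
  fun_prop

/-- Two paths that cross the same edges are homotopic, after a change of the parameter. -/
theorem Follows.exists_homotopy {c : ℝ} (hc : 1 ≤ c) {γ γ' : ℝ → S c} {T T' t₀ t₀' : ℝ} {ε : Bool}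
    {a a' : Plane} {l : List ℤ} {m : ℤ} (h : Follows c γ T t₀ ε a l m)
    (h' : Follows c γ' T' t₀' ε a' l m) :
    ∃ (ρ : ℝ → ℝ) (H : ℝ → ℝ → S c), ContinuousOn ρ (Set.Icc t₀ T) ∧ ρ t₀ = t₀' ∧ ρ T = T' ∧
      (∀ t ∈ Set.Ioo t₀ T, ρ t ∈ Set.Ioo t₀' T') ∧
      ContinuousOn (Function.uncurry H) (Set.Icc 0 1 ×ˢ Set.Icc t₀ T) ∧
      (∀ t ∈ Set.Icc t₀ T, H 0 t = γ t) ∧ (∀ t ∈ Set.Icc t₀ T, H 1 t = γ' (ρ t)) ∧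
      (∀ s ∈ Set.Icc (0 : ℝ) 1, H s t₀ = pt c ε ((1 - s) • a + s • a')) ∧
      (∀ s ∈ Set.Icc (0 : ℝ) 1, H s T = γ T) ∧
      ∀ s ∈ Set.Icc (0 : ℝ) 1, ∀ t ∈ Set.Ioo t₀ T, H s t ∉ singular c := by
  induction h generalizing t₀' a' with
  | @nil t₀ ε m p ht hp hγ hv hm =>
    cases h' with
    | nil p' ht' hp' hγ' hv' hm' =>
      have hr : ∀ t ∈ Set.Icc t₀ T, rescale t₀ T t₀' T' t ∈ Set.Icc t₀' T' :=
        fun t h1 => rescale_mem ht ht' h1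
      refine ⟨rescale t₀ T t₀' T', straightHomotopy c ε p (fun t => p' (rescale t₀ T t₀' T' t)),
        continuous_rescale.continuousOn, rescale_left, rescale_right ht,
        fun t h1 => ⟨rescale_gt ht ht' h1.1, rescale_lt ht ht' h1.2⟩,
        continuousOn_straightHomotopy ε hp (hp'.comp continuous_rescale.continuousOn hr)
          (fun t h1 => (hγ t h1).1) (fun t h1 => (hγ' _ (hr t h1)).1), ?_, ?_, ?_, ?_, ?_⟩
      · intro t h1
        simpa [straightHomotopy] using (hγ t h1).2.symm
      · intro t h1
        simpa [straightHomotopy] using (hγ' _ (hr t h1)).2.symm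
      · intro s _
        simp [straightHomotopy, rescale_left]
      · intro s _
        rw [straightHomotopy, rescale_right ht, hm', hm, ← add_smul, (hγ T ⟨ht.le, le_rfl⟩).2, hm]
        simp
      · intro s hs t h1
        have h2 := Set.Ioo_subset_Icc_self h1
        rw [straightHomotopy, pt_mem_singular hc
          (straightHomotopy_mem (hγ t h2).1 (hγ' _ (hr t h2)).1 hs)]
        exact notMem_range_vertex_of_comb hc (hγ t h2).1 (hγ' _ (hr t h2)).1 (hv t h1)
          (hv' _ ⟨rescale_gt ht ht' h1.1, rescale_lt ht ht' h1.2⟩) hs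
  | @cons t₀ t₁ ε k l m p ht hp hγ hv he h ih =>
    cases h' with
    | @cons _ t₁' _ _ _ _ p' ht' hp' hγ' hv' he' h' =>
      obtain ⟨ρ, H, hρ, hρ0, hρT, hρI, hH, hH0, hH1, hHs, hHT, hHn⟩ := ih h'
      set r := rescale t₀ t₁ t₀' t₁' with hrdef
      have hr : ∀ t ∈ Set.Icc t₀ t₁, r t ∈ Set.Icc t₀' t₁' :=
        fun t h1 => rescale_mem ht ht' h1
      have hr1 : r t₁ = t₁' := rescale_right ht
      set K := straightHomotopy c ε p (fun t => p' (r t)) with hK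
      have hlt := h.lt
      have hlt' := h'.lt
      -- At the time of the crossing both paths are on the edge `k`, and the gluing rotation is
      -- affine; so the straight homotopies on the two sides of the edge agree.
      have hKH : ∀ s ∈ Set.Icc (0 : ℝ) 1, K s t₁ = H s t₁ := by
        intro s hs
        rw [hHs s hs, hK, straightHomotopy, hr1, ← pt_flipPt (k := k) (ε := ε)]
        · congr 1
          apply plane_ext <;> simp [flipPt] <;> ring
        · exact convex_segment _ _ he he' (by linarith [hs.2]) hs.1 (by ring)
      have hGle : ∀ s t, t ≤ t₁ → (if t ≤ t₁ then K s t else H s t) = K s t :=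
        fun s t h1 => if_pos h1
      have hGge : ∀ s ∈ Set.Icc (0 : ℝ) 1, ∀ t, t₁ ≤ t →
          (if t ≤ t₁ then K s t else H s t) = H s t := by
        intro s hs t h1
        split_ifs with h2
        · obtain rfl := le_antisymm h1 h2; exact hKH s hs
        · rfl
      have hRle : ∀ t, t ≤ t₁ → (if t ≤ t₁ then r t else ρ t) = r t := fun t h1 => if_pos h1
      have hRge : ∀ t, t₁ ≤ t → (if t ≤ t₁ then r t else ρ t) = ρ t := by
        intro t h1
        split_ifs with h2
        · obtain rfl := le_antisymm h1 h2; rw [hρ0, hr1]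
        · rfl
      have hKc : ContinuousOn (Function.uncurry K) (Set.Icc 0 1 ×ˢ Set.Icc t₀ t₁) :=
        continuousOn_straightHomotopy ε hp (hp'.comp continuous_rescale.continuousOn hr)
          (fun t h1 => (hγ t h1).1) (fun t h1 => (hγ' _ (hr t h1)).1)
      have hI := Set.Icc_union_Icc_eq_Icc ht.le hlt.le
      refine ⟨fun t => if t ≤ t₁ then r t else ρ t, fun s t => if t ≤ t₁ then K s t else H s t,
        ?_, ?_, ?_, ?_, ?_, ?_, ?_, ?_, ?_, ?_⟩
      · rw [← hI]
        exact (continuous_rescale.continuousOn.congr fun t h1 => hRle t h1.2).union_of_isClosed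
          (hρ.congr fun t h1 => hRge t h1.1) isClosed_Icc isClosed_Icc
      · beta_reduce; rw [hRle _ ht.le]; exact rescale_left
      · beta_reduce; rw [hRge _ hlt.le, hρT]
      · intro t h1
        beta_reduce
        rcases le_or_gt t t₁ with h2 | h2
        · rw [hRle t h2]
          exact ⟨rescale_gt ht ht' h1.1, (hr t ⟨h1.1.le, h2⟩).2.trans_lt hlt'⟩
        · rw [hRge t h2.le]
          exact ⟨ht'.trans (hρI t ⟨h2, h1.2⟩).1, (hρI t ⟨h2, h1.2⟩).2⟩
      · rw [← hI, Set.prod_union]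
        exact (hKc.congr fun x hx => hGle x.1 x.2 hx.2.2).union_of_isClosed
          (hH.congr fun x hx => hGge x.1 hx.1 x.2 hx.2.1) (isClosed_Icc.prod isClosed_Icc)
          (isClosed_Icc.prod isClosed_Icc)
      · intro t h1
        beta_reduce
        rcases le_or_gt t t₁ with h2 | h2
        · rw [hGle 0 t h2, hK]
          simpa [straightHomotopy] using (hγ t ⟨h1.1, h2⟩).2.symm
        · rw [hGge 0 (by simp) t h2.le, hH0 t ⟨h2.le, h1.2⟩]
      · intro t h1
        beta_reduce
        rcases le_or_gt t t₁ with h2 | h2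
        · rw [hGle 1 t h2, hRle t h2, hK]
          simpa [straightHomotopy] using (hγ' _ (hr t ⟨h1.1, h2⟩)).2.symm
        · rw [hGge 1 (by simp) t h2.le, hRge t h2.le, hH1 t ⟨h2.le, h1.2⟩]
      · intro s _
        beta_reduce
        rw [hGle s _ ht.le]
        simp [hK, straightHomotopy, hrdef, rescale_left]
      · intro s hs
        beta_reduce
        rw [hGge s hs T hlt.le, hHT s hs]
      · intro s hs t h1
        beta_reduce
        rcases le_or_gt t t₁ with h2 | h2
        · have h3 : t ∈ Set.Icc t₀ t₁ := ⟨h1.1.le, h2⟩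
          rw [hGle s t h2, hK, straightHomotopy, pt_mem_singular hc
            (straightHomotopy_mem (hγ t h3).1 (hγ' _ (hr t h3)).1 hs)]
          exact notMem_range_vertex_of_comb hc (hγ t h3).1 (hγ' _ (hr t h3)).1 (hv t ⟨h1.1, h2⟩)
            (hv' _ ⟨rescale_gt ht ht' h1.1, (hr t h3).2⟩) hs
        · rw [hGge s hs t h2.le]
          exact hHn s hs t ⟨h2, h1.2⟩

/-- This is the homotopy of the path with itself at time 0. -/
theorem Follows.notMem_singular {c : ℝ} (hc : 1 ≤ c) {γ : ℝ → S c} {T t₀ : ℝ} {ε : Bool}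
    {a : Plane} {l : List ℤ} {m : ℤ} (h : Follows c γ T t₀ ε a l m) {t : ℝ}
    (ht : t ∈ Set.Ioo t₀ T) : γ t ∉ singular c := by
  obtain ⟨ρ, H, -, -, -, -, -, hH0, -, -, -, hHn⟩ := h.exists_homotopy hc h
  rw [← hH0 t (Set.Ioo_subset_Icc_self ht)]
  exact hHn 0 (by simp) t ht

/-- `Follows.exists_homotopy` reaches only a reparametrization of `γ`. A second homotopy
interpolates linearly between the two parameters. -/
theorem Follows.mem_homotopyClass {c : ℝ} (hc : 1 ≤ c) {x y : S c} {σ γ : Path x y} {ε : Bool}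
    {k₀ : ℤ} {l : List ℤ} {m : ℤ} (h : Follows c σ.extend 1 0 ε (vertex c k₀) l m)
    (h' : Follows c γ.extend 1 0 ε (vertex c k₀) l m) : γ ∈ homotopyClass σ := by
  obtain ⟨ρ, H, hρ, hρ0, hρ1, hρI, hH, hH0, hH1, hHs, hHT, hHn⟩ := h.exists_homotopy hc h'
  have hx : x = pt c ε (vertex c k₀) := by rw [← h.start, Path.extend_zero]
  have hρm : ∀ t : unitInterval, ρ t ∈ Set.Icc (0 : ℝ) 1 := by
    intro t
    rcases t.2.1.eq_or_lt with h0 | h0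
    · rw [← h0, hρ0]; simp
    rcases t.2.2.eq_or_lt with h1 | h1
    · rw [h1, hρ1]; simp
    exact Set.Ioo_subset_Icc_self (hρI t ⟨h0, h1⟩)
  have hρc : Continuous fun t : unitInterval => ρ t :=
    hρ.comp_continuous continuous_subtype_val fun t => t.2
  let δ : Path x y :=
    { toFun := fun t => γ.extend (ρ t)
      continuous_toFun := γ.continuous_extend.comp hρc
      source' := by simp [hρ0]
      target' := by simp [hρ1] }
  have hI : ∀ t : unitInterval, t ≠ 0 → t ≠ 1 → (t : ℝ) ∈ Set.Ioo (0 : ℝ) 1 := fun t h0 h1 =>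
    ⟨unitInterval.pos_iff_ne_zero.2 h0, unitInterval.lt_one_iff_ne_one.2 h1⟩
  let F₁ : Path.Homotopy σ δ :=
    { toFun := fun z => H z.1 z.2
      continuous_toFun := hH.comp_continuous (f := fun z : unitInterval × unitInterval =>
        ((z.1 : ℝ), (z.2 : ℝ))) (by fun_prop) fun z => ⟨z.1.2, z.2.2⟩
      map_zero_left := fun t => by simpa using hH0 t t.2
      map_one_left := fun t => by simpa [δ] using hH1 t t.2
      prop' := by
        rintro s t (rfl | rfl)
        · have := hHs s s.2
          rw [← add_smul, sub_add_cancel, one_smul, ← hx] at this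
          simpa using this
        · have := hHT s s.2
          simpa using this }
  have hcomb : ∀ s t : unitInterval, (1 - (s : ℝ)) * ρ t + s * t ∈ Set.Icc (0 : ℝ) 1 := fun s t =>
    convex_Icc (0 : ℝ) 1 (hρm t) t.2 (by linarith [s.2.2]) s.2.1 (by ring)
  let F₂ : Path.Homotopy δ γ :=
    { toFun := fun z => γ.extend ((1 - (z.1 : ℝ)) * ρ z.2 + z.1 * z.2)
      continuous_toFun := γ.continuous_extend.comp (by
        have h2 : Continuous fun z : unitInterval × unitInterval => ρ z.2 :=
          hρc.comp continuous_snd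
        exact ((continuous_const.sub (continuous_subtype_val.comp continuous_fst)).mul h2).add
          ((continuous_subtype_val.comp continuous_fst).mul
            (continuous_subtype_val.comp continuous_snd)))
      map_zero_left := fun t => by simp [δ]
      map_one_left := fun t => by simp
      prop' := by
        rintro s t (rfl | rfl)
        · simp [hρ0]
        · simp [hρ1] }
  refine ⟨F₁.trans F₂, fun s t h0 h1 => ?_⟩
  rw [Path.Homotopy.trans_apply]
  split_ifs with h2
  · have h3 : (s : ℝ) ≤ 1 / 2 := h2
    exact hHn (2 * s) ⟨by linarith [s.2.1], by linarith⟩ t (hI t h0 h1)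
  · have h3 : 1 / 2 < (s : ℝ) := not_le.1 h2
    refine h'.notMem_singular hc ?_
    exact convex_Ioo (0 : ℝ) 1 (hρI t (hI t h0 h1)) (hI t h0 h1) 
      (show (0 : ℝ) ≤ 1 - (2 * s - 1) by linarith [s.2.2]) (show (0 : ℝ) ≤ 2 * s - 1 by linarith) (by ring)

/-! ### Transport of homotopy classes by canonical homeomorphisms -/

/-- The map `H` is induced by the map `g` of the polygons, which maps edges affinely to edges. -/
structure Induces (c c' : ℝ) (g : Plane → Plane) (H : S c → S c') : Prop where
  continuousOn : ContinuousOn g (Qplus c)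
  mapsTo : Set.MapsTo g (Qplus c) (Qplus c')
  edge : ∀ (k : ℤ) (s : ℝ), s ∈ Set.Icc (0 : ℝ) 1 →
    g ((1 - s) • vertex c k + s • vertex c (k + 1)) = (1 - s) • vertex c' k + s • vertex c' (k + 1)
  map_pt : ∀ ε, ∀ p ∈ Qplus c, H (pt c ε p) = pt c' ε (g p)
  of_vertex : ∀ p ∈ Qplus c, g p ∈ Set.range (vertex c') → p ∈ Set.range (vertex c)

namespace Induces

variable {c c' : ℝ} {g : Plane → Plane} {H : S c → S c'}

theorem map_vertex (hg : Induces c c' g H) (k : ℤ) : g (vertex c k) = vertex c' k := by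
  simpa using hg.edge k 0 (by simp)

theorem map_edge (hg : Induces c c' g H) {k : ℤ} {p : Plane} (hp : p ∈ ParabolaSurface.edge c k) :
    g p ∈ ParabolaSurface.edge c' k ∧ g (flipPt c k p) = flipPt c' k (g p) := by
  obtain ⟨a, b, ha, hb, hab, rfl⟩ := hp
  obtain rfl : a = 1 - b := by linarith
  have h1 := hg.edge k b ⟨hb, by linarith⟩
  have h2 := hg.edge k (1 - b) ⟨ha, by linarith⟩
  have e : flipPt c k ((1 - b) • vertex c k + b • vertex c (k + 1))
      = (1 - (1 - b)) • vertex c k + (1 - b) • vertex c (k + 1) := by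
    apply plane_ext <;> simp [flipPt] <;> ring
  rw [e, h1, h2]
  refine ⟨⟨1 - b, b, ha, hb, by ring, rfl⟩, ?_⟩
  apply plane_ext <;> simp [flipPt] <;> ring

theorem follows (hg : Induces c c' g H) {γ : ℝ → S c} {T t₀ : ℝ} {ε : Bool} {a : Plane}
    {l : List ℤ} {m : ℤ} (h : Follows c γ T t₀ ε a l m) :
    Follows c' (fun t => H (γ t)) T t₀ ε (g a) l m := by
  induction h with
  | nil p ht hp hγ hv hm =>
    refine .nil (fun t => g (p t)) ht (hg.continuousOn.comp hp fun t h1 => (hγ t h1).1)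
      (fun t h1 => ⟨hg.mapsTo (hγ t h1).1, ?_⟩) (fun t h1 h2 => hv t h1 ?_) ?_
    · rw [(hγ t h1).2, hg.map_pt _ _ (hγ t h1).1]
    · exact hg.of_vertex _ (hγ t (Set.Ioo_subset_Icc_self h1)).1 h2
    · rw [hm, hg.map_vertex]
  | cons p ht hp hγ hv he h ih =>
    refine .cons (fun t => g (p t)) ht (hg.continuousOn.comp hp fun t h1 => (hγ t h1).1)
      (fun t h1 => ⟨hg.mapsTo (hγ t h1).1, ?_⟩) (fun t h1 h2 => hv t h1 ?_) (hg.map_edge he).1 ?_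
    · rw [(hγ t h1).2, hg.map_pt _ _ (hγ t h1).1]
    · exact hg.of_vertex _ (hγ t (Set.Ioc_subset_Icc_self h1)).1 h2
    · rw [← (hg.map_edge he).2]
      exact ih

end Induces

/-- The list of edges of `σ` is realized on the other surface by `Realizes.transfer`. The saddle
connection found there, pulled back by `H`, crosses the same edges as `σ` and is therefore homotopic
to it. -/
theorem exists_saddleConnection_of_induces {c c' : ℝ} (hc : 1 ≤ c) (hc' : 1 ≤ c')
    {g g' : Plane → Plane} (H : S c ≃ₜ S c') (hg : Induces c c' g H) (hg' : Induces c' c g' H.symm)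
    {x y : S c} {σ : Path x y} (h : IsSaddleConnection σ) :
    ∃ σ' ∈ (fun γ : Path x y => γ.map H.continuous) '' homotopyClass σ, IsSaddleConnection σ' := by
  obtain ⟨v, h⟩ := h
  obtain ⟨ε, k₀, l, m, hσ⟩ := h.geod hc
  obtain ⟨u', hu', -⟩ := (hσ.realizes hc (fold_ne_zero h.ne_zero)).transfer hc hc'
  have hfol := hσ.follows hc (fold_ne_zero h.ne_zero)
  have hx : H x = pt c' ε (vertex c' k₀) := by
    have := hfol.start
    rw [Path.extend_zero] at this
    rw [this, hg.map_pt _ _ (vertex_mem c _), hg.map_vertex]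
  -- The list also determines in which polygon the path ends, so the new saddle connection ends at
  -- `H y`.
  have hy : H y = pt c' (l.foldl (fun e _ => !e) ε) (vertex c' m) := by
    have := hfol.finish
    rw [Path.extend_one] at this
    rw [this, hg.map_pt _ _ (vertex_mem c _), hg.map_vertex]
  obtain ⟨σ', hσ', hf⟩ : ∃ σ' : Path (H x) (H y), IsSaddleConnection σ' ∧
      Follows c' σ'.extend 1 0 ε (vertex c' k₀) l m := by
    obtain ⟨r, hr, y', σ', h1, h2⟩ := hu'.exists_saddleConnection hc' ε
    have h3 := h1.follows hc' (smul_ne_zero hr.ne' hu'.ne_zero)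
    have h4 := h3.finish
    rw [Path.extend_one, ← hy] at h4
    subst h4
    rw [hx]
    exact ⟨σ', ⟨_, h2⟩, h3⟩
  let γ : Path x y := (σ'.map H.symm.continuous).cast (by simp) (by simp)
  refine ⟨σ', ⟨γ, ?_, ?_⟩, hσ'⟩
  · refine hfol.mem_homotopyClass hc ?_
    have := hg'.follows hf
    rw [hg'.map_vertex] at this
    exact this
  · ext t
    simp [γ]

/-! ### Piecewise linear interpolation -/

/-- The piecewise linear function that interpolates a sequence. -/
noncomputable def interp (f : ℤ → ℝ) (a : ℝ) : ℝ :=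
  f ⌊a⌋ + (a - ⌊a⌋) * (f (⌊a⌋ + 1) - f ⌊a⌋)

theorem interp_eq (f : ℤ → ℝ) {k : ℤ} {a : ℝ} (ha : a ∈ Set.Icc (k : ℝ) (k + 1)) :
    interp f a = f k + (a - k) * (f (k + 1) - f k) := by
  rcases ha.2.eq_or_lt with rfl | h
  · have : ⌊(k : ℝ) + 1⌋ = k + 1 := by simp
    rw [interp, this]; push_cast; ring
  · have : ⌊a⌋ = k := Int.floor_eq_iff.2 ⟨ha.1, h⟩
    rw [interp, this]

theorem interp_intCast (f : ℤ → ℝ) (k : ℤ) : interp f k = f k := by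
  simp [interp]

theorem mem_Icc_floor (a : ℝ) : a ∈ Set.Icc (⌊a⌋ : ℝ) (⌊a⌋ + 1) :=
  ⟨Int.floor_le a, (Int.lt_floor_add_one a).le⟩

theorem locallyFinite_Icc_int : LocallyFinite fun k : ℤ => Set.Icc (k : ℝ) (k + 1) := by
  intro x
  refine ⟨Set.Ioo (x - 1) (x + 1), Ioo_mem_nhds (by linarith) (by linarith),
    (Set.finite_Icc (⌊x⌋ - 2) (⌊x⌋ + 2)).subset ?_⟩
  rintro k ⟨y, hy, hy'⟩
  have h1 := Int.floor_le x
  have h2 := Int.lt_floor_add_one x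
  have h3 : (k : ℝ) < ((⌊x⌋ + 2 : ℤ) : ℝ) := by push_cast; linarith [hy.1, hy'.2]
  have h4 : ((⌊x⌋ - 2 : ℤ) : ℝ) < (k : ℝ) := by push_cast; linarith [hy.2, hy'.1]
  exact ⟨(Int.cast_lt.1 h4).le, (Int.cast_lt.1 h3).le⟩

theorem continuous_interp (f : ℤ → ℝ) : Continuous (interp f) := by
  refine locallyFinite_Icc_int.continuous ?_ (fun k => isClosed_Icc) fun k => ?_
  · exact Set.eq_univ_of_forall fun a => Set.mem_iUnion.2 ⟨⌊a⌋, mem_Icc_floor a⟩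
  · refine ContinuousOn.congr (f := fun a : ℝ => f k + (a - k) * (f (k + 1) - f k)) ?_
      fun a ha => interp_eq f ha
    fun_prop

theorem strictMono_interp {f : ℤ → ℝ} (hf : StrictMono f) : StrictMono (interp f) := by
  intro a b hab
  have ha := Int.floor_le a
  have ha' := Int.lt_floor_add_one a
  have hb := Int.floor_le b
  have hfa : f ⌊a⌋ < f (⌊a⌋ + 1) := hf (by omega)
  have hfb : f ⌊b⌋ < f (⌊b⌋ + 1) := hf (by omega)
  rcases (Int.floor_mono hab.le).eq_or_lt with h | h
  · rw [interp, interp, ← h]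
    nlinarith
  · have h1 : f (⌊a⌋ + 1) ≤ f ⌊b⌋ := hf.monotone (by omega)
    rw [interp, interp]
    nlinarith

theorem surjective_interp {c : ℝ} (hc : 1 ≤ c) :
    Function.Surjective (interp fun k => vertex c k 0) := by
  intro x
  have key : ∀ n : ℕ, (n : ℝ) ≤ vertex c n 0 := by
    intro n
    induction n with
    | zero => simp [vertex_zero]
    | succ n ih => have := vertex_zero_step hc n; push_cast; linarith
  obtain ⟨n, hn⟩ := exists_nat_ge |x|
  have h1 : vertex c (-n) 0 ≤ x := by
    rw [(vertex_neg c n).1]; linarith [neg_abs_le x, key n]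
  have h2 : x ≤ vertex c n 0 := (le_abs_self x).trans (hn.trans (key n))
  have := intermediate_value_Icc (a := -(n : ℝ)) (b := n) (by linarith [n.cast_nonneg (α := ℝ)])
    (continuous_interp fun k => vertex c k 0).continuousOn
  have e1 := interp_intCast (fun k => vertex c k 0) (-(n : ℤ))
  have e2 := interp_intCast (fun k => vertex c k 0) n
  push_cast at e1 e2
  rw [e1, e2] at this
  obtain ⟨a, -, ha⟩ := this ⟨h1, h2⟩
  exact ⟨a, ha⟩

/-- The parameter of the boundary point of `Q_c^+` with first coordinate `x`. -/
noncomputable def param {c : ℝ} (hc : 1 ≤ c) : ℝ ≃ₜ ℝ :=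
  ((strictMono_interp (vertex_zero_strictMono hc)).orderIsoOfSurjective _
    (surjective_interp hc)).toHomeomorph.symm

theorem param_symm {c : ℝ} (hc : 1 ≤ c) (a : ℝ) :
    (param hc).symm a = interp (fun k => vertex c k 0) a := rfl

/-- The second coordinate of the boundary point of `Q_c^+` with a given parameter. -/
noncomputable def height (c a : ℝ) : ℝ := interp (fun k => vertex c k 1) a

/-- The polygon is the region above the broken line through the vertices: a point below it violates
an edge inequality, and a point above it lies on a vertical segment from an edge up to a high
horizontal diagonal. -/
theorem mem_Qplus_iff {c : ℝ} (hc : 1 ≤ c) (p : Plane) :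
    p ∈ Qplus c ↔ height c (param hc (p 0)) ≤ p 1 := by
  obtain ⟨a, ha⟩ := (param hc).symm.surjective (p 0)
  have hpa : param hc (p 0) = a := by rw [← ha]; simp
  rw [hpa]
  rw [param_symm] at ha
  have hk := mem_Icc_floor a
  set k := ⌊a⌋
  rw [interp_eq _ hk] at ha
  rw [height, interp_eq _ hk]
  have hpos := vertex_zero_step hc k
  constructor
  · intro hp
    have h1 := side_nonneg hc k hp
    have : side c k p = (vertex c (k + 1) 0 - vertex c k 0) *
        (p 1 - (vertex c k 1 + (a - k) * (vertex c (k + 1) 1 - vertex c k 1))) := by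
      simp only [side, cross, Pi.sub_apply, ← ha]; ring
    rw [this] at h1
    by_contra! hcon
    nlinarith
  · intro h
    have hconv : Convex ℝ (Qplus c) := convex_convexHull ℝ _
    have key : ∀ n : ℕ, (n : ℝ) ≤ vertex c n 0 ∧ (n : ℝ) ≤ vertex c n 1 := by
      intro n
      induction n with
      | zero => simp [vertex_zero]
      | succ n ih =>
        have h1 := vertex_zero_step hc n
        have h2 := vertex_step_one c n
        have h3 := vertex_zero_nonneg hc (k := n) (by omega)
        push_cast
        constructor <;> linarith
    obtain ⟨n, hn⟩ := exists_nat_ge (max (|p 0| + 1) (p 1))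
    obtain ⟨h1, h2⟩ := key n
    have h3 := (le_max_left _ _).trans hn
    have h4 := (le_max_right _ _).trans hn
    have h5 := le_abs_self (p 0)
    have h6 := neg_abs_le (p 0)
    have hx : 0 < vertex c n 0 := by linarith [abs_nonneg (p 0)]
    have htop : ![p 0, vertex c n 1] ∈ Qplus c := by
      refine hconv.segment_subset (vertex_mem c (-n)) (vertex_mem c n)
        ⟨(vertex c n 0 - p 0) / (2 * vertex c n 0), (vertex c n 0 + p 0) / (2 * vertex c n 0),
          div_nonneg (by linarith) (by linarith), div_nonneg (by linarith) (by linarith),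
          by field_simp; ring, ?_⟩
      apply plane_ext
      · simp [(vertex_neg c n).1]; field_simp; ring
      · simp [(vertex_neg c n).2]; field_simp; ring
    set b := vertex c k 1 + (a - k) * (vertex c (k + 1) 1 - vertex c k 1)
    have hbot : ![p 0, b] ∈ Qplus c := by
      refine hconv.segment_subset (vertex_mem c k) (vertex_mem c (k + 1))
        ⟨1 - (a - k), a - k, by linarith [hk.2], by linarith [hk.1], by ring, ?_⟩
      apply plane_ext
      · simp [← ha]; ring
      · simp [b]; ring
    rcases h.eq_or_lt with h7 | h7
    · convert hbot using 1
      apply plane_ext <;> simp [h7]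
    · have hd : 0 < vertex c n 1 - b := by linarith
      refine hconv.segment_subset hbot htop
        ⟨(vertex c n 1 - p 1) / (vertex c n 1 - b), (p 1 - b) / (vertex c n 1 - b),
          div_nonneg (by linarith) hd.le, div_nonneg (by linarith) hd.le,
          by field_simp; ring, ?_⟩
      apply plane_ext
      · simp; field_simp; ring
      · simp; field_simp; ring

/-! ### The canonical homeomorphisms -/

/-- The homeomorphism from `Q_c^+` to `Q_{c'}^+` that is affine on the edges, and
maps vertical lines isometrically to vertical lines. -/
noncomputable def polygonMap {c c' : ℝ} (hc : 1 ≤ c) (hc' : 1 ≤ c') (p : Plane) : Plane :=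
  ![(param hc').symm (param hc (p 0)),
    height c' (param hc (p 0)) + (p 1 - height c (param hc (p 0)))]

theorem polygonMap_mem {c c' : ℝ} (hc : 1 ≤ c) (hc' : 1 ≤ c') {p : Plane} (hp : p ∈ Qplus c) :
    polygonMap hc hc' p ∈ Qplus c' := by
  rw [mem_Qplus_iff hc] at hp
  rw [mem_Qplus_iff hc']
  simp [polygonMap, hp]

theorem polygonMap_polygonMap {c c' : ℝ} (hc : 1 ≤ c) (hc' : 1 ≤ c') (p : Plane) :
    polygonMap hc' hc (polygonMap hc hc' p) = p := by
  apply plane_ext <;> simp [polygonMap]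

theorem continuous_polygonMap {c c' : ℝ} (hc : 1 ≤ c) (hc' : 1 ≤ c') :
    Continuous (polygonMap hc hc') := by
  have h : ∀ c, Continuous (height c) := fun c => continuous_interp fun k => vertex c k 1
  have h0 : Continuous fun p : Plane => param hc (p 0) :=
    (param hc).continuous.comp (continuous_apply 0)
  refine continuous_pi fun i => ?_
  fin_cases i
  · exact (param hc').symm.continuous.comp h0
  · exact ((h c').comp h0).add ((continuous_apply 1).sub ((h c).comp h0))

theorem polygonMap_edge {c c' : ℝ} (hc : 1 ≤ c) (hc' : 1 ≤ c') (k : ℤ) {s : ℝ}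
    (hs : s ∈ Set.Icc (0 : ℝ) 1) :
    polygonMap hc hc' (AffineMap.lineMap (vertex c k) (vertex c (k + 1)) s) =
      AffineMap.lineMap (vertex c' k) (vertex c' (k + 1)) s := by
  have ha : (k + s : ℝ) ∈ Set.Icc (k : ℝ) (k + 1) := ⟨by linarith [hs.1], by linarith [hs.2]⟩
  have e : ∀ {d : ℝ} (hd : 1 ≤ d), (AffineMap.lineMap (vertex d k) (vertex d (k + 1)) s : Plane)
      = ![(param hd).symm (k + s), height d (k + s)] := by
    intro d hd
    rw [param_symm, height, interp_eq _ ha, interp_eq _ ha]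
    apply plane_ext <;> simp [AffineMap.lineMap_apply] <;> ring
  rw [e hc, e hc', polygonMap]
  simp

/-- The homeomorphism of the polygons. -/
noncomputable def polygonHomeo {c c' : ℝ} (hc : 1 ≤ c) (hc' : 1 ≤ c') : Qplus c ≃ₜ Qplus c' where
  toFun p := ⟨polygonMap hc hc' p, polygonMap_mem hc hc' p.2⟩
  invFun p := ⟨polygonMap hc' hc p, polygonMap_mem hc' hc p.2⟩
  left_inv p := Subtype.ext (polygonMap_polygonMap hc hc' p)
  right_inv p := Subtype.ext (polygonMap_polygonMap hc' hc p)
  continuous_toFun := ((continuous_polygonMap hc hc').comp continuous_subtype_val).subtype_mk _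
  continuous_invFun := ((continuous_polygonMap hc' hc).comp continuous_subtype_val).subtype_mk _

/-- A map between the polygons `Q_c^+` acts on both polygons. -/
def bothSides {c c' : ℝ} (g : Qplus c → Qplus c') : Qplus c ⊕ Qminus c → Qplus c' ⊕ Qminus c' :=
  Sum.map g fun q => rot (g ⟨-q.1, q.2⟩)

theorem continuous_bothSides {c c' : ℝ} {g : Qplus c → Qplus c'} (hg : Continuous g) :
    Continuous (bothSides g) := by
  refine hg.sumMap ?_
  refine Continuous.subtype_mk ?_ _
  refine (continuous_subtype_val.comp (hg.comp ?_)).neg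
  exact continuous_subtype_val.neg.subtype_mk _

/-- The gluing replaces the parameter `t` of an edge by `1 - t`, which `g` respects because it
preserves ratios on edges. -/
theorem bothSides_glue {c c' : ℝ} {g : Qplus c → Qplus c'}
    (hg : ∀ (k : ℤ) (t : unitInterval) (p : Qplus c),
      (p : Plane) = AffineMap.lineMap (vertex c k) (vertex c (k + 1)) (t : ℝ) →
      (g p : Plane) = AffineMap.lineMap (vertex c' k) (vertex c' (k + 1)) (t : ℝ))
    {x y : Qplus c ⊕ Qminus c} (h : Glue c x y) : Glue c' (bothSides g x) (bothSides g y) := by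
  obtain ⟨k, p, q, hp, hq⟩ := h
  rw [edge, segment_eq_image_lineMap] at hp
  obtain ⟨t, ht, hp⟩ := hp
  have h1 := hg k ⟨t, ht⟩ p hp.symm
  have h2 := hg k ⟨1 - t, by linarith [ht.2], by linarith [ht.1]⟩ ⟨-q.1, q.2⟩ (by
    show -(q : Plane) = _
    rw [hq, ← hp]
    apply plane_ext <;> simp [AffineMap.lineMap_apply] <;> ring)
  refine Glue.edge k _ _ ?_ ?_
  · rw [edge, segment_eq_image_lineMap]
    exact ⟨t, ht, h1.symm⟩
  · rw [h1]
    simp only [rot, h2]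
    apply plane_ext <;> simp [AffineMap.lineMap_apply] <;> ring

theorem polygonHomeo_edge {c c' : ℝ} (hc : 1 ≤ c) (hc' : 1 ≤ c') (k : ℤ) (t : unitInterval)
    (p : Qplus c) (hp : (p : Plane) = AffineMap.lineMap (vertex c k) (vertex c (k + 1)) (t : ℝ)) :
    (polygonHomeo hc hc' p : Plane) =
      AffineMap.lineMap (vertex c' k) (vertex c' (k + 1)) (t : ℝ) := by
  show polygonMap hc hc' p = _
  rw [hp, polygonMap_edge hc hc' k t.2]

theorem bothSides_bothSides {c c' : ℝ} {g : Qplus c → Qplus c'} {g' : Qplus c' → Qplus c}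
    (h : Function.LeftInverse g' g) : Function.LeftInverse (bothSides g') (bothSides g) := by
  rintro (p | q)
  · simp [bothSides, h p]
  · simp [bothSides, rot, h _]

/-- The homeomorphism of the surfaces that is induced by a homeomorphism of the polygons. -/
noncomputable def surfaceHomeo {c c' : ℝ} (hc : 1 ≤ c) (hc' : 1 ≤ c') : S c ≃ₜ S c' where
  toFun := Quot.map (bothSides (polygonHomeo hc hc'))
    fun _ _ h => bothSides_glue (polygonHomeo_edge hc hc') h
  invFun := Quot.map (bothSides (polygonHomeo hc' hc))
    fun _ _ h => bothSides_glue (polygonHomeo_edge hc' hc) h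
  left_inv := by
    rintro ⟨x⟩
    exact congrArg _ (bothSides_bothSides (polygonHomeo hc hc').left_inv x)
  right_inv := by
    rintro ⟨x⟩
    exact congrArg _ (bothSides_bothSides (polygonHomeo hc hc').right_inv x)
  continuous_toFun := continuous_quot_lift _
    (continuous_quot_mk.comp (continuous_bothSides (polygonHomeo hc hc').continuous))
  continuous_invFun := continuous_quot_lift _
    (continuous_quot_mk.comp (continuous_bothSides (polygonHomeo hc' hc).continuous))

theorem exists_isCanonicalHomeo {c : ℝ} (hc : 1 ≤ c) : ∃ h : S c ≃ₜ S 1, IsCanonicalHomeo h := by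
  refine ⟨surfaceHomeo hc le_rfl, polygonHomeo hc le_rfl, polygonHomeo_edge hc le_rfl,
    fun p => rfl, fun p => ?_⟩
  show Quot.mk _ (Sum.inr _) = Quot.mk _ (Sum.inr _)
  simp [rot]

open Classical in
/-- A map of the polygons, extended to the plane. -/
noncomputable def extendMap {c c' : ℝ} (g : Qplus c → Qplus c') (p : Plane) : Plane :=
  if h : p ∈ Qplus c then g ⟨p, h⟩ else 0

theorem extendMap_apply {c c' : ℝ} (g : Qplus c → Qplus c') {p : Plane} (h : p ∈ Qplus c) :
    extendMap g p = g ⟨p, h⟩ := dif_pos h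

theorem induces_of_homeo {c c' : ℝ} (g : Qplus c ≃ₜ Qplus c') (H : S c → S c')
    (hg : ∀ (k : ℤ) (t : unitInterval) (p : Qplus c),
      (p : Plane) = AffineMap.lineMap (vertex c k) (vertex c (k + 1)) (t : ℝ) →
      (g p : Plane) = AffineMap.lineMap (vertex c' k) (vertex c' (k + 1)) (t : ℝ))
    (h1 : ∀ p : Qplus c, H (inPlus p) = inPlus (g p))
    (h2 : ∀ p : Qplus c, H (inMinus (rot p)) = inMinus (rot (g p))) :
    Induces c c' (extendMap g) H where
  continuousOn := by
    rw [continuousOn_iff_continuous_domRestrict]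
    have : (Qplus c).domRestrict (extendMap g) = fun p => (g p : Plane) := by
      funext p; exact extendMap_apply g p.2
    rw [this]
    exact continuous_subtype_val.comp g.continuous
  mapsTo p hp := by rw [extendMap_apply g hp]; exact (g _).2
  edge k s hs := by
    have hp : (1 - s) • vertex c k + s • vertex c (k + 1) ∈ Qplus c :=
      edge_subset c k ⟨1 - s, s, by linarith [hs.2], hs.1, by ring, rfl⟩
    rw [extendMap_apply g hp, hg k ⟨s, hs⟩ _ (by rw [AffineMap.lineMap_apply_module]),
      AffineMap.lineMap_apply_module]
  map_pt ε p hp := by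
    rw [extendMap_apply g hp]
    cases ε
    · rw [pt_false hp, pt_false (g _).2, h2]
    · rw [pt_true hp, pt_true (g _).2, h1]
  of_vertex p hp := by
    rintro ⟨k, hk⟩
    rw [extendMap_apply g hp] at hk
    have := hg k 0 ⟨_, vertex_mem c k⟩ (by simp)
    simp only [Set.Icc.coe_zero, AffineMap.lineMap_apply_zero] at this
    rw [← this] at hk
    exact ⟨k, congrArg Subtype.val (g.injective (Subtype.ext hk))⟩

theorem IsCanonicalHomeo.induces {c : ℝ} {h : S c ≃ₜ S 1} (hh : IsCanonicalHomeo h) :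
    ∃ g g', Induces c 1 g h ∧ Induces 1 c g' h.symm := by
  obtain ⟨g, hg, h1, h2⟩ := hh
  refine ⟨_, _, induces_of_homeo g h hg h1 h2, induces_of_homeo g.symm h.symm ?_ ?_ ?_⟩
  · intro k t p hp
    have hq : (AffineMap.lineMap (vertex c k) (vertex c (k + 1)) (t : ℝ) : Plane) ∈ Qplus c := by
      refine edge_subset c k ?_
      rw [edge, segment_eq_image_lineMap]
      exact ⟨t, t.2, rfl⟩
    have := hg k t ⟨_, hq⟩ rfl
    rw [← hp] at this
    rw [← Subtype.ext this, Homeomorph.symm_apply_apply]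
  · intro p
    rw [Homeomorph.symm_apply_eq, h1, Homeomorph.apply_symm_apply]
  · intro p
    rw [Homeomorph.symm_apply_eq, h2, Homeomorph.apply_symm_apply]

/-! ### Functions with the symmetries of the reflections in `0` and `1` -/

/-- The extension of a function on `[0, 1]` to the line that commutes with the
reflections in `0` and `1`. -/
noncomputable def unfold (G : ℝ → ℝ) (x : ℝ) : ℝ :=
  if Even ⌊x⌋ then ⌊x⌋ + G (x - ⌊x⌋) else ⌊x⌋ + 1 - G (⌊x⌋ + 1 - x)

section unfold

variable {G : ℝ → ℝ}

theorem unfold_even (h1 : G 1 = 1) {k : ℤ} (hk : Even k) {x : ℝ}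
    (hx : x ∈ Set.Icc (k : ℝ) (k + 1)) : unfold G x = k + G (x - k) := by
  rcases hx.2.eq_or_lt with rfl | h
  · have : ⌊(k : ℝ) + 1⌋ = k + 1 := by simp
    rw [unfold, this, if_neg (by simpa [Int.even_add_one] using hk)]
    push_cast
    rw [show (k : ℝ) + 1 + 1 - (k + 1) = 1 by ring, show (k : ℝ) + 1 - k = 1 by ring, h1]; ring
  · have : ⌊x⌋ = k := Int.floor_eq_iff.2 ⟨hx.1, h⟩
    rw [unfold, this, if_pos hk]

theorem unfold_odd (h0 : G 0 = 0) {k : ℤ} (hk : ¬ Even k) {x : ℝ}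
    (hx : x ∈ Set.Icc (k : ℝ) (k + 1)) : unfold G x = k + 1 - G (k + 1 - x) := by
  rcases hx.2.eq_or_lt with rfl | h
  · have : ⌊(k : ℝ) + 1⌋ = k + 1 := by simp
    rw [unfold, this, if_pos (by simpa [Int.even_add_one] using hk)]
    simp [h0]
  · have : ⌊x⌋ = k := Int.floor_eq_iff.2 ⟨hx.1, h⟩
    rw [unfold, this, if_neg hk]

theorem unfold_of_mem (h1 : G 1 = 1) {x : ℝ} (hx : x ∈ Set.Icc (0 : ℝ) 1) : unfold G x = G x := by
  have := unfold_even (k := 0) h1 (by simp) (x := x) (by simpa using hx)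
  simpa using this

theorem unfold_neg (h0 : G 0 = 0) (h1 : G 1 = 1) (x : ℝ) : unfold G (-x) = -unfold G x := by
  have hx := mem_Icc_floor x
  have hx' : -x ∈ Set.Icc ((-⌊x⌋ - 1 : ℤ) : ℝ) ((-⌊x⌋ - 1 : ℤ) + 1) := by
    push_cast; constructor <;> linarith [hx.1, hx.2]
  by_cases hk : Even ⌊x⌋
  · rw [unfold_even h1 hk hx, unfold_odd h0 (by simpa [Int.even_sub_one] using hk) hx']
    push_cast
    rw [show (-⌊x⌋ - 1 + 1 - -x : ℝ) = x - ⌊x⌋ by ring]; ring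
  · rw [unfold_odd h0 hk hx, unfold_even h1 (by simpa [Int.even_sub_one] using hk) hx']
    push_cast
    rw [show (-x - (-⌊x⌋ - 1) : ℝ) = ⌊x⌋ + 1 - x by ring]; ring

theorem unfold_flip (h0 : G 0 = 0) (h1 : G 1 = 1) (x : ℝ) :
    unfold G (2 - x) = 2 - unfold G x := by
  have hx := mem_Icc_floor x
  have hx' : 2 - x ∈ Set.Icc ((1 - ⌊x⌋ : ℤ) : ℝ) ((1 - ⌊x⌋ : ℤ) + 1) := by
    push_cast; constructor <;> linarith [hx.1, hx.2]
  by_cases hk : Even ⌊x⌋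
  · rw [unfold_even h1 hk hx, unfold_odd h0 (by simpa [Int.even_sub] using hk) hx']
    push_cast
    rw [show (1 - ⌊x⌋ + 1 - (2 - x) : ℝ) = x - ⌊x⌋ by ring]; ring
  · rw [unfold_odd h0 hk hx, unfold_even h1 (by simpa [Int.even_sub] using hk) hx']
    push_cast
    rw [show (2 - x - (1 - ⌊x⌋) : ℝ) = ⌊x⌋ + 1 - x by ring]; ring

theorem unfold_mem (hG : ∀ r ∈ Set.Icc (0 : ℝ) 1, G r ∈ Set.Icc (0 : ℝ) 1) (x : ℝ) :
    unfold G x ∈ Set.Icc (⌊x⌋ : ℝ) (⌊x⌋ + 1) := by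
  have hx := mem_Icc_floor x
  unfold unfold
  split_ifs
  · have := hG (x - ⌊x⌋) ⟨by linarith [hx.1], by linarith [hx.2]⟩
    constructor <;> linarith [this.1, this.2]
  · have := hG (⌊x⌋ + 1 - x) ⟨by linarith [hx.2], by linarith [hx.1]⟩
    constructor <;> linarith [this.1, this.2]

theorem abs_unfold_sub {G' : ℝ → ℝ} {e : ℝ}
    (h : ∀ r ∈ Set.Icc (0 : ℝ) 1, |G r - G' r| ≤ e) (x : ℝ) : |unfold G x - unfold G' x| ≤ e := by
  have hx := mem_Icc_floor x
  unfold unfold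
  split_ifs
  · have := h (x - ⌊x⌋) ⟨by linarith [hx.1], by linarith [hx.2]⟩
    rwa [add_sub_add_left_eq_sub]
  · have := h (⌊x⌋ + 1 - x) ⟨by linarith [hx.2], by linarith [hx.1]⟩
    rwa [sub_sub_sub_cancel_left, abs_sub_comm]

theorem continuous_unfold (h0 : G 0 = 0) (h1 : G 1 = 1)
    (hG : ContinuousOn G (Set.Icc 0 1)) : Continuous (unfold G) := by
  refine locallyFinite_Icc_int.continuous ?_ (fun k => isClosed_Icc) fun k => ?_
  · exact Set.eq_univ_of_forall fun a => Set.mem_iUnion.2 ⟨⌊a⌋, mem_Icc_floor a⟩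
  · by_cases hk : Even k
    · refine ContinuousOn.congr (f := fun x : ℝ => k + G (x - k)) ?_
        fun x hx => unfold_even h1 hk hx
      refine continuousOn_const.add (hG.comp (by fun_prop) fun x hx => ?_)
      exact ⟨by linarith [hx.1], by linarith [hx.2]⟩
    · refine ContinuousOn.congr (f := fun x : ℝ => k + 1 - G (k + 1 - x)) ?_
        fun x hx => unfold_odd h0 hk hx
      refine continuousOn_const.sub (hG.comp (by fun_prop) fun x hx => ?_)
      exact ⟨by linarith [hx.2], by linarith [hx.1]⟩

theorem monotone_unfold (hm : ∀ r ∈ Set.Icc (0 : ℝ) 1, G r ∈ Set.Icc (0 : ℝ) 1)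
    (hG : MonotoneOn G (Set.Icc 0 1)) : Monotone (unfold G) := by
  intro x y hxy
  have hx := mem_Icc_floor x
  have hy := mem_Icc_floor y
  rcases (Int.floor_mono hxy).eq_or_lt with h | h
  · unfold unfold
    rw [← h] at hy ⊢
    split_ifs
    · have := hG (a := x - ⌊x⌋) (b := y - ⌊x⌋) ⟨by linarith [hx.1], by linarith [hx.2]⟩
        ⟨by linarith [hy.1], by linarith [hy.2]⟩ (by linarith)
      linarith
    · have := hG (a := ⌊x⌋ + 1 - y) (b := ⌊x⌋ + 1 - x) ⟨by linarith [hy.2], by linarith [hy.1]⟩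
        ⟨by linarith [hx.2], by linarith [hx.1]⟩ (by linarith)
      linarith
  · have h1 : (⌊x⌋ : ℝ) + 1 ≤ ⌊y⌋ := by exact_mod_cast h
    exact (unfold_mem hm x).2.trans (h1.trans (unfold_mem hm y).1)

end unfold

/-! ### The projective actions in an affine chart -/

/-- The fixed point of `C_c`, other than `1`, in the chart `(x, 1)`. -/
noncomputable def kap (c : ℝ) : ℝ := (c - 1) / (c + 1)

/-- The image of `∞` under `C_c`. -/
noncomputable def mid (c : ℝ) : ℝ := c / (c + 1)

/-- The action of `C_c` in the chart `(x, 1)`. -/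
noncomputable def inv (c x : ℝ) : ℝ := mid c + 1 / ((c + 1) ^ 2 * (x - mid c))

section chart

variable {c : ℝ}

theorem mid_sub_kap : mid c - kap c = 1 / (c + 1) := by
  unfold kap mid; rw [← sub_div]; ring

variable (hc : 1 ≤ c)

include hc

theorem kap_nonneg : 0 ≤ kap c := div_nonneg (by linarith) (by linarith)

theorem kap_lt_mid : kap c < mid c := by
  unfold kap mid
  rw [div_lt_div_iff_of_pos_right (by linarith)]
  linarith

theorem mid_lt_one : mid c < 1 := by
  unfold mid; rw [div_lt_one (by linarith)]; linarith

theorem one_sub_mid : 1 - mid c = 1 / (c + 1) := by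
  have : c + 1 ≠ 0 := by linarith
  unfold mid; field_simp; ring

theorem half_le_mid : 1 / 2 ≤ mid c := by
  unfold mid
  rw [div_le_div_iff₀ (by norm_num) (by linarith)]; linarith

/-- $C_c$ acts as the inversion about `mid c` with radius $1/(c+1)$; the fixed points $\kappa$ and
$1$ are at this distance from the center. The properties of `inv` below follow from this identity.
-/
theorem inv_sub_mul {x : ℝ} (hx : x ≠ mid c) :
    (inv c x - mid c) * (x - mid c) = (1 / (c + 1)) ^ 2 := by
  have : c + 1 ≠ 0 := by linarith
  have : x - mid c ≠ 0 := sub_ne_zero.2 hx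
  unfold inv
  field_simp
  ring

theorem inv_ne_mid {x : ℝ} (hx : x ≠ mid c) : inv c x ≠ mid c := by
  intro h
  have := inv_sub_mul hc hx
  rw [h, sub_self, zero_mul] at this
  have h2 : 0 < (1 / (c + 1)) ^ 2 := pow_pos (div_pos one_pos (by linarith)) 2
  exact h2.ne this

theorem inv_inv {x : ℝ} (hx : x ≠ mid c) : inv c (inv c x) = x := by
  have h1 := inv_sub_mul hc hx
  have h2 := inv_sub_mul hc (inv_ne_mid hc hx)
  have h3 : inv c x - mid c ≠ 0 := sub_ne_zero.2 (inv_ne_mid hc hx)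
  have h4 : inv c (inv c x) - mid c = x - mid c :=
    mul_right_cancel₀ h3 (by linear_combination h2 - h1)
  linarith

theorem inv_le_kap {x : ℝ} (h1 : kap c ≤ x) (h2 : x < mid c) : inv c x ≤ kap c := by
  have h3 := inv_sub_mul hc h2.ne
  have h4 := mid_sub_kap (c := c)
  rw [← h4] at h3
  by_contra! hcon
  nlinarith

theorem one_le_inv {x : ℝ} (h1 : mid c < x) (h2 : x ≤ 1) : 1 ≤ inv c x := by
  have h3 := inv_sub_mul hc h1.ne'
  have h4 := one_sub_mid hc
  rw [← h4] at h3
  by_contra! hcon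
  nlinarith

theorem inv_kap : inv c (kap c) = kap c := by
  have h1 := kap_lt_mid hc
  have h3 := inv_sub_mul hc h1.ne
  rw [← mid_sub_kap] at h3
  have h4 : kap c - mid c ≠ 0 := (sub_neg.2 h1).ne
  have := mul_right_cancel₀ h4 (show (inv c (kap c) - mid c) * (kap c - mid c) =
    (kap c - mid c) * (kap c - mid c) by rw [h3]; ring)
  linarith

theorem inv_one : inv c 1 = 1 := by
  have h1 := mid_lt_one hc
  have h3 := inv_sub_mul hc h1.ne'
  rw [← one_sub_mid hc] at h3
  have h4 : 1 - mid c ≠ 0 := (sub_pos.2 h1).ne'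
  have := mul_right_cancel₀ h4 (show (inv c 1 - mid c) * (1 - mid c) =
    (1 - mid c) * (1 - mid c) by rw [h3]; ring)
  linarith

theorem inv_anti {x y : ℝ} (hxy : x ≤ y) (h : y < mid c ∨ mid c < x) : inv c y ≤ inv c x := by
  have hx : x ≠ mid c := by rcases h with h | h <;> [exact (hxy.trans_lt h).ne; exact h.ne']
  have hy : y ≠ mid c := by rcases h with h | h <;> [exact h.ne; exact (h.trans_le hxy).ne']
  have h1 := inv_sub_mul hc hx
  have h2 := inv_sub_mul hc hy
  have hp : 0 < (1 / (c + 1)) ^ 2 := pow_pos (div_pos one_pos (by linarith)) 2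
  have e : (inv c x - inv c y) * ((x - mid c) * (y - mid c)) = (1 / (c + 1)) ^ 2 * (y - x) := by
    linear_combination (y - mid c) * h1 - (x - mid c) * h2
  have hq : 0 < (x - mid c) * (y - mid c) := by
    rcases h with h | h
    · exact mul_pos_of_neg_of_neg (by linarith) (by linarith)
    · exact mul_pos (by linarith) (by linarith)
  by_contra! hcon
  have : 0 ≤ (1 / (c + 1)) ^ 2 * (y - x) := mul_nonneg hp.le (by linarith)
  nlinarith

theorem continuousAt_inv {x : ℝ} (hx : x ≠ mid c) : ContinuousAt (inv c) x := by
  have h1 : c + 1 ≠ 0 := by linarith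
  have h2 : x - mid c ≠ 0 := sub_ne_zero.2 hx
  unfold inv
  refine continuousAt_const.add (ContinuousAt.div continuousAt_const (by fun_prop) ?_)
  positivity

end chart

/-! ### The equation for the semiconjugacy in the affine chart -/

/-- The functions that commute with the reflections in `0` and `1`, preserve `[0, 1]`, and vanish
on `[0, κ]`. -/
structure Symmetric (c : ℝ) (f : ℝ → ℝ) : Prop where
  neg : ∀ x, f (-x) = -f x
  flip : ∀ x, f (2 - x) = 2 - f x
  mem : ∀ x ∈ Set.Icc (0 : ℝ) 1, f x ∈ Set.Icc (0 : ℝ) 1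
  vanish : ∀ x ∈ Set.Icc 0 (kap c), f x = 0

namespace Symmetric

variable {c : ℝ} {f g : ℝ → ℝ}

theorem one (hf : Symmetric c f) : f 1 = 1 := by
  have := hf.flip 1
  norm_num at this
  linarith

theorem add_two (hf : Symmetric c f) (x : ℝ) : f (x + 2) = f x + 2 := by
  have := hf.flip (-x)
  rw [hf.neg] at this
  rw [show x + 2 = 2 - -x by ring, this]; ring

theorem add_int (hf : Symmetric c f) (n : ℤ) (x : ℝ) : f (x + 2 * n) = f x + 2 * n := by
  induction n using Int.induction_on generalizing x with
  | zero => simp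
  | succ n ih =>
    push_cast at ih ⊢
    rw [show x + 2 * ((n : ℝ) + 1) = x + 2 * n + 2 by ring, hf.add_two, ih]; ring
  | pred n ih =>
    push_cast at ih ⊢
    have := hf.add_two (x + 2 * (-(n : ℝ) - 1))
    rw [show x + 2 * (-(n : ℝ) - 1) + 2 = x + 2 * -n by ring, ih] at this
    linarith

theorem unfold_self (hf : Symmetric c f) : unfold f = f := by
  funext x
  unfold unfold
  split_ifs with hk
  · obtain ⟨n, hn⟩ := hk
    have h1 : (⌊x⌋ : ℝ) = 2 * n := by rw [hn]; push_cast; ring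
    have := hf.add_int n (x - 2 * n)
    rw [sub_add_cancel] at this
    rw [h1, this]; ring
  · obtain ⟨n, hn⟩ := Int.not_even_iff_odd.1 hk
    have h1 : (⌊x⌋ : ℝ) = 2 * n + 1 := by rw [hn]; push_cast; ring
    have := hf.add_int (n + 1) (-x)
    push_cast at this
    rw [hf.neg] at this
    rw [h1, show (2 * n + 1 + 1 - x : ℝ) = -x + 2 * (n + 1) by ring, this]; ring

/-- The symmetries spread the invariance of `[0, 1]` to all unit intervals. Any two such functions
are hence at distance at most one, which starts the iteration. -/
theorem mem_floor (hf : Symmetric c f) (x : ℝ) : f x ∈ Set.Icc (⌊x⌋ : ℝ) (⌊x⌋ + 1) := by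
  have := unfold_mem hf.mem x
  rwa [hf.unfold_self] at this

theorem abs_sub_le_one (hf : Symmetric c f) (hg : Symmetric c g) (x : ℝ) : |f x - g x| ≤ 1 := by
  have h1 := hf.mem_floor x
  have h2 := hg.mem_floor x
  rw [abs_le]
  constructor <;> linarith [h1.1, h1.2, h2.1, h2.2]

theorem abs_sub_self (hf : Symmetric c f) (x : ℝ) : |x - f x| ≤ 1 := by
  have h1 := hf.mem_floor x
  have h2 := mem_Icc_floor x
  rw [abs_le]
  constructor <;> linarith [h1.1, h1.2, h2.1, h2.2]

theorem one_le (hf : Symmetric c f) {x : ℝ} (hx : 1 ≤ x) : 1 ≤ f x := by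
  refine le_trans ?_ (hf.mem_floor x).1
  exact_mod_cast Int.le_floor.2 (by simpa using hx)

theorem nonpos (hf : Symmetric c f) {x : ℝ} (hx : x ≤ kap c) : f x ≤ 0 := by
  rcases le_or_gt 0 x with h | h
  · exact (hf.vanish x ⟨h, hx⟩).le
  · refine (hf.mem_floor x).2.trans ?_
    have : ⌊x⌋ < 0 := Int.floor_lt.2 (by simpa using h)
    exact_mod_cast this

/-- The inversion moves $[\kappa,1]$ out of $(\kappa,1)$, where `f` has values outside of $(0,1)$,
away from the pole $1/2$ of `inv 1`. -/
theorem inv_cases (hc : 1 ≤ c) (hf : Symmetric c f) {x : ℝ} (h1 : kap c ≤ x) (h2 : x ≤ 1)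
    (h3 : x ≠ mid c) : (x < mid c ∧ f (inv c x) ≤ 0) ∨ (mid c < x ∧ 1 ≤ f (inv c x)) := by
  rcases h3.lt_or_gt with h | h
  · exact .inl ⟨h, hf.nonpos (inv_le_kap hc h1 h)⟩
  · exact .inr ⟨h, hf.one_le (one_le_inv hc h h2)⟩

end Symmetric

/-- The action of `C_1` in the chart, with an affine factor. -/
theorem inv_one_eq (y : ℝ) : inv 1 y = 1 / 2 + 1 / (4 * (y - 1 / 2)) := by
  norm_num [inv, mid]

/-- At distance $\alpha$ outside of $[0,1]$ the value of `inv 1` is $1/2\pm1/(2+4\alpha)$, and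
differences are $(\beta-\alpha)/((1+2\alpha)(1+2\beta))$, with the worst case $\alpha=0$. The
derivative at 0 and 1 has modulus one, so there is no uniform contraction factor. -/
theorem abs_inv_one_sub_le {a b e : ℝ} (he : |a - b| ≤ e)
    (h : (a ≤ 0 ∧ b ≤ 0) ∨ (1 ≤ a ∧ 1 ≤ b)) : |inv 1 a - inv 1 b| ≤ e / (1 + 2 * e) := by
  have key : ∀ α β : ℝ, 0 ≤ α → 0 ≤ β → |α - β| ≤ e →
      |1 / (2 + 4 * α) - 1 / (2 + 4 * β)| ≤ e / (1 + 2 * e) := by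
    have : ∀ α β : ℝ, 0 ≤ α → α ≤ β → β - α ≤ e →
        |1 / (2 + 4 * α) - 1 / (2 + 4 * β)| ≤ e / (1 + 2 * e) := by
      intro α β hα hαβ h
      have h1 : 1 / (2 + 4 * α) - 1 / (2 + 4 * β)
          = (β - α) / ((1 + 2 * α) * (1 + 2 * β)) := by
        have : 1 + 2 * α ≠ 0 := by linarith
        have : 1 + 2 * β ≠ 0 := by linarith
        rw [show 2 + 4 * α = 2 * (1 + 2 * α) by ring, show 2 + 4 * β = 2 * (1 + 2 * β) by ring]
        field_simp
        ring
      rw [h1, abs_of_nonneg (div_nonneg (by linarith) (mul_nonneg (by linarith) (by linarith))),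
        div_le_div_iff₀ (mul_pos (by linarith) (by linarith)) (by linarith)]
      nlinarith [mul_nonneg hα (hα.trans hαβ), mul_nonneg (sub_nonneg.2 h) hα,
        mul_nonneg (show 0 ≤ e by linarith) (mul_nonneg hα (hα.trans hαβ)),
        mul_nonneg (show 0 ≤ e by linarith) hα]
    intro α β hα hβ h
    rcases le_total α β with h' | h'
    · exact this α β hα h' (by have := neg_abs_le (α - β); linarith)
    · rw [abs_sub_comm]
      exact this β α hβ h' (by have := le_abs_self (α - β); linarith)
  rcases h with ⟨ha, hb⟩ | ⟨ha, hb⟩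
  · have := key (-a) (-b) (by linarith) (by linarith) (by rwa [neg_sub_neg, abs_sub_comm])
    rw [abs_sub_comm] at this
    convert this using 2
    rw [inv_one_eq, inv_one_eq, show 4 * (a - 1 / 2) = -(2 + 4 * -a) by ring,
      show 4 * (b - 1 / 2) = -(2 + 4 * -b) by ring, div_neg, div_neg]
    ring
  · have := key (a - 1) (b - 1) (by linarith) (by linarith) (by rwa [sub_sub_sub_cancel_right])
    convert this using 2
    rw [inv_one_eq, inv_one_eq, show 4 * (a - 1 / 2) = 2 + 4 * (a - 1) by ring,
      show 4 * (b - 1 / 2) = 2 + 4 * (b - 1) by ring]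
    ring

/-- The right hand side, on `[0, 1]`, of the equation for the semiconjugacy. -/
noncomputable def stepFun (c : ℝ) (f : ℝ → ℝ) (x : ℝ) : ℝ :=
  if x ≤ kap c then 0 else if x = mid c then 1 / 2 else inv 1 (f (inv c x))

/-- The right hand side of the equation for the semiconjugacy. -/
noncomputable def step (c : ℝ) (f : ℝ → ℝ) : ℝ → ℝ := unfold (stepFun c f)

section step

variable {c : ℝ} {f g : ℝ → ℝ}

theorem stepFun_zero (hc : 1 ≤ c) : stepFun c f 0 = 0 := if_pos (kap_nonneg hc)

theorem stepFun_one (hc : 1 ≤ c) (hf : Symmetric c f) : stepFun c f 1 = 1 := by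
  have h1 := kap_lt_mid hc
  have h2 := mid_lt_one hc
  rw [stepFun, if_neg (by linarith), if_neg h2.ne', inv_one hc, hf.one, inv_one le_rfl]

theorem inv_one_mem_of_nonpos {y : ℝ} (hy : y ≤ 0) : inv 1 y ∈ Set.Ico (0 : ℝ) (1 / 2) := by
  rw [inv_one_eq, show 4 * (y - 1 / 2) = -(2 + 4 * -y) by ring, div_neg]
  have : 0 < 1 / (2 + 4 * -y) := by apply div_pos <;> linarith
  have : 1 / (2 + 4 * -y) ≤ 1 / 2 := one_div_le_one_div_of_le (by norm_num) (by linarith)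
  constructor <;> linarith

theorem inv_one_mem_of_one_le {y : ℝ} (hy : 1 ≤ y) : inv 1 y ∈ Set.Ioc (1 / 2 : ℝ) 1 := by
  rw [inv_one_eq, show 4 * (y - 1 / 2) = 2 + 4 * (y - 1) by ring]
  have : 0 < 1 / (2 + 4 * (y - 1)) := by apply div_pos <;> linarith
  have : 1 / (2 + 4 * (y - 1)) ≤ 1 / 2 := one_div_le_one_div_of_le (by norm_num) (by linarith)
  constructor <;> linarith

theorem stepFun_cases (hc : 1 ≤ c) (hf : Symmetric c f) {x : ℝ} (hx : x ≤ 1) :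
    (x < mid c ∧ stepFun c f x ∈ Set.Ico (0 : ℝ) (1 / 2)) ∨ (x = mid c ∧ stepFun c f x = 1 / 2) ∨
      (mid c < x ∧ stepFun c f x ∈ Set.Ioc (1 / 2 : ℝ) 1) := by
  unfold stepFun
  split_ifs with h1 h2
  · exact .inl ⟨h1.trans_lt (kap_lt_mid hc), by norm_num⟩
  · exact .inr (.inl ⟨h2, rfl⟩)
  · rcases hf.inv_cases hc (not_le.1 h1).le hx h2 with ⟨h, h'⟩ | ⟨h, h'⟩
    · exact .inl ⟨h, inv_one_mem_of_nonpos h'⟩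
    · exact .inr (.inr ⟨h, inv_one_mem_of_one_le h'⟩)

theorem stepFun_mem (hc : 1 ≤ c) (hf : Symmetric c f) {x : ℝ} (hx : x ∈ Set.Icc (0 : ℝ) 1) :
    stepFun c f x ∈ Set.Icc (0 : ℝ) 1 := by
  rcases stepFun_cases hc hf hx.2 with ⟨-, h⟩ | ⟨-, h⟩ | ⟨-, h⟩
  · exact ⟨h.1, by linarith [h.2]⟩
  · rw [h]; norm_num
  · exact ⟨by linarith [h.1], h.2⟩

theorem symmetric_step (hc : 1 ≤ c) (hf : Symmetric c f) : Symmetric c (step c f) where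
  neg := unfold_neg (stepFun_zero hc) (stepFun_one hc hf)
  flip := unfold_flip (stepFun_zero hc) (stepFun_one hc hf)
  mem x hx := by
    rw [step, unfold_of_mem (stepFun_one hc hf) hx]
    exact stepFun_mem hc hf hx
  vanish x hx := by
    have h1 := kap_lt_mid hc
    have h2 := mid_lt_one hc
    rw [step, unfold_of_mem (stepFun_one hc hf) ⟨hx.1, by linarith [hx.2]⟩]
    exact if_pos hx.2

theorem abs_step_sub_le (hc : 1 ≤ c) (hf : Symmetric c f) (hg : Symmetric c g) {e : ℝ}
    (h : ∀ x, |f x - g x| ≤ e) (x : ℝ) : |step c f x - step c g x| ≤ e / (1 + 2 * e) := by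
  have he : 0 ≤ e := (abs_nonneg _).trans (h 0)
  refine abs_unfold_sub (fun r hr => ?_) x
  unfold stepFun
  split_ifs with h1 h2
  · simp only [sub_self, abs_zero]; positivity
  · simp only [sub_self, abs_zero]; positivity
  · refine abs_inv_one_sub_le (h _) ?_
    rcases hf.inv_cases hc (not_le.1 h1).le hr.2 h2 with ⟨h3, h4⟩ | ⟨h3, h4⟩ <;>
      rcases hg.inv_cases hc (not_le.1 h1).le hr.2 h2 with ⟨h5, h6⟩ | ⟨h5, h6⟩
    · exact .inl ⟨h4, h6⟩
    · linarith
    · linarith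
    · exact .inr ⟨h4, h6⟩

/-- On each side of `mid c` two decreasing inversions enclose the increasing `f`, and the value
$1/2$ separates the two sides. -/
theorem monotone_step (hc : 1 ≤ c) (hf : Symmetric c f) (hm : Monotone f) :
    Monotone (step c f) := by
  refine monotone_unfold (fun r hr => stepFun_mem hc hf hr) fun x hx y hy hxy => ?_
  have h0 := kap_lt_mid hc
  rcases le_or_gt x (kap c) with h1 | h1
  · rw [stepFun, if_pos h1]
    exact (stepFun_mem hc hf hy).1
  have h1' := h1.trans_le hxy
  rcases stepFun_cases hc hf hx.2 with ⟨hx', h⟩ | ⟨hx', h⟩ | ⟨hx', h⟩ <;>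
    rcases stepFun_cases hc hf hy.2 with ⟨hy', h'⟩ | ⟨hy', h'⟩ | ⟨hy', h'⟩
  any_goals linarith [h.1, h.2, h'.1, h'.2]
  any_goals linarith [h.1, h.2]
  any_goals linarith [h'.1, h'.2]
  any_goals linarith
  · rw [stepFun, if_neg (not_le.2 h1), if_neg hx'.ne, stepFun, if_neg (not_le.2 h1'),
      if_neg hy'.ne]
    refine inv_anti le_rfl (hm (inv_anti hc hxy (.inl hy'))) (.inl ?_)
    refine (hf.nonpos (inv_le_kap hc h1.le hx')).trans_lt ?_
    norm_num [mid]
  · rw [stepFun, if_neg (not_le.2 h1), if_neg hx'.ne', stepFun, if_neg (not_le.2 h1'),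
      if_neg hy'.ne']
    refine inv_anti le_rfl (hm (inv_anti hc hxy (.inr hx'))) (.inr ?_)
    refine lt_of_lt_of_le ?_ (hf.one_le (one_le_inv hc hy' hy.2))
    norm_num [mid]

/-- The delicate point is the pole `mid c` of the inversion. As `f` stays within distance one of the
identity, `f (inv c y)` is unbounded there at the same rate, and `inv 1` brings it to $1/2$ with a
linear error. -/
theorem continuous_step (hc : 1 ≤ c) (hf : Symmetric c f) (hcont : Continuous f) :
    Continuous (step c f) := by
  have h0 := kap_lt_mid hc
  have h1 := mid_lt_one hc
  have h2 := kap_nonneg hc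
  refine continuous_unfold (stepFun_zero hc) (stepFun_one hc hf) ?_
  rw [← Set.Icc_union_Icc_eq_Icc h2 (by linarith : kap c ≤ 1)]
  refine ContinuousOn.union_of_isClosed ?_ ?_ isClosed_Icc isClosed_Icc
  · exact (continuousOn_const (c := (0 : ℝ))).congr fun x hx => if_pos hx.2
  have hF : ∀ x ∈ Set.Icc (kap c) 1, x ≠ mid c → stepFun c f x = inv 1 (f (inv c x)) := by
    intro x hx hx'
    rw [stepFun]
    split_ifs with h3
    · obtain rfl := le_antisymm h3 hx.1
      rw [inv_kap hc, hf.vanish _ ⟨h2, le_rfl⟩]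
      norm_num [inv, mid]
    · rfl
  have hmid : stepFun c f (mid c) = 1 / 2 := by
    rw [stepFun, if_neg (not_le.2 h0), if_pos rfl]
  intro x hx
  by_cases hx' : x = mid c
  · subst hx'
    refine ContinuousAt.continuousWithinAt ?_
    have hb : ∀ y ∈ Set.Ioo (kap c) 1, |stepFun c f y - 1 / 2| ≤ |y - mid c| * (c + 1) ^ 2 := by
      intro y hy
      by_cases hy' : y = mid c
      · rw [hy', hmid]; simp
      rw [hF y ⟨hy.1.le, hy.2.le⟩ hy', inv_one_eq, add_sub_cancel_left]
      set w := inv c y with hw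
      have e1 := inv_sub_mul hc hy'
      rw [← hw] at e1
      have e2 : 1 / 2 ≤ |f w - 1 / 2| := by
        rcases hf.inv_cases hc hy.1.le hy.2.le hy' with ⟨-, h⟩ | ⟨-, h⟩
        · rw [abs_sub_comm]; exact le_trans (by linarith) (le_abs_self _)
        · exact le_trans (by linarith) (le_abs_self _)
      -- The bounded errors, 1 from `f` and 1/2 from the center, are absorbed into the factor 4
      -- because `f w` is at distance at least 1/2 from 1/2.
      have e3 : |w - mid c| ≤ 4 * |f w - 1 / 2| := by
        have e4 := hf.abs_sub_self w
        have e5 : |1 / 2 - mid c| ≤ 1 := by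
          rw [abs_le]; constructor <;> linarith [half_le_mid hc]
        have e6 := abs_add_le (w - f w + (f w - 1 / 2)) (1 / 2 - mid c)
        have e7 := abs_add_le (w - f w) (f w - 1 / 2)
        rw [show w - f w + (f w - 1 / 2) + (1 / 2 - mid c) = w - mid c by ring] at e6
        have e8 : |1 / 2 - mid c| ≤ 1 / 2 := by
          rw [abs_le]; constructor <;> linarith [half_le_mid hc]
        linarith
      have e9 : |w - mid c| * |y - mid c| * (c + 1) ^ 2 = 1 := by
        rw [← abs_mul, e1, abs_of_nonneg (by positivity)]
        have : c + 1 ≠ 0 := by linarith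
        field_simp
      rw [abs_div, abs_one, abs_mul, abs_of_pos (by norm_num : (0 : ℝ) < 4),
        div_le_iff₀ (by linarith)]
      have e10 : 0 ≤ |y - mid c| * (c + 1) ^ 2 := by positivity
      nlinarith
    rw [ContinuousAt, hmid, tendsto_iff_dist_tendsto_zero]
    refine squeeze_zero' (.of_forall fun _ => dist_nonneg)
      (g := fun y => |y - mid c| * (c + 1) ^ 2) ?_ ?_
    · filter_upwards [Ioo_mem_nhds h0 h1] with y hy
      rw [Real.dist_eq]
      exact hb y hy
    · have : Continuous fun y => |y - mid c| * (c + 1) ^ 2 := by fun_prop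
      simpa using this.tendsto (mid c)
  · have hne : ∀ᶠ y in nhds x, y ≠ mid c := isOpen_ne.mem_nhds hx'
    have hc1 : ContinuousAt (fun y => inv 1 (f (inv c y))) x := by
      refine ContinuousAt.comp (g := inv 1) (f := fun y => f (inv c y)) (continuousAt_inv le_rfl ?_)
        (hcont.continuousAt.comp (continuousAt_inv hc hx'))
      rcases hf.inv_cases hc hx.1 hx.2 hx' with ⟨-, h⟩ | ⟨-, h⟩
      · exact (h.trans_lt (by norm_num [mid])).ne
      · exact (lt_of_lt_of_le (by norm_num [mid]) h).ne'
    refine (hc1.continuousWithinAt (s := Set.Icc (kap c) 1)).congr_of_eventuallyEq ?_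
      (hF x hx hx')
    filter_upwards [self_mem_nhdsWithin, nhdsWithin_le_nhds hne] with y hy hy'
    exact hF y hy hy'

end step

/-- The function that describes the semiconjugacy in the affine chart. -/
structure IsProfile (c : ℝ) (f : ℝ → ℝ) : Prop where
  symmetric : Symmetric c f
  step_eq : step c f = f

/-- The bound $e/(1+2e)$ sends $1/(2n+1)$ to $1/(2n+3)$, so two fixed points of `step` are closer
than every positive number. -/
theorem IsProfile.unique {c : ℝ} (hc : 1 ≤ c) {f g : ℝ → ℝ} (hf : IsProfile c f)
    (hg : IsProfile c g) : f = g := by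
  have key : ∀ n : ℕ, ∀ x, |f x - g x| ≤ 1 / (2 * n + 1) := by
    intro n
    induction n with
    | zero => simpa using hf.symmetric.abs_sub_le_one hg.symmetric
    | succ n ih =>
      intro x
      have := abs_step_sub_le hc hf.symmetric hg.symmetric ih x
      rw [hf.step_eq, hg.step_eq] at this
      convert this using 1
      push_cast
      field_simp
      ring
  funext x
  rw [← sub_eq_zero, ← abs_eq_zero]
  refine le_antisymm (le_of_forall_pos_le_add fun e he => ?_) (abs_nonneg _)
  obtain ⟨n, hn⟩ := exists_nat_one_div_lt he
  have h1 : 1 / (2 * (n : ℝ) + 1) ≤ 1 / (n + 1) :=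
    one_div_le_one_div_of_le (by positivity) (by linarith [n.cast_nonneg (α := ℝ)])
  linarith [key n x]

/-- A continuous function with the symmetries. -/
theorem exists_symmetric {c : ℝ} (hc : 1 ≤ c) :
    ∃ f, Symmetric c f ∧ Continuous f ∧ Monotone f := by
  have h0 := kap_nonneg hc
  have h1 := (kap_lt_mid hc).trans (mid_lt_one hc)
  let G : ℝ → ℝ := fun x => max 0 ((x - kap c) / (1 - kap c))
  have hG0 : G 0 = 0 := max_eq_left (div_nonpos_of_nonpos_of_nonneg (by linarith) (by linarith))
  have hG1 : G 1 = 1 := by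
    simp only [G]
    rw [div_self (by linarith), max_eq_right zero_le_one]
  have hGm : Monotone G := fun x y hxy =>
    max_le_max le_rfl (div_le_div_of_nonneg_right (by linarith) (by linarith))
  have hG : ∀ r ∈ Set.Icc (0 : ℝ) 1, G r ∈ Set.Icc (0 : ℝ) 1 := fun r hr =>
    ⟨le_max_left _ _, hG1 ▸ hGm hr.2⟩
  refine ⟨unfold G, ⟨unfold_neg hG0 hG1, unfold_flip hG0 hG1, fun x hx => ?_, fun x hx => ?_⟩,
    continuous_unfold hG0 hG1 (by fun_prop), monotone_unfold hG (hGm.monotoneOn _)⟩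
  · rw [unfold_of_mem hG1 hx]; exact hG x hx
  · rw [unfold_of_mem hG1 ⟨hx.1, by linarith [hx.2]⟩]
    exact max_eq_left (div_nonpos_of_nonpos_of_nonneg (by linarith [hx.2]) (by linarith))

/-- The iterates of `step` are uniformly Cauchy with the same rate, so that continuity, monotonicity
and the symmetries pass to the limit. -/
theorem exists_isProfile {c : ℝ} (hc : 1 ≤ c) : ∃ f, IsProfile c f ∧ Continuous f ∧ Monotone f := by
  obtain ⟨f₀, hs₀, hc₀, hm₀⟩ := exists_symmetric hc
  let u : ℕ → ℝ → ℝ := fun n => (step c)^[n] f₀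
  have hu : ∀ n, u (n + 1) = step c (u n) := fun n => Function.iterate_succ_apply' _ _ _
  have hs : ∀ n, Symmetric c (u n) := by
    intro n
    induction n with
    | zero => exact hs₀
    | succ n ih => rw [hu]; exact symmetric_step hc ih
  have hcont : ∀ n, Continuous (u n) := by
    intro n
    induction n with
    | zero => exact hc₀
    | succ n ih => rw [hu]; exact continuous_step hc (hs n) ih
  have hmono : ∀ n, Monotone (u n) := by
    intro n
    induction n with
    | zero => exact hm₀
    | succ n ih => rw [hu]; exact monotone_step hc (hs n) ih
  have key : ∀ n m : ℕ, n ≤ m → ∀ x, |u n x - u m x| ≤ 1 / (2 * n + 1) := by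
    intro n
    induction n with
    | zero => intro m _ x; simpa using (hs 0).abs_sub_le_one (hs m) x
    | succ n ih =>
      intro m hm x
      obtain ⟨m, rfl⟩ : ∃ j, m = j + 1 := ⟨m - 1, by omega⟩
      have := abs_step_sub_le hc (hs n) (hs m) (ih m (by omega)) x
      rw [← hu, ← hu] at this
      convert this using 1
      push_cast
      field_simp
      ring
  have hz : Filter.Tendsto (fun n : ℕ => 1 / (2 * (n : ℝ) + 1)) Filter.atTop (nhds 0) := by
    have := tendsto_one_div_add_atTop_nhds_zero_nat (𝕜 := ℝ)
    refine squeeze_zero (fun n => by positivity) (fun n => ?_) this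
    exact one_div_le_one_div_of_le (by positivity) (by linarith [n.cast_nonneg (α := ℝ)])
  have hlim : ∀ x, ∃ y, Filter.Tendsto (fun n => u n x) Filter.atTop (nhds y) := by
    intro x
    refine cauchySeq_tendsto_of_complete (cauchySeq_of_le_tendsto_0' _ (fun n m h => ?_) hz)
    rw [Real.dist_eq]
    exact key n m h x
  choose f hf using hlim
  have hfu : ∀ n x, |u n x - f x| ≤ 1 / (2 * n + 1) := by
    intro n x
    refine le_of_tendsto ((tendsto_const_nhds.sub (hf x)).abs) ?_
    filter_upwards [Filter.eventually_ge_atTop n] with m hm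
    exact key n m hm x
  have hsym : Symmetric c f := by
    refine ⟨fun x => ?_, fun x => ?_, fun x hx => ?_, fun x hx => ?_⟩
    · refine tendsto_nhds_unique (hf (-x)) ?_
      simpa only [(hs _).neg] using (hf x).neg
    · refine tendsto_nhds_unique (hf (2 - x)) ?_
      simpa only [(hs _).flip] using (hf x).const_sub 2
    · exact isClosed_Icc.mem_of_tendsto (hf x) (.of_forall fun n => (hs n).mem x hx)
    · refine tendsto_nhds_unique (hf x) ?_
      simpa only [(hs _).vanish x hx] using tendsto_const_nhds
  refine ⟨f, ⟨hsym, ?_⟩, ?_, ?_⟩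
  · funext x
    have h1 : Filter.Tendsto (fun n => u (n + 1) x) Filter.atTop (nhds (f x)) :=
      (hf x).comp (Filter.tendsto_add_atTop_nat 1)
    refine tendsto_nhds_unique ?_ h1
    rw [tendsto_iff_dist_tendsto_zero]
    refine squeeze_zero (fun _ => dist_nonneg) (fun n => ?_) hz
    rw [Real.dist_eq, hu]
    refine (abs_step_sub_le hc (hs n) hsym (hfu n) x).trans ?_
    exact div_le_self (by positivity) (by
      have : (0 : ℝ) ≤ 2 * (1 / (2 * n + 1)) := by positivity
      linarith)
  · refine TendstoUniformly.continuous (F := u) (p := Filter.atTop) ?_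
      (Filter.Eventually.frequently (.of_forall hcont))
    rw [Metric.tendstoUniformly_iff]
    intro e he
    filter_upwards [hz.eventually_lt_const he] with n hn x
    rw [dist_comm, Real.dist_eq]
    exact (hfu n x).trans_lt hn
  · intro x y hxy
    exact le_of_tendsto_of_tendsto' (hf x) (hf y) fun n => hmono n hxy

/-! ### Properties of the fixed point of `step`. -/

namespace IsProfile

variable {c : ℝ} {f : ℝ → ℝ}

theorem eq_stepFun (hc : 1 ≤ c) (hf : IsProfile c f) {x : ℝ} (hx : x ∈ Set.Icc (0 : ℝ) 1) :
    f x = stepFun c f x := by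
  rw [← unfold_of_mem (stepFun_one hc hf.symmetric) hx]
  exact (congrFun hf.step_eq x).symm

theorem map_mid (hc : 1 ≤ c) (hf : IsProfile c f) : f (mid c) = 1 / 2 := by
  have h0 := kap_lt_mid hc
  rw [hf.eq_stepFun hc ⟨by linarith [half_le_mid hc], (mid_lt_one hc).le⟩, stepFun,
    if_neg (not_le.2 h0), if_pos rfl]

theorem map_eq_half (hc : 1 ≤ c) (hf : IsProfile c f) {x : ℝ} (h : f x = 1 / 2) : x = mid c := by
  have h1 : kap c < x := by
    by_contra! hcon
    have := hf.symmetric.nonpos hcon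
    linarith
  have h2 : x ≤ 1 := by
    by_contra! hcon
    have := hf.symmetric.one_le hcon.le
    linarith
  rw [hf.eq_stepFun hc ⟨by linarith [kap_nonneg hc], h2⟩] at h
  rcases stepFun_cases hc hf.symmetric h2 with ⟨-, h3⟩ | ⟨h3, -⟩ | ⟨-, h3⟩
  · linarith [h3.2]
  · exact h3
  · linarith [h3.1]

theorem map_inv_aux (hc : 1 ≤ c) (hf : IsProfile c f) {x : ℝ} (h1 : kap c < x) (h2 : x ≤ 1)
    (h3 : x ≠ mid c) : f x = inv 1 (f (inv c x)) := by
  rw [hf.eq_stepFun hc ⟨by linarith [kap_nonneg hc], h2⟩, stepFun, if_neg (not_le.2 h1), if_neg h3]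

/-- The fixed point equation gives the relation on $(\kappa,1]$. The inversion is an involution that
maps the other points, except for its fixed point $\kappa$, into this interval. -/
theorem map_inv (hc : 1 ≤ c) (hf : IsProfile c f) {x : ℝ} (hx : x ≠ mid c) :
    f (inv c x) = inv 1 (f x) := by
  have hm : mid 1 = 1 / 2 := by norm_num [mid]
  have key : ∀ {x}, kap c < x → x ≤ 1 → x ≠ mid c → f (inv c x) = inv 1 (f x) := by
    intro x h1 h2 h3
    rw [hf.map_inv_aux hc h1 h2 h3, inv_inv le_rfl]
    intro h
    exact inv_ne_mid hc h3 (hf.map_eq_half hc (h.trans hm))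
  have key' : kap c < inv c x → inv c x ≤ 1 → f (inv c x) = inv 1 (f x) := by
    intro h1 h2
    rw [hf.map_inv_aux hc h1 h2 (inv_ne_mid hc hx), inv_inv hc hx]
  rcases le_or_gt x (kap c) with h1 | h1
  · have h2 := kap_lt_mid hc
    have h3 := inv_anti hc h1 (.inl h2)
    rw [inv_kap hc] at h3
    have h4 : inv c x < mid c := by
      have := inv_sub_mul hc hx
      have hp : 0 < (1 / (c + 1)) ^ 2 := pow_pos (div_pos one_pos (by linarith)) 2
      by_contra! hcon
      nlinarith
    rcases h3.eq_or_lt with h5 | h5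
    · have : x = kap c := by rw [← inv_inv hc hx, ← h5, inv_kap hc]
      rw [this, inv_kap hc, hf.symmetric.vanish _ ⟨kap_nonneg hc, le_rfl⟩]
      norm_num [inv, mid]
    · exact key' h5 (by linarith [mid_lt_one hc])
  · rcases le_or_gt x 1 with h2 | h2
    · exact key h1 h2 hx
    · have h3 := inv_anti hc h2.le (.inr (mid_lt_one hc))
      rw [inv_one hc] at h3
      have h4 : mid c < inv c x := by
        have := inv_sub_mul hc hx
        have hp : 0 < (1 / (c + 1)) ^ 2 := pow_pos (div_pos one_pos (by linarith)) 2
        have := mid_lt_one hc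
        by_contra! hcon
        nlinarith
      exact key' (by linarith [kap_lt_mid hc]) h3

/-- The map $x\mapsto2-$`inv c x` is parabolic at 1: in the coordinate $1/(1-x)$ it is the
translation by $-(c+1)$. It preserves the property `f x = 1` and, for points with this property, the
condition $x<1$, so this positive coordinate cannot decrease forever. Points $x>1$ are reflected. -/
theorem map_eq_one (hc : 1 ≤ c) (hf : IsProfile c f) {x : ℝ} (h : f x = 1) : x = 1 := by
  have key : ∀ n : ℕ, ∀ x, x < 1 → f x = 1 → 1 / (1 - x) ≤ n → False := by
    intro n
    induction n with
    | zero =>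
      intro x hx _ hn
      have : 0 < 1 / (1 - x) := div_pos one_pos (by linarith)
      push_cast at hn
      linarith
    | succ n ih =>
      intro x hx h hn
      have h1 : kap c < x := by
        by_contra! hcon
        have := hf.symmetric.nonpos hcon
        linarith
      have h2 : x ≠ mid c := by rintro rfl; rw [hf.map_mid hc] at h; norm_num at h
      have h3 := hf.map_inv hc h2
      rw [h, inv_one le_rfl] at h3
      rcases hf.symmetric.inv_cases hc h1.le hx.le h2 with ⟨_, h4⟩ | ⟨h4, -⟩
      · linarith
      have h5 : inv c x - 1 = (1 - x) / ((c + 1) * (x - mid c)) := by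
        have e1 : c + 1 ≠ 0 := by linarith
        have e2 : x - mid c ≠ 0 := (sub_pos.2 h4).ne'
        have e3 : mid c = 1 - 1 / (c + 1) := by linarith [one_sub_mid hc]
        have e4 : (c + 1) * (x - mid c) = (c + 1) * x - c := by rw [e3]; field_simp; ring
        have e5 : inv c x = mid c + 1 / ((c + 1) * ((c + 1) * (x - mid c))) := by
          unfold inv; rw [← mul_assoc, sq]
        have e6 : (c + 1) * x - c ≠ 0 := by rw [← e4]; exact mul_ne_zero e1 e2
        rw [e5, e4, e3]
        field_simp
        ring
      have h6 : 0 < (c + 1) * (x - mid c) := mul_pos (by linarith) (by linarith)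
      have h7 : 0 < inv c x - 1 := by rw [h5]; exact div_pos (by linarith) h6
      refine ih (2 - inv c x) (by linarith) (by rw [hf.symmetric.flip, h3]; norm_num) ?_
      have e3 : (c + 1) * (x - mid c) = (c + 1) * x - c := by
        have e1 : c + 1 ≠ 0 := by linarith
        unfold mid; field_simp
      rw [show 1 - (2 - inv c x) = inv c x - 1 by ring, h5, one_div_div, e3]
      have e4 : ((c + 1) * x - c) / (1 - x) = 1 / (1 - x) - (c + 1) := by
        have : 1 - x ≠ 0 := by linarith
        field_simp
        ring
      rw [e4]
      push_cast at hn
      linarith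
  by_contra hne
  rcases lt_or_gt_of_ne hne with hlt | hgt
  · obtain ⟨n, hn⟩ := exists_nat_ge (1 / (1 - x))
    exact key n x hlt h hn
  · obtain ⟨n, hn⟩ := exists_nat_ge (1 / (1 - (2 - x)))
    exact key n (2 - x) (by linarith) (by rw [hf.symmetric.flip, h]; norm_num) hn

theorem surjective (hf : IsProfile c f) (hcont : Continuous f) : Function.Surjective f := by
  intro y
  have h1 := abs_le.1 (hf.symmetric.abs_sub_self (y - 1))
  have h2 := abs_le.1 (hf.symmetric.abs_sub_self (y + 1))
  obtain ⟨x, -, hx⟩ := intermediate_value_Icc (show y - 1 ≤ y + 1 by linarith) hcont.continuousOn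
    (show y ∈ Set.Icc (f (y - 1)) (f (y + 1)) from ⟨by linarith [h1.1], by linarith [h2.2]⟩)
  exact ⟨x, hx⟩

end IsProfile

/-! ### Directions in the affine chart -/

/-- The direction of the vector `(x, 1)`. -/
noncomputable def aff (x : ℝ) : RP1 := Projectivization.mk ℝ ![x, 1] (by simp)

theorem mk_eq_mk {u v : Plane} {hu : u ≠ 0} {hv : v ≠ 0} {r : ℝ} (h : r • v = u) :
    Projectivization.mk ℝ u hu = Projectivization.mk ℝ v hv :=
  (Projectivization.mk_eq_mk_iff' ..).2 ⟨r, h⟩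

theorem mk_eq_aff {v : Plane} (hv : v ≠ 0) (h : v 1 ≠ 0) :
    Projectivization.mk ℝ v hv = aff (v 0 / v 1) := by
  refine mk_eq_mk (r := v 1) (plane_ext ?_ ?_)
  · simp; field_simp
  · simp

theorem mk_eq_horizontal {v : Plane} (hv : v ≠ 0) (h : v 1 = 0) :
    Projectivization.mk ℝ v hv = horizontal := by
  refine mk_eq_mk (r := v 0) (plane_ext ?_ ?_)
  · simp
  · simp [h]

theorem eq_horizontal_or_aff (θ : RP1) : θ = horizontal ∨ ∃ x, θ = aff x := by
  induction θ using Projectivization.ind with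
  | h v hv =>
    by_cases h : v 1 = 0
    · exact .inl (mk_eq_horizontal hv h)
    · exact .inr ⟨_, mk_eq_aff hv h⟩

theorem aff_injective : Function.Injective aff := by
  intro x y h
  obtain ⟨r, hr⟩ := (Projectivization.mk_eq_mk_iff' ..).1 h
  have h0 := congrFun hr 0
  have h1 := congrFun hr 1
  simp at h0 h1
  rw [← h0, h1, one_mul]

theorem aff_ne_horizontal (x : ℝ) : aff x ≠ horizontal := by
  intro h
  obtain ⟨r, hr⟩ := (Projectivization.mk_eq_mk_iff' ..).1 h
  have h1 := congrFun hr 1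
  simp at h1

theorem aff_one : aff 1 = slopeOne := rfl

theorem smul_mk_eq {G : GL (Fin 2) ℝ} {u v : Plane} {hu : u ≠ 0} {hv : v ≠ 0} {r : ℝ}
    (h : r • v = (G : Matrix (Fin 2) (Fin 2) ℝ).mulVec u) :
    G • Projectivization.mk ℝ u hu = Projectivization.mk ℝ v hv := by
  rw [Projectivization.smul_mk]
  exact mk_eq_mk h

theorem genMat_A_aff (c x : ℝ) : genMat c Gen.A • aff x = aff (-x) := by
  refine smul_mk_eq (r := 1) (plane_ext ?_ ?_) <;>
    simp [genMat, matA, Matrix.GeneralLinearGroup.mkOfDetNeZero, Matrix.mulVec, dotProduct,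
      Fin.sum_univ_two]

theorem genMat_A_horizontal (c : ℝ) : genMat c Gen.A • horizontal = horizontal := by
  refine smul_mk_eq (r := -1) (plane_ext ?_ ?_) <;>
    simp [genMat, matA, Matrix.GeneralLinearGroup.mkOfDetNeZero, Matrix.mulVec, dotProduct,
      Fin.sum_univ_two]

theorem genMat_B_aff (c x : ℝ) : genMat c Gen.B • aff x = aff (2 - x) := by
  refine smul_mk_eq (r := 1) (plane_ext ?_ ?_) <;>
    simp [genMat, matB, Matrix.GeneralLinearGroup.mkOfDetNeZero, Matrix.mulVec, dotProduct,
      Fin.sum_univ_two]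
  ring

theorem genMat_B_horizontal (c : ℝ) : genMat c Gen.B • horizontal = horizontal := by
  refine smul_mk_eq (r := -1) (plane_ext ?_ ?_) <;>
    simp [genMat, matB, Matrix.GeneralLinearGroup.mkOfDetNeZero, Matrix.mulVec, dotProduct,
      Fin.sum_univ_two]

theorem genMat_C_aff {c : ℝ} (hc : 1 ≤ c) {x : ℝ} (hx : x ≠ mid c) :
    genMat c Gen.C • aff x = aff (inv c x) := by
  have h1 : c + 1 ≠ 0 := by linarith
  have h2 : x - mid c ≠ 0 := sub_ne_zero.2 hx
  have h3 : (c + 1) * (x - mid c) = (c + 1) * x - c := by unfold mid; field_simp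
  have h4 : (c + 1) * x - c ≠ 0 := by rw [← h3]; exact mul_ne_zero h1 h2
  have h5 : inv c x = c / (c + 1) + 1 / ((c + 1) * ((c + 1) * x - c)) := by
    rw [← h3]; unfold inv mid; rw [← mul_assoc, sq]
  refine smul_mk_eq (r := c - (c + 1) * x) (plane_ext ?_ ?_)
  · rw [h5]
    simp [genMat, matC, Matrix.GeneralLinearGroup.mkOfDetNeZero, Matrix.mulVec, dotProduct,
      Fin.sum_univ_two]
    field_simp
    ring
  · simp [genMat, matC, Matrix.GeneralLinearGroup.mkOfDetNeZero, Matrix.mulVec, dotProduct,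
      Fin.sum_univ_two]
    ring

theorem genMat_C_mid {c : ℝ} (hc : 1 ≤ c) : genMat c Gen.C • aff (mid c) = horizontal := by
  have h1 : c + 1 ≠ 0 := by linarith
  refine smul_mk_eq (r := -1 / (c + 1)) (plane_ext ?_ ?_) <;>
    simp [genMat, matC, Matrix.GeneralLinearGroup.mkOfDetNeZero, Matrix.mulVec, dotProduct,
      Fin.sum_univ_two, mid] <;> field_simp <;> ring

theorem genMat_C_horizontal {c : ℝ} (hc : 1 ≤ c) : genMat c Gen.C • horizontal = aff (mid c) := by
  have h1 : c + 1 ≠ 0 := by linarith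
  refine smul_mk_eq (r := -(c + 1)) (plane_ext ?_ ?_) <;>
    simp [genMat, matC, Matrix.GeneralLinearGroup.mkOfDetNeZero, Matrix.mulVec, dotProduct,
      Fin.sum_univ_two, mid] <;> field_simp <;> ring

theorem neg_one_smul_RP1 (θ : RP1) : (-1 : GL (Fin 2) ℝ) • θ = θ := by
  induction θ using Projectivization.ind with
  | h v hv =>
    refine smul_mk_eq (r := -1) ?_
    simp [Matrix.neg_mulVec]

theorem rep_of (c : ℝ) (x : Gen) : rep c (PresentedGroup.of x) = genMat c x :=
  PresentedGroup.toGroup.of (genMat_rel c)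

/-- Equivariance has to be checked for the generators only. -/
theorem semiconj_of_gen {c : ℝ} {φ : RP1 → RP1}
    (h : ∀ x θ, φ (genMat c x • θ) = genMat 1 x • φ θ) (G : AbsGroup) (θ : RP1) :
    φ (rep c G • θ) = rep 1 G • φ θ := by
  induction G using PresentedGroup.induction_on with
  | _ w =>
    induction w using FreeGroup.induction_on generalizing θ with
    | C1 => simp
    | of x =>
      have := h x θ
      rw [← rep_of, ← rep_of] at this
      exact this
    | inv_of x ih =>
      have := ih ((rep c (PresentedGroup.mk _ (FreeGroup.of x)))⁻¹ • θ)
      rw [smul_inv_smul] at this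
      rw [map_inv, _root_.map_inv, _root_.map_inv, this, inv_smul_smul]
    | mul w w' ih ih' =>
      simp only [map_mul, mul_smul]
      rw [ih, ih']

/-! ### Directions and angles -/

theorem dir_eq_dir_iff {s t : ℝ} : dir s = dir t ↔ ∃ n : ℤ, s = t + n * Real.pi := by
  constructor
  · intro h
    obtain ⟨r, hr⟩ := (Projectivization.mk_eq_mk_iff' ..).1 h
    have h0 := congrFun hr 0
    have h1 := congrFun hr 1
    simp only [Pi.smul_apply, Matrix.cons_val_zero, Matrix.cons_val_one, smul_eq_mul] at h0 h1
    have : Real.sin (s - t) = 0 := by rw [Real.sin_sub, ← h0, ← h1]; ring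
    obtain ⟨n, hn⟩ := Real.sin_eq_zero_iff.1 this
    exact ⟨n, by linarith⟩
  · rintro ⟨n, rfl⟩
    refine mk_eq_mk (r := (-1) ^ n) (plane_ext ?_ ?_)
    · simp [Real.cos_add_int_mul_pi]
    · simp [Real.sin_add_int_mul_pi]

theorem dir_zero : dir 0 = horizontal := mk_eq_horizontal _ (by simp)

theorem dir_angle (x : ℝ) : dir (Real.pi / 2 - Real.arctan x) = aff x := by
  have h1 : Real.cos (Real.arctan x) ≠ 0 := (Real.cos_arctan_pos x).ne'
  rw [dir, mk_eq_aff _ (by simpa [Real.sin_pi_div_two_sub] using h1)]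
  congr 1
  simp only [Matrix.cons_val_zero, Matrix.cons_val_one, Real.sin_pi_div_two_sub,
    Real.cos_pi_div_two_sub]
  rw [← Real.tan_eq_sin_div_cos, Real.tan_arctan]

/-- The angle of the direction `aff x`. -/
noncomputable def angle (x : ℝ) : ℝ := Real.pi / 2 - Real.arctan x

theorem angle_mem (x : ℝ) : angle x ∈ Set.Ioo 0 Real.pi := by
  have h1 := Real.neg_pi_div_two_lt_arctan x
  have h2 := Real.arctan_lt_pi_div_two x
  unfold angle
  constructor <;> linarith

theorem angle_anti {x y : ℝ} (h : x < y) : angle y < angle x := by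
  have := Real.arctan_strictMono h
  unfold angle; linarith

theorem dir_angle' (x : ℝ) : dir (angle x) = aff x := dir_angle x

theorem angle_tan {s : ℝ} (hs : s ∈ Set.Ioo 0 Real.pi) :
    angle (Real.tan (Real.pi / 2 - s)) = s := by
  rw [angle, Real.arctan_tan (by linarith [hs.2]) (by linarith [hs.1])]; ring

theorem continuous_mk : Continuous fun v : {v : Plane // v ≠ 0} => Projectivization.mk ℝ v.1 v.2 :=
  continuous_quot_mk

theorem continuous_dir : Continuous dir := by
  have h : Continuous fun t : ℝ => (⟨![Real.cos t, Real.sin t], by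
      intro h
      have h0 := congrFun h 0
      have h1 := congrFun h 1
      simp at h0 h1
      nlinarith [Real.sin_sq_add_cos_sq t]⟩ : {v : Plane // v ≠ 0}) := by
    refine Continuous.subtype_mk (continuous_pi fun i => ?_) _
    fin_cases i
    · exact Real.continuous_cos
    · exact Real.continuous_sin
  exact continuous_mk.comp h

theorem mk_eq_dir_arg {v : Plane} (hv : v ≠ 0) :
    Projectivization.mk ℝ v hv = dir (Complex.arg ⟨v 0, v 1⟩) := by
  refine mk_eq_mk (r := ‖(⟨v 0, v 1⟩ : ℂ)‖) (plane_ext ?_ ?_)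
  · simp
  · simp

/-- A map of the projective line that has a continuous lift is continuous. -/
theorem continuous_of_lift {φ : RP1 → RP1} {F : ℝ → ℝ} (hF : Continuous F)
    (h : ∀ t, φ (dir t) = dir (F t)) : Continuous φ := by
  refine continuous_coinduced_dom.2 (continuous_iff_continuousAt.2 fun v => ?_)
  show ContinuousAt (fun w : {v : Plane // v ≠ 0} => φ (Projectivization.mk ℝ w.1 w.2)) v
  let z : {v : Plane // v ≠ 0} → ℂ := fun w => ⟨w.1 0, w.1 1⟩
  have hz : Continuous z := by
    have : z = fun w => ((w.1 0 : ℝ) : ℂ) + ((w.1 1 : ℝ) : ℂ) * Complex.I := by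
      funext w; exact (Complex.mk_eq_add_mul_I _ _)
    rw [this]
    have h0 : ∀ i, Continuous fun w : {v : Plane // v ≠ 0} => w.1 i := fun i =>
      (continuous_apply i).comp continuous_subtype_val
    exact (Complex.continuous_ofReal.comp (h0 0)).add
      ((Complex.continuous_ofReal.comp (h0 1)).mul continuous_const)
  have hne : z v ≠ 0 := by
    intro h0
    apply v.2
    exact plane_ext (congrArg Complex.re h0) (congrArg Complex.im h0)
  -- The argument of the vector or of its negative is continuous nearby and gives a local section of
  -- `dir`.
  rcases Complex.mem_slitPlane_or_neg_mem_slitPlane hne with h1 | h1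
  · have : (fun w : {v : Plane // v ≠ 0} => φ (Projectivization.mk ℝ w.1 w.2)) =
        fun w => dir (F (Complex.arg (z w))) := by
      funext w; rw [mk_eq_dir_arg, h]
    rw [this]
    exact (continuous_dir.comp hF).continuousAt.comp
      ((Complex.continuousAt_arg h1).comp hz.continuousAt)
  · have : (fun w : {v : Plane // v ≠ 0} => φ (Projectivization.mk ℝ w.1 w.2)) =
        fun w => dir (F (Complex.arg (-z w))) := by
      funext w
      rw [← h, show -z w = ⟨(-w.1) 0, (-w.1) 1⟩ from rfl, ← mk_eq_dir_arg (neg_ne_zero.2 w.2)]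
      congr 1
      exact mk_eq_mk (r := -1) (by simp)
    rw [this]
    exact (continuous_dir.comp hF).continuousAt.comp
      (ContinuousAt.comp (g := Complex.arg) (f := fun w => -z w) (Complex.continuousAt_arg h1)
        hz.neg.continuousAt)

/-! ### Orientation -/

theorem PosOriented.rotate {a b d : RP1} (h : PosOriented a b d) : PosOriented b d a := by
  obtain ⟨α, β, δ, h1, h2, h3, rfl, rfl, rfl⟩ := h
  refine ⟨β, δ, α + Real.pi, h2, h3, by linarith, rfl, rfl, ?_⟩
  exact dir_eq_dir_iff.2 ⟨1, by simp⟩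

/-- The angle decreases with the chart coordinate, so counterclockwise order is decreasing order in
the chart. -/
theorem posOriented_aff {x y z : ℝ} (h1 : y < x) (h2 : z < y) :
    PosOriented (aff x) (aff y) (aff z) :=
  ⟨angle x, angle y, angle z, angle_anti h1, angle_anti h2,
    by linarith [(angle_mem x).1, (angle_mem z).2], dir_angle' x, dir_angle' y, dir_angle' z⟩

theorem posOriented_horizontal {x y : ℝ} (h : y < x) :
    PosOriented horizontal (aff x) (aff y) :=
  ⟨0, angle x, angle y, (angle_mem x).1, angle_anti h, by linarith [(angle_mem y).2], dir_zero,
    dir_angle' x, dir_angle' y⟩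

/-- A map with a monotone lift weakly preserves the orientation. -/
theorem not_posOriented_of_lift {φ : RP1 → RP1} {F : ℝ → ℝ} (hF : Monotone F)
    (hF' : ∀ t, F (t + Real.pi) = F t + Real.pi) (h : ∀ t, φ (dir t) = dir (F t)) {a b d : RP1}
    (ho : PosOriented a b d) : ¬ PosOriented (φ d) (φ b) (φ a) := by
  rintro ⟨δ', β', α', h4, h5, h6, e1, e2, e3⟩
  obtain ⟨α, β, δ, h1, h2, h3, rfl, rfl, rfl⟩ := ho
  rw [h, dir_eq_dir_iff] at e1 e2 e3
  obtain ⟨k, rfl⟩ := e1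
  obtain ⟨l, rfl⟩ := e2
  obtain ⟨m, rfl⟩ := e3
  have g1 := hF h1.le
  have g2 := hF h2.le
  have g3 := hF h3.le
  rw [hF'] at g3
  have hpi := Real.pi_pos
  -- Monotonicity of the lift reduces a reversed triple to integers with `k < l < m < k + 2`.
  have i1 : (k : ℝ) < l := by
    have : (k : ℝ) * Real.pi < l * Real.pi := by linarith
    exact lt_of_mul_lt_mul_right this hpi.le
  have i2 : (l : ℝ) < m := by
    have : (l : ℝ) * Real.pi < m * Real.pi := by linarith
    exact lt_of_mul_lt_mul_right this hpi.le
  have i3 : (m : ℝ) < k + 2 := by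
    have : (m : ℝ) * Real.pi < (k + 2) * Real.pi := by linarith
    exact lt_of_mul_lt_mul_right this hpi.le
  have j1 : k < l := by exact_mod_cast i1
  have j2 : l < m := by exact_mod_cast i2
  have j3 : m < k + 2 := by exact_mod_cast i3
  omega

/-! ### The semiconjugacy -/

/-- The map of the projective line that is given by `f` in the affine chart. -/
noncomputable def profileMap (f : ℝ → ℝ) : RP1 → RP1 :=
  Projectivization.lift (fun v => if v.1 1 = 0 then horizontal else aff (f (v.1 0 / v.1 1))) (by
    intro a b t h
    have ht : t ≠ 0 := by rintro rfl; exact a.2 (by simp [h])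
    simp only [h, Pi.smul_apply, smul_eq_mul, mul_eq_zero, ht, false_or]
    rw [mul_div_mul_left _ _ ht])

theorem profileMap_horizontal (f : ℝ → ℝ) : profileMap f horizontal = horizontal := by
  rw [horizontal, profileMap, Projectivization.lift_mk]
  simp [horizontal]

theorem profileMap_aff (f : ℝ → ℝ) (x : ℝ) : profileMap f (aff x) = aff (f x) := by
  rw [aff, profileMap, Projectivization.lift_mk]
  simp [aff]

/-- The restriction to `[0, π)` of the lift of `profileMap f` -/
noncomputable def liftFun (f : ℝ → ℝ) (s : ℝ) : ℝ :=
  if s = 0 then 0 else angle (f (Real.tan (Real.pi / 2 - s)))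

/-- The lift of `profileMap f`. -/
noncomputable def lift (f : ℝ → ℝ) (t : ℝ) : ℝ :=
  ⌊t / Real.pi⌋ * Real.pi + liftFun f (t - ⌊t / Real.pi⌋ * Real.pi)

section lift

variable {f : ℝ → ℝ}

theorem sub_floor_mem (t : ℝ) : t - ⌊t / Real.pi⌋ * Real.pi ∈ Set.Ico 0 Real.pi := by
  have hpi := Real.pi_pos
  have h1 := Int.floor_le (t / Real.pi)
  have h2 := Int.lt_floor_add_one (t / Real.pi)
  rw [le_div_iff₀ hpi] at h1
  rw [div_lt_iff₀ hpi] at h2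
  constructor <;> linarith

theorem liftFun_mem (s : ℝ) : liftFun f s ∈ Set.Ico 0 Real.pi := by
  unfold liftFun
  split_ifs
  · exact ⟨le_rfl, Real.pi_pos⟩
  · exact Set.Ioo_subset_Ico_self (angle_mem _)

theorem lift_add_pi (t : ℝ) : lift f (t + Real.pi) = lift f t + Real.pi := by
  have : ⌊(t + Real.pi) / Real.pi⌋ = ⌊t / Real.pi⌋ + 1 := by
    rw [add_div, div_self Real.pi_ne_zero, Int.floor_add_one]
  unfold lift
  rw [this]
  push_cast
  rw [show t + Real.pi - (⌊t / Real.pi⌋ + 1) * Real.pi = t - ⌊t / Real.pi⌋ * Real.pi by ring]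
  ring

theorem monotone_lift (hf : Monotone f) : Monotone (lift f) := by
  intro x y hxy
  have hpi := Real.pi_pos
  have hx := sub_floor_mem x
  have hy := sub_floor_mem y
  have mx := liftFun_mem (f := f) (x - ⌊x / Real.pi⌋ * Real.pi)
  have my := liftFun_mem (f := f) (y - ⌊y / Real.pi⌋ * Real.pi)
  have hle : ⌊x / Real.pi⌋ ≤ ⌊y / Real.pi⌋ :=
    Int.floor_mono (div_le_div_of_nonneg_right hxy hpi.le)
  unfold lift
  rcases hle.eq_or_lt with h | h
  · rw [← h] at hy my ⊢
    set s := x - ⌊x / Real.pi⌋ * Real.pi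
    set t := y - ⌊x / Real.pi⌋ * Real.pi
    have hst : s ≤ t := by simp only [s, t]; linarith
    have : liftFun f s ≤ liftFun f t := by
      by_cases h1 : s = 0
      · rw [liftFun, if_pos h1]; exact my.1
      · have hs0 : 0 < s := lt_of_le_of_ne hx.1 (Ne.symm h1)
        rw [liftFun, if_neg h1, liftFun, if_neg (by linarith)]
        unfold angle
        have h2 := Real.strictMonoOn_tan.monotoneOn (a := Real.pi / 2 - t) (b := Real.pi / 2 - s)
          ⟨by linarith [hy.2], by linarith⟩ ⟨by linarith [hx.2], by linarith⟩ (by linarith)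
        have := Real.arctan_strictMono.monotone (hf h2)
        linarith
    linarith
  · have h1 : (⌊x / Real.pi⌋ : ℝ) + 1 ≤ ⌊y / Real.pi⌋ := by exact_mod_cast h
    nlinarith [mx.2, my.1]

theorem floor_add {k : ℤ} {s : ℝ} (hs : s ∈ Set.Ico 0 Real.pi) :
    ⌊(k * Real.pi + s) / Real.pi⌋ = k := by
  have hpi := Real.pi_pos
  rw [Int.floor_eq_iff, le_div_iff₀ hpi, div_lt_iff₀ hpi]
  constructor <;> linarith [hs.1, hs.2]

theorem lift_eq {k : ℤ} {s : ℝ} (hs : s ∈ Set.Ico 0 Real.pi) :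
    lift f (k * Real.pi + s) = k * Real.pi + liftFun f s := by
  rw [lift, floor_add hs, add_sub_cancel_left]

theorem surjective_lift (hf : Function.Surjective f) : Function.Surjective (lift f) := by
  intro y
  have hy := sub_floor_mem y
  set k := ⌊y / Real.pi⌋
  set s := y - k * Real.pi with hs
  rcases hy.1.eq_or_lt with h | h
  · refine ⟨k * Real.pi + 0, ?_⟩
    rw [lift_eq ⟨le_rfl, Real.pi_pos⟩, liftFun, if_pos rfl]
    linarith
  · obtain ⟨x, hx⟩ := hf (Real.tan (Real.pi / 2 - s))
    refine ⟨k * Real.pi + angle x, ?_⟩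
    rw [lift_eq (Set.Ioo_subset_Ico_self (angle_mem x)), liftFun, if_neg (angle_mem x).1.ne']
    have : Real.tan (Real.pi / 2 - angle x) = x := by
      rw [angle, sub_sub_cancel, Real.tan_arctan]
    rw [this, hx, angle_tan ⟨h, hy.2⟩]
    linarith

theorem profileMap_dir (t : ℝ) : profileMap f (dir t) = dir (lift f t) := by
  have ht := sub_floor_mem t
  obtain ⟨k, hk⟩ : ∃ k, k = ⌊t / Real.pi⌋ := ⟨_, rfl⟩
  rw [← hk] at ht
  clear hk
  obtain ⟨s, hs⟩ : ∃ s, s = t - k * Real.pi := ⟨_, rfl⟩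
  rw [← hs] at ht
  obtain rfl : t = k * Real.pi + s := by linarith
  rw [lift_eq ht, dir_eq_dir_iff.2 ⟨k, add_comm _ _⟩,
    (dir_eq_dir_iff.2 ⟨k, add_comm _ _⟩ : dir (k * Real.pi + liftFun f s) = dir (liftFun f s))]
  rcases ht.1.eq_or_lt with rfl | h
  · rw [liftFun, if_pos rfl, dir_zero, profileMap_horizontal]
  · rw [liftFun, if_neg h.ne', dir_angle', ← profileMap_aff, ← dir_angle', angle_tan ⟨h, ht.2⟩]

end lift

theorem isSemiconjugacy_profileMap {c : ℝ} (hc : 1 ≤ c) {f : ℝ → ℝ} (hf : IsProfile c f)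
    (hcont : Continuous f) (hm : Monotone f) : IsSemiconjugacy c (profileMap f) := by
  -- A monotone surjection of the line is continuous, so the seams of the piecewise lift need no
  -- check.
  have hF := (monotone_lift hm).continuous_of_surjective
    (surjective_lift (hf.surjective hcont))
  refine ⟨continuous_of_lift hF profileMap_dir, fun θ => ?_,
    ⟨lift f, hF, lift_add_pi, profileMap_dir⟩, semiconj_of_gen ?_,
    fun a b d h => not_posOriented_of_lift (monotone_lift hm) lift_add_pi profileMap_dir h⟩
  · rcases eq_horizontal_or_aff θ with rfl | ⟨y, rfl⟩
    · exact ⟨_, profileMap_horizontal f⟩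
    · obtain ⟨x, rfl⟩ := hf.surjective hcont y
      exact ⟨_, profileMap_aff f x⟩
  · have hm1 : mid 1 = 1 / 2 := by norm_num [mid]
    intro g θ
    rcases eq_horizontal_or_aff θ with rfl | ⟨x, rfl⟩
    · cases g
      · simp only [genMat_A_horizontal, profileMap_horizontal]
      · simp only [genMat_B_horizontal, profileMap_horizontal]
      · rw [genMat_C_horizontal hc, profileMap_horizontal, profileMap_aff,
          genMat_C_horizontal le_rfl, hf.map_mid hc, hm1]
      · simp only [genMat, neg_one_smul_RP1]
    · cases g
      · rw [genMat_A_aff, profileMap_aff, profileMap_aff, genMat_A_aff, hf.symmetric.neg]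
      · rw [genMat_B_aff, profileMap_aff, profileMap_aff, genMat_B_aff, hf.symmetric.flip]
      · by_cases hx : x = mid c
        · rw [hx, genMat_C_mid hc, profileMap_horizontal, profileMap_aff, hf.map_mid hc, ← hm1,
            genMat_C_mid le_rfl]
        · rw [genMat_C_aff hc hx, profileMap_aff, profileMap_aff, genMat_C_aff le_rfl,
            hf.map_inv hc hx]
          rw [hm1]
          exact fun h => hx (hf.map_eq_half hc h)
      · simp only [genMat, neg_one_smul_RP1]

/-! ### Every semiconjugacy comes from a profile. -/

namespace IsSemiconjugacy

variable {c : ℝ} {φ : RP1 → RP1}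

theorem gen (h : IsSemiconjugacy c φ) (g : Gen) (θ : RP1) :
    φ (genMat c g • θ) = genMat 1 g • φ θ := by
  have := h.semiconj (PresentedGroup.of g) θ
  rwa [rep_of, rep_of] at this

/-- The horizontal direction is the only common fixed point of $A_1$ and $B_1$, whose fixed points
in the chart are 0 and 1, respectively. In the same way, slope one is the common fixed point of
$B_1$ and $C_1$. -/
theorem map_horizontal (h : IsSemiconjugacy c φ) : φ horizontal = horizontal := by
  have hA := h.gen Gen.A horizontal
  have hB := h.gen Gen.B horizontal
  rw [genMat_A_horizontal] at hA
  rw [genMat_B_horizontal] at hB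
  rcases eq_horizontal_or_aff (φ horizontal) with e | ⟨x, e⟩
  · exact e
  · rw [e, genMat_A_aff] at hA
    rw [e, genMat_B_aff] at hB
    have h1 := aff_injective hA
    have h2 := aff_injective hB
    linarith

theorem map_aff_one (hc : 1 ≤ c) (h : IsSemiconjugacy c φ) : φ (aff 1) = aff 1 := by
  have hB := h.gen Gen.B (aff 1)
  have hC := h.gen Gen.C (aff 1)
  rw [genMat_B_aff] at hB
  rw [genMat_C_aff hc (mid_lt_one hc).ne', inv_one hc] at hC
  rcases eq_horizontal_or_aff (φ (aff 1)) with e | ⟨x, e⟩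
  · rw [e, genMat_C_horizontal le_rfl] at hC
    exact absurd hC.symm (aff_ne_horizontal _)
  · norm_num at hB
    rw [e, genMat_B_aff] at hB
    have := aff_injective hB
    rw [e]
    congr 1
    linarith

theorem map_aff_neg (h : IsSemiconjugacy c φ) {x y : ℝ} (hx : φ (aff x) = aff y) :
    φ (aff (-x)) = aff (-y) := by
  rw [← genMat_A_aff c, h.gen, hx, genMat_A_aff]

theorem map_aff_flip (h : IsSemiconjugacy c φ) {x y : ℝ} (hx : φ (aff x) = aff y) :
    φ (aff (2 - x)) = aff (2 - y) := by
  rw [← genMat_B_aff c, h.gen, hx, genMat_B_aff]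

theorem map_aff_odd (hc : 1 ≤ c) (h : IsSemiconjugacy c φ) (n : ℕ) :
    φ (aff (2 * n + 1)) = aff (2 * n + 1) := by
  induction n with
  | zero => simpa using h.map_aff_one hc
  | succ n ih =>
    have := h.map_aff_flip (h.map_aff_neg ih)
    push_cast
    rwa [show 2 - -(2 * (n : ℝ) + 1) = 2 * (n + 1) + 1 by ring] at this

/-- The odd integers in the chart are fixed by `φ`. If a finite `x` went to infinity, a positive
triple `2n + 1`, `x`, `-(2n + 1)` would become a negative one. -/
theorem eq_horizontal (hc : 1 ≤ c) (h : IsSemiconjugacy c φ) {θ : RP1} (hθ : φ θ = horizontal) :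
    θ = horizontal := by
  rcases eq_horizontal_or_aff θ with e | ⟨x, rfl⟩
  · exact e
  · exfalso
    obtain ⟨n, hn⟩ := exists_nat_ge |x|
    have h1 := le_abs_self x
    have h2 := neg_abs_le x
    have h3 : 0 ≤ |x| := abs_nonneg x
    refine h.weakly_monotone _ _ _ (posOriented_aff (x := 2 * n + 1) (y := x)
      (z := -(2 * n + 1)) (by linarith) (by linarith)) ?_
    rw [hθ, h.map_aff_odd hc, h.map_aff_neg (h.map_aff_odd hc n)]
    exact (posOriented_horizontal (by linarith)).rotate.rotate

theorem exists_fun (hc : 1 ≤ c) (h : IsSemiconjugacy c φ) : ∃ f : ℝ → ℝ, φ = profileMap f := by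
  have : ∀ x, ∃ y, φ (aff x) = aff y := by
    intro x
    rcases eq_horizontal_or_aff (φ (aff x)) with e | e
    · exact absurd (h.eq_horizontal hc e) (aff_ne_horizontal x)
    · exact e
  choose f hf using this
  refine ⟨f, funext fun θ => ?_⟩
  rcases eq_horizontal_or_aff θ with rfl | ⟨x, rfl⟩
  · rw [h.map_horizontal, profileMap_horizontal]
  · rw [hf, profileMap_aff]

theorem order {f : ℝ → ℝ} (h : IsSemiconjugacy c (profileMap f)) {x y z : ℝ} (hxy : y < x)
    (hyz : z < y) : ¬ (f y < f z ∧ f x < f y) ∧ ¬ (f x < f y ∧ f z < f x) ∧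
      ¬ (f z < f x ∧ f y < f z) := by
  have h1 := h.weakly_monotone _ _ _ (posOriented_aff hxy hyz)
  simp only [profileMap_aff] at h1
  refine ⟨fun h2 => h1 (posOriented_aff h2.1 h2.2), fun h2 => ?_, fun h2 => ?_⟩
  · exact h1 (posOriented_aff h2.1 h2.2).rotate.rotate
  · exact h1 (posOriented_aff h2.1 h2.2).rotate

/-- Equivariance yields the symmetries and the values at 0, `mid c` and 1, and orientation controls
`f` in between. In particular $f(\kappa)$ is a fixed point of `inv 1` that is at most $1/2$, hence
0. -/
theorem isProfile (hc : 1 ≤ c) {f : ℝ → ℝ} (h : IsSemiconjugacy c (profileMap f)) :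
    IsProfile c f := by
  have hm1 : mid 1 = 1 / 2 := by norm_num [mid]
  have hA : ∀ x, f (-x) = -f x := by
    intro x
    have := h.map_aff_neg (profileMap_aff f x)
    rw [profileMap_aff] at this
    exact aff_injective this
  have hB : ∀ x, f (2 - x) = 2 - f x := by
    intro x
    have := h.map_aff_flip (profileMap_aff f x)
    rw [profileMap_aff] at this
    exact aff_injective this
  have h0 : f 0 = 0 := by have := hA 0; rw [neg_zero] at this; linarith
  have h1 : f 1 = 1 := by have := hB 1; norm_num at this; linarith
  have hC : f (mid c) = 1 / 2 := by
    have := h.gen Gen.C horizontal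
    rw [genMat_C_horizontal hc, profileMap_horizontal, genMat_C_horizontal le_rfl,
      profileMap_aff, hm1] at this
    exact aff_injective this
  have hC' : ∀ x, x ≠ mid c → f x ≠ 1 / 2 ∧ f (inv c x) = inv 1 (f x) := by
    intro x hx
    have := h.gen Gen.C (aff x)
    rw [genMat_C_aff hc hx, profileMap_aff, profileMap_aff] at this
    have hne : f x ≠ mid 1 := by
      intro e
      rw [e, genMat_C_mid le_rfl] at this
      exact aff_ne_horizontal _ this
    rw [genMat_C_aff le_rfl hne] at this
    exact ⟨hm1 ▸ hne, aff_injective this⟩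
  have k0 := kap_nonneg hc
  have k1 := kap_lt_mid hc
  have k2 := mid_lt_one hc
  have hmem : ∀ x ∈ Set.Icc (0 : ℝ) 1, f x ∈ Set.Icc (0 : ℝ) 1 := by
    intro x hx
    rcases hx.1.eq_or_lt with rfl | h2
    · rw [h0]; norm_num
    rcases hx.2.eq_or_lt with rfl | h3
    · rw [h1]; norm_num
    obtain ⟨-, h4, h5⟩ := h.order h3 h2
    rw [h0, h1] at h4 h5
    constructor
    · by_contra! hcon
      exact h5 ⟨one_pos, hcon⟩
    · by_contra! hcon
      exact h4 ⟨hcon, one_pos⟩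
  have hhalf : ∀ x, 0 < x → x < mid c → f x ≤ 1 / 2 := by
    intro x hx hx'
    by_contra! hcon
    refine (h.order hx' hx).2.1 ⟨by rwa [hC], ?_⟩
    rw [h0, hC]; norm_num
  have hkap : f (kap c) = 0 := by
    rcases k0.eq_or_lt with e | e
    · rw [← e, h0]
    have e1 := (hC' (kap c) k1.ne).2
    have e2 := hhalf _ e k1
    have e3 := (hC' (kap c) k1.ne).1
    rw [inv_kap hc] at e1
    have e4 := inv_sub_mul (c := 1) le_rfl (x := f (kap c)) (by rwa [hm1])
    rw [← e1, hm1] at e4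
    have e5 : f (kap c) * (f (kap c) - 1) = 0 := by linarith
    rcases mul_eq_zero.1 e5 with e6 | e6
    · exact e6
    · linarith
  have hvan : ∀ x ∈ Set.Icc 0 (kap c), f x = 0 := by
    intro x hx
    rcases hx.1.eq_or_lt with rfl | h2
    · exact h0
    rcases hx.2.eq_or_lt with rfl | h3
    · exact hkap
    have h4 := hhalf x h2 (h3.trans k1)
    have h5 := (hmem x ⟨h2.le, by linarith⟩).1
    by_contra hne
    -- A positive value at `x` would reverse the orientation of the triple $1$, $\kappa$, $x$.
    refine (h.order (k1.trans k2) h3).2.2 ⟨?_, ?_⟩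
    · rw [h1]; linarith
    · rw [hkap]; exact lt_of_le_of_ne h5 (Ne.symm hne)
  have hsym : Symmetric c f := ⟨hA, hB, hmem, hvan⟩
  refine ⟨hsym, Eq.trans ?_ hsym.unfold_self⟩
  have hstep : ∀ x ∈ Set.Icc (0 : ℝ) 1, stepFun c f x = f x := by
    intro x hx
    rw [stepFun]
    split_ifs with h2 h3
    · exact (hvan x ⟨hx.1, h2⟩).symm
    · rw [h3, hC]
    · rw [← (hC' _ (inv_ne_mid hc h3)).2, inv_inv hc h3]
  funext x
  have hx := mem_Icc_floor x
  unfold step unfold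
  split_ifs
  · rw [hstep _ ⟨by linarith [hx.1], by linarith [hx.2]⟩]
  · rw [hstep _ ⟨by linarith [hx.2], by linarith [hx.1]⟩]

end IsSemiconjugacy

theorem existsUnique_isSemiconjugacy {c : ℝ} (hc : 1 ≤ c) :
    ∃! φ : RP1 → RP1, IsSemiconjugacy c φ := by
  obtain ⟨f, hf, hcont, hm⟩ := exists_isProfile hc
  refine ⟨profileMap f, isSemiconjugacy_profileMap hc hf hcont hm, fun φ hφ => ?_⟩
  obtain ⟨g, rfl⟩ := hφ.exists_fun hc
  rw [(hφ.isProfile hc).unique hc hf]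

/-! ### The directions of saddle connections -/

section

variable {c : ℝ} {u : Plane} (hu : u ≠ 0)

theorem genMat_A_mk (hu' : refl u ≠ 0) : genMat c Gen.A • Projectivization.mk ℝ u hu =
    Projectivization.mk ℝ (refl u) hu' := by
  refine smul_mk_eq (r := 1) (plane_ext ?_ ?_) <;>
    simp [refl, genMat, matA, Matrix.GeneralLinearGroup.mkOfDetNeZero, Matrix.mulVec, dotProduct,
      Fin.sum_univ_two]

theorem genMat_B_mk (hu' : bvec u ≠ 0) : genMat c Gen.B • Projectivization.mk ℝ u hu =
    Projectivization.mk ℝ (bvec u) hu' := by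
  refine smul_mk_eq (r := 1) (plane_ext ?_ ?_) <;>
    simp [bvec, genMat, matB, Matrix.GeneralLinearGroup.mkOfDetNeZero, Matrix.mulVec, dotProduct,
      Fin.sum_univ_two]

theorem genMat_C_mk (hu' : lin c (refl u) ≠ 0) : genMat c Gen.C • Projectivization.mk ℝ u hu =
    Projectivization.mk ℝ (lin c (refl u)) hu' := by
  refine smul_mk_eq (r := 1) (plane_ext ?_ ?_) <;>
    simp [lin, refl, genMat, matC, Matrix.GeneralLinearGroup.mkOfDetNeZero, Matrix.mulVec,
      dotProduct, Fin.sum_univ_two]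
  ring

end

theorem bvec_ne_zero {u : Plane} (hu : u ≠ 0) : bvec u ≠ 0 := by
  intro h
  apply hu
  rw [← bvec_bvec u, h]
  apply plane_ext <;> simp [bvec]

theorem genMat_smul_smul (c : ℝ) (g : Gen) (θ : RP1) : genMat c g • genMat c g • θ = θ := by
  have := genMat_rel c _ (Rel.sq g)
  rw [map_mul, FreeGroup.lift_apply_of] at this
  rw [smul_smul, this, one_smul]

theorem HasSaddleConnection.genMat {c : ℝ} (hc : 1 ≤ c) {θ : RP1} (h : HasSaddleConnection c θ)
    (g : Gen) : HasSaddleConnection c (genMat c g • θ) := by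
  induction θ using Projectivization.ind with
  | h u hu =>
    rw [hasSaddleConnection_mk hc] at h
    cases g
    · rw [genMat_A_mk hu (refl_ne_zero hu), hasSaddleConnection_mk hc]
      exact h.refl
    · rw [genMat_B_mk hu (bvec_ne_zero hu), hasSaddleConnection_mk hc]
      exact h.bvec
    · rw [genMat_C_mk hu (lin_ne_zero (refl_ne_zero hu)), hasSaddleConnection_mk hc]
      exact h.refl.lin
    · rw [ParabolaSurface.genMat, neg_one_smul_RP1, hasSaddleConnection_mk hc]
      exact h

theorem hasSaddleConnection_genMat_iff {c : ℝ} (hc : 1 ≤ c) {θ : RP1} (g : Gen) :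
    HasSaddleConnection c (genMat c g • θ) ↔ HasSaddleConnection c θ := by
  refine ⟨fun h => ?_, fun h => h.genMat hc g⟩
  have := h.genMat hc g
  rwa [genMat_smul_smul] at this

theorem hasSaddleConnection_horizontal {c : ℝ} (hc : 1 ≤ c) :
    HasSaddleConnection c horizontal := by
  rw [horizontal, hasSaddleConnection_mk hc]
  simpa using InOrbit.horizontal (c := c) 1 one_ne_zero

theorem hasSaddleConnection_slopeOne {c : ℝ} (hc : 1 ≤ c) : HasSaddleConnection c slopeOne := by
  rw [slopeOne, hasSaddleConnection_mk hc]
  simpa using InOrbit.slopeOne (c := c) 1 one_ne_zero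

/-- Every direction of saddle connections is obtained from the horizontal direction or
the direction of slope one by the reflections `A`, `B`, `C`. -/
theorem HasSaddleConnection.induction {c : ℝ} (hc : 1 ≤ c) {P : RP1 → Prop} (h0 : P horizontal)
    (h1 : P slopeOne) (hg : ∀ g θ, P θ → P (ParabolaSurface.genMat c g • θ)) {θ : RP1}
    (h : HasSaddleConnection c θ) : P θ := by
  induction θ using Projectivization.ind with
  | h u hu =>
    rw [hasSaddleConnection_mk hc] at h
    induction h with
    | horizontal r hr => rwa [mk_eq_horizontal hu (by simp)]
    | slopeOne r hr =>
      have : Projectivization.mk ℝ _ hu = slopeOne := mk_eq_mk (r := r) rfl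
      rwa [this]
    | refl w _ ih =>
      have hw : w ≠ 0 := by
        rintro rfl
        exact hu (plane_ext (by simp [ParabolaSurface.refl]) (by simp [ParabolaSurface.refl]))
      rw [← genMat_A_mk (c := c) hw]
      exact hg _ _ (ih hw)
    | bvec w _ ih =>
      have hw : w ≠ 0 := by
        rintro rfl
        exact hu (plane_ext (by simp [ParabolaSurface.bvec]) (by simp [ParabolaSurface.bvec]))
      rw [← genMat_B_mk (c := c) hw]
      exact hg _ _ (ih hw)
    | lin w _ ih =>
      have hw : w ≠ 0 := by
        rintro rfl
        exact hu (plane_ext (by simp [ParabolaSurface.lin]) (by simp [ParabolaSurface.lin]))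
      have : Projectivization.mk ℝ _ hu = ParabolaSurface.genMat c Gen.C •
          ParabolaSurface.genMat c Gen.A • Projectivization.mk ℝ w hw := by
        rw [genMat_A_mk hw (refl_ne_zero hw),
          genMat_C_mk _ (by rw [refl_refl]; exact hu)]
        exact mk_eq_mk (r := 1) (by rw [refl_refl, one_smul])
      rw [this]
      exact hg _ _ (hg _ _ (ih hw))

theorem matD_eq : matD = matB * matA := by
  ext i j
  fin_cases i <;> fin_cases j <;>
    simp [matD, matA, matB, Matrix.GeneralLinearGroup.mkOfDetNeZero, Matrix.mul_apply,
      Fin.sum_univ_two]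

theorem matE_eq (c : ℝ) : matE c = -1 * (matC c * matB) := by
  ext i j
  fin_cases i <;> fin_cases j <;>
    simp [matE, matC, matB, Matrix.GeneralLinearGroup.mkOfDetNeZero] <;> ring

theorem matB_eq : matB = matD * matA := by
  ext i j
  fin_cases i <;> fin_cases j <;>
    simp [matD, matA, matB, Matrix.GeneralLinearGroup.mkOfDetNeZero, Matrix.mul_apply,
      Fin.sum_univ_two]

theorem matC_eq (c : ℝ) : matC c = -1 * (matE c * matB) := by
  ext i j
  fin_cases i <;> fin_cases j <;>
    simp [matE, matC, matB, Matrix.GeneralLinearGroup.mkOfDetNeZero] <;> ring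

theorem genMat_mem_matGroup (c : ℝ) (g : Gen) : genMat c g ∈ matGroup c := by
  have hneg : -1 ∈ matGroup c := Subgroup.subset_closure (by simp)
  have hA : matA ∈ matGroup c := Subgroup.subset_closure (by simp)
  have hD : matD ∈ matGroup c := Subgroup.subset_closure (by simp)
  have hE : matE c ∈ matGroup c := Subgroup.subset_closure (by simp)
  have hB : matB ∈ matGroup c := matB_eq ▸ mul_mem hD hA
  cases g
  · exact hA
  · exact hB
  · rw [genMat, matC_eq]
    exact mul_mem hneg (mul_mem hE hB)
  · exact hneg

theorem hasSaddleConnection_smul_iff {c : ℝ} (hc : 1 ≤ c) {G : GL (Fin 2) ℝ}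
    (hG : G ∈ matGroup c) (θ : RP1) :
    HasSaddleConnection c (G • θ) ↔ HasSaddleConnection c θ := by
  induction hG using Subgroup.closure_induction generalizing θ with
  | mem G hG =>
    rcases hG with rfl | rfl | rfl | rfl
    · rw [neg_one_smul_RP1]
    · exact hasSaddleConnection_genMat_iff hc Gen.A
    · rw [matD_eq, mul_smul]
      exact (hasSaddleConnection_genMat_iff hc Gen.B).trans
        (hasSaddleConnection_genMat_iff hc Gen.A)
    · rw [matE_eq, mul_smul, mul_smul, neg_one_smul_RP1]
      exact (hasSaddleConnection_genMat_iff hc Gen.C).trans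
        (hasSaddleConnection_genMat_iff hc Gen.B)
  | one => rw [one_smul]
  | mul G G' _ _ h h' => rw [mul_smul, h, h']
  | inv G _ h => rw [← h, smul_inv_smul]

theorem hasSaddleConnection_iff_mem_orbit {c : ℝ} (hc : 1 ≤ c) (θ : RP1) :
    HasSaddleConnection c θ ↔
      ∃ G ∈ matGroup c, θ = G • horizontal ∨ θ = G • slopeOne := by
  constructor
  · refine HasSaddleConnection.induction hc
      (P := fun θ => ∃ G ∈ matGroup c, θ = G • horizontal ∨ θ = G • slopeOne) ⟨1, one_mem _, .inl (one_smul _ _).symm⟩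
      ⟨1, one_mem _, .inr (one_smul _ _).symm⟩ ?_
    rintro g θ ⟨G, hG, h | h⟩
    · exact ⟨_, mul_mem (genMat_mem_matGroup c g) hG, .inl (by rw [mul_smul, h])⟩
    · exact ⟨_, mul_mem (genMat_mem_matGroup c g) hG, .inr (by rw [mul_smul, h])⟩
  · rintro ⟨G, hG, rfl | rfl⟩
    · exact (hasSaddleConnection_smul_iff hc hG _).2 (hasSaddleConnection_horizontal hc)
    · exact (hasSaddleConnection_smul_iff hc hG _).2 (hasSaddleConnection_slopeOne hc)

/-- Forward, `φ` fixes the horizontal direction and slope one and is equivariant. Backward, each of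
these two directions has a single preimage, and the generators are involutions on directions, so a
preimage can be moved along with its image. -/
theorem IsSemiconjugacy.hasSaddleConnection_iff {c : ℝ} (hc : 1 ≤ c) {φ : RP1 → RP1}
    (hφ : IsSemiconjugacy c φ) (θ : RP1) :
    HasSaddleConnection c θ ↔ HasSaddleConnection 1 (φ θ) := by
  constructor
  · refine HasSaddleConnection.induction hc (P := fun θ => HasSaddleConnection 1 (φ θ)) ?_ ?_ ?_
    · rw [hφ.map_horizontal]
      exact hasSaddleConnection_horizontal le_rfl
    · rw [← aff_one, hφ.map_aff_one hc, aff_one]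
      exact hasSaddleConnection_slopeOne le_rfl
    · intro g θ h
      rw [hφ.gen]
      exact h.genMat le_rfl g
  · intro h
    refine HasSaddleConnection.induction le_rfl
      (P := fun θ' => ∀ θ, φ θ = θ' → HasSaddleConnection c θ) ?_ ?_ ?_ h θ rfl
    · intro θ hθ
      rw [hφ.eq_horizontal hc hθ]
      exact hasSaddleConnection_horizontal hc
    · obtain ⟨f, rfl⟩ := hφ.exists_fun hc
      intro θ hθ
      rcases eq_horizontal_or_aff θ with rfl | ⟨x, rfl⟩
      · exact hasSaddleConnection_horizontal hc
      · rw [profileMap_aff, ← aff_one] at hθ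
        rw [(hφ.isProfile hc).map_eq_one hc (aff_injective hθ), aff_one]
        exact hasSaddleConnection_slopeOne hc
    · intro g θ' ih θ hθ
      rw [← hasSaddleConnection_genMat_iff hc g]
      refine ih _ ?_
      rw [hφ.gen, hθ, genMat_smul_smul]

end ParabolaSurface

open ParabolaSurface
theorem mainTheorem4 (c : ℝ) (hc : 1 < c) :
    -- there is exactly one semiconjugacy `φ_c`, and it detects the directions of saddle connections
    (∃! φ : RP1 → RP1, IsSemiconjugacy c φ) ∧
    (∀ φ : RP1 → RP1, IsSemiconjugacy c φ →
      ∀ θ : RP1, HasSaddleConnection c θ ↔ HasSaddleConnection 1 (φ θ)) ∧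
    -- these directions are the images of the horizontal and of the slope one direction
    (∀ θ : RP1, HasSaddleConnection c θ ↔
      ∃ G ∈ matGroup c, θ = G • horizontal ∨ θ = G • slopeOne) ∧
    -- canonical homeomorphisms exist, and identify the homotopy classes of saddle connections
    (∃ h : S c ≃ₜ S 1, IsCanonicalHomeo h) ∧
    (∀ h : S c ≃ₜ S 1, IsCanonicalHomeo h →
      (∀ (x y : S c) (σ : Path x y), IsSaddleConnection σ →
        ∃ σ' ∈ (fun γ : Path x y => γ.map h.continuous) '' homotopyClass σ,
          IsSaddleConnection σ') ∧
      (∀ (x y : S 1) (σ' : Path x y), IsSaddleConnection σ' →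
        ∃ σ ∈ (fun γ : Path x y => γ.map h.symm.continuous) '' homotopyClass σ',
          IsSaddleConnection σ)) := by
  have hc' : 1 ≤ c := hc.le
  refine ⟨existsUnique_isSemiconjugacy hc', fun φ hφ => hφ.hasSaddleConnection_iff hc',
    hasSaddleConnection_iff_mem_orbit hc', exists_isCanonicalHomeo hc', fun h hh => ?_⟩
  obtain ⟨g, g', hg, hg'⟩ := hh.induces
  exact ⟨fun x y σ hσ => exists_saddleConnection_of_induces hc' le_rfl h hg hg' hσ,
    fun x y σ hσ => exists_saddleConnection_of_induces le_rfl hc' h.symm hg' hg hσ⟩
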